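/- **Theorem (SyncPCN provides relationship anonymity).** Let $E=(\mathrm{KeyGen},\mathrm{Enc},\mathrm{Dec})$ be a perfectly correct, IND-CCA secure public-key encryption scheme, with ciphertexts padded so that their length depends only on the security parameter $n$ and the plaintext length. Let $\mathcal H=(\mathcal H_n)$, $\mathcal H_n:D_n\to R_n$, be an efficiently computable one-way family of homomorphisms of abelian groups, where $D_n$ is finite and efficiently samplable up to negligible statistical distance from uniform. Security means security against probabilistic polynomial-time (PPT) adversaries. Fix a finite payment channel network, with balances of the channels, public fees $f$ and timelock values $TL$ of the channels, and a timelock value $T_{\mathrm{end}}$ expected by each party when it is the receiver. Every party has an independent key pair of $E$. *Protocol (SyncPCN payment of value $v$ along a path $P_0,\dots,P_k$).* Let $f_j,TL_j$ be the fee and timelock value of the channel from $P_j$ to $P_{j+1}$. The sender $P_0$ samples independent $\ell_0,\dots,\ell_{k-1}\in D_n$ and sets $y_j=\sum_{i\le j}\ell_i$, $Y_j=\mathcal H_n(y_j)$, $v_i=v+\sum_{j=i+1}^{k-1}f_j$ and $T_i=T_{\mathrm{end}}(P_k)+\sum_{j=i+1}^{k-1}TL_j$. The payload of the intermediary $P_i$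 $(1\le i\le k-1)$ is $$M_i=\bigl(P_{i+1},\,v_i,\,(Y_{i-1},Y_i,\ell_i),\,T_i,\,\mathrm{Enc}_{pk_{i+1}}(M_{i+1})\bigr),$$ and $M_k=(v_{k-1},Y_{k-1},T_{k-1})$. *Locking:* each $P_i$, $0\le i\le k-1$, locks $v_i$ coins in its channel with $P_{i+1}$ and hands over $\mathrm{Enc}_{pk_{i+1}}(M_{i+1})$. An intermediary does so only after decrypting $M_i$ and checking that its balance is at least $v_i$, that $v_{i-1}-v_i\ge f_i$ and $T_{i-1}-T_i\ge TL_i$, and that $\mathcal H_n(\ell_i)+Y_{i-1}=Y_i$; the sender checks its balance, and the receiver checks $T_{k-1}\ge T_{\mathrm{end}}(P_k)$. *Payment:* the sender gives $y_{k-1}$ to the receiver. From the receiver backwards, $P_i$ receives $y_i$, checks $\mathcal H_n(y_i)=Y_i$, pays, and passes $y_{i-1}=y_i-\ell_i$ on, up to the sender. The payment is *successful* if all checks pass; messages are delivered in time. *Relationship anonymity game.* Let $C$ be a set of corrupted parties. The adversary $\mathcal A$ gets all public keys and the secret keys of $C$. It chooses a path segment $P_1,\dots,P_{k-1}$ containing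 at least one honest party, candidate senders $s^0,s^1$ and receivers $r^0,r^1$, and a value $v$. The candidates must be honest, every pair $(s^i,r^j)$ must give a simple path $s^i,P_1,\dots,P_{k-1},r^j$ in the network, and the fees and timelock values must be the same for both receivers. A uniform bit $b$ is drawn, and two simultaneous payments of value $v$ are made over the segment, from $s^0$ to $r^0$ and from $s^1$ to $r^1$ if $b=0$, and from $s^0$ to $r^1$ and from $s^1$ to $r^0$ if $b=1$. For each corrupted $P_i$, $\mathcal A$ gets the payload $M_i$ and the witness $y_i$ of both payments. The two payments are presented to $P_1$ in the order $s^0,s^1$ of their senders; a corrupted party keeps the order in which it got them, and an honest one forwards them in a fresh uniformly random order. $\mathcal A$ outputs $b'$ and wins if $b'=b$. If its choice is not admissible or one of the payments is not successful, then it wins with probability exactly $1/2$. *Claim.* For every set $C$ and every PPT adversary $\mathcal A$, the probability that $\mathcal A$ wins is $1/2+\epsilon(n)$, where $\epsilon$ is a negligible function of the security parameter $n$. -/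

import Mathlib

namespace SyncPCN

noncomputable section

/-! ## Bit strings -/

/-- Bit strings, the data on which all algorithms work. -/
abbrev Str := List Bool

/-- Self-delimiting pairing of strings: every bit of `x` is doubled, then `01`, then `y`. -/
def pairStr : Str → Str → Str
  | [], y => false :: true :: y
  | b :: x, y => b :: b :: pairStr x y

/-- Decoding of `pairStr` (with a default value on strings that are not pairs). -/
def unpairStr : Str → Str × Str
  | b :: c :: w => if b = c then (b :: (unpairStr w).1, (unpairStr w).2) else ([], w)
  | _ => ([], [])

theorem unpairStr_pairStr (x y : Str) : unpairStr (pairStr x y) = (x, y) := by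
  induction x with
  | nil => simp [pairStr, unpairStr]
  | cons b x ih => simp [pairStr, unpairStr, ih]

/-- A finite sequence of strings as one string. -/
def joinStr (l : List Str) : Str := l.foldr pairStr []

/-- The number `n` in unary, `1ⁿ`. -/
def unary (n : ℕ) : Str := List.replicate n true

/-- An optional string as a string: failure is the empty string. -/
def optStr : Option Str → Str
  | none => []
  | some m => true :: m

/-- `c` followed by `1 0 ... 0`, of total length `L + 1` if `c` has at most `L` bits. -/
def padStr (L : ℕ) (c : Str) : Str := c ++ true :: List.replicate (L - c.length) false

/-- Removal of the padding. -/
def unpadStr (c : Str) : Str := ((c.reverse.dropWhile (fun b => !b)).drop 1).reverse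

/-- The bit that an algorithm reports in its output string. -/
def bitOf (w : Str) : Bool := w.head? == some true

/-! ## Probabilistic algorithms with a step count -/

/-- A fair coin. -/
def coin : PMF Bool := PMF.uniformOfFintype Bool

/-- `k` independent samples. -/
def iid {α : Type} (p : PMF α) : (k : ℕ) → PMF (Fin k → α)
  | 0 => PMF.pure Fin.elim0
  | k + 1 => p.bind fun a => (iid p k).map fun f => Fin.cons a f

/-- Programs of a small structured language for probabilistic oracle algorithms on strings.
The only loop repeats its body a number of times that is fixed when the loop is entered, so that
every program halts; an algorithm that halts within a polynomial number of steps can always be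
written in this form, its loops being bounded by a clock. -/
inductive Prog : Type
  | id : Prog
  | const (w : Str) : Prog
  | comp (g f : Prog) : Prog
  | pair (f g : Prog) : Prog
  | fst : Prog
  | snd : Prog
  | push (b : Bool) : Prog
  | pop : Prog
  | isNil : Prog
  | cond (c f g : Prog) : Prog
  | loop (f : Prog) : Prog
  | toss : Prog
  | query : Prog

/-- A basic operation with input `x` and output `y` costs `1 + |x| + |y|` steps. -/
def basic (x y : Str) : PMF (Str × ℕ) := PMF.pure (y, 1 + x.length + y.length)

/-- Run `F` for `k` rounds, adding up the costs. -/
def rounds (F : Str → PMF (Str × ℕ)) : ℕ → Str → PMF (Str × ℕ)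
  | 0, w => PMF.pure (w, 0)
  | k + 1, w => (F w).bind fun a => (rounds F k a.1).map fun z => (z.1, a.2 + z.2 + 1)

/-- `run O P x` is the joint distribution of the output and of the number of steps of the program
`P` on the input `x` with the oracle `O`. -/
def run (O : Str → Str) : Prog → Str → PMF (Str × ℕ)
  | .id, x => basic x x
  | .const w, x => basic x w
  -- first `f`, then `g`
  | .comp g f, x => (run O f x).bind fun a => (run O g a.1).map fun z => (z.1, a.2 + z.2 + 1)
  -- both on the same input
  | .pair f g, x => (run O f x).bind fun a => (run O g x).map fun z =>
      (pairStr a.1 z.1, a.2 + z.2 + 1 + x.length + (pairStr a.1 z.1).length)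
  | .fst, x => basic x (unpairStr x).1
  | .snd, x => basic x (unpairStr x).2
  | .push b, x => basic x (b :: x)
  | .pop, x => basic x x.tail
  | .isNil, x => basic x [x.isEmpty]
  -- if `c` reports 1 on the input then `f`, else `g`
  | .cond c f g, x => (run O c x).bind fun a =>
      (if bitOf a.1 then run O f x else run O g x).map fun z => (z.1, a.2 + z.2 + 1 + x.length)
  -- on input `(u, w)`, apply `f` to `w` repeatedly, `|u|` times
  | .loop f, x => (rounds (run O f) (unpairStr x).1.length (unpairStr x).2).map fun z =>
      (z.1, z.2 + 1 + x.length)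
  | .toss, x => coin.bind fun b => basic x [b]
  -- on input `(u, q)`, submit `q` to the oracle and read the first `|u|` bits of the reply
  | .query, x => basic x ((O (unpairStr x).2).take (unpairStr x).1.length)

/-- The trivial oracle, for algorithms without oracle. -/
def noOracle : Str → Str := fun _ => []

/-- The output distribution. -/
def output (O : Str → Str) (P : Prog) (x : Str) : PMF Str := (run O P x).map Prod.fst

/-- Probabilistic polynomial time: a polynomial in the length of the input bounds the number of
steps, for every oracle and every outcome of the coin tosses. -/
def IsPPT (P : Prog) : Prop :=
  ∃ p : Polynomial ℕ, ∀ (O : Str → Str) (x : Str), ∀ z ∈ (run O P x).support,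
    z.2 ≤ p.eval x.length

/-- Negligible functions of the security parameter. -/
def Negligible (f : ℕ → ℝ) : Prop :=
  Asymptotics.SuperpolynomialDecay Filter.atTop (fun n : ℕ => (n : ℝ)) f

/-- A success probability that differs from `1/2` by a negligible amount. -/
def NegligibleAdvantage (game : ℕ → PMF Bool) : Prop :=
  Negligible fun n => (game n true).toReal - 1 / 2

/-! ## Public-key encryption -/

/-- A public-key encryption scheme. Key generation takes `1ⁿ` and returns `(pk, sk)`; encryption
takes `(1ⁿ, (pk, m))`; decryption is deterministic and may fail. -/
structure PKE where
  keyGen : Prog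
  enc : Prog
  dec : Str → Str → Option Str
  keyGen_ppt : IsPPT keyGen
  enc_ppt : IsPPT enc
  dec_ppt : ∃ P, IsPPT P ∧ ∀ sk c, output noOracle P (pairStr sk c) = PMF.pure (optStr (dec sk c))
  correct : ∀ n m, ∀ k ∈ (output noOracle keyGen (unary n)).support,
    ∀ c ∈ (output noOracle enc (pairStr (unary n) (pairStr (unpairStr k).1 m))).support,
      dec (unpairStr k).2 c = some m

namespace PKE

/-- A random key pair `(pk, sk)`. -/
def keys (E : PKE) (n : ℕ) : PMF (Str × Str) := (output noOracle E.keyGen (unary n)).map unpairStr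

/-- A random encryption of `m`. -/
def encrypt (E : PKE) (n : ℕ) (pk m : Str) : PMF Str :=
  output noOracle E.enc (pairStr (unary n) (pairStr pk m))

/-- The decryption oracle, which refuses the ciphertexts in `S`. -/
def decOracle (E : PKE) (sk : Str) (S : Set Str) : Str → Str :=
  open Classical in fun c => if c ∈ S then optStr none else optStr (E.dec sk c)

/-- The adaptive chosen-ciphertext game: `A₁` gets the public key and returns two messages and a
state, `A₂` gets the challenge ciphertext and the state. Both have a decryption oracle, which
refuses the challenge in the second phase. The result is true if the bit is guessed; messages of
different lengths only earn a fair coin. -/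
def ccaGame (E : PKE) (A₁ A₂ : Prog) (n : ℕ) : PMF Bool := do
  let k ← E.keys n
  let a ← output (E.decOracle k.2 ∅) A₁ (pairStr (unary n) k.1)
  let m₀ := (unpairStr a).1
  let m₁ := (unpairStr (unpairStr a).2).1
  let st := (unpairStr (unpairStr a).2).2
  if m₀.length = m₁.length then do
    let b ← coin
    let c ← E.encrypt n k.1 (if b then m₁ else m₀)
    let g ← output (E.decOracle k.2 {c}) A₂ (pairStr (unary n) (pairStr c st))
    pure (bitOf g == b)
  else coin

/-- IND-CCA security. -/
def INDCCA (E : PKE) : Prop :=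
  ∀ A₁ A₂ : Prog, IsPPT A₁ → IsPPT A₂ → NegligibleAdvantage (E.ccaGame A₁ A₂)

end PKE

/-- A rule for padding ciphertexts to a common length: `len n m` is an efficiently computable
upper bound for the length of the encryptions of messages of `m` bits. -/
structure Padding (E : PKE) where
  len : ℕ → ℕ → ℕ
  prog : Prog
  prog_ppt : IsPPT prog
  prog_spec : ∀ n m, output noOracle prog (pairStr (unary n) (unary m)) = PMF.pure (unary (len n m))
  bound : ∀ n m, ∀ k ∈ (E.keys n).support, ∀ c ∈ (E.encrypt n k.1 m).support,
    c.length ≤ len n m.length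

/-! ## Homomorphic one-way functions -/

/-- An efficiently computable family of homomorphisms `H` of abelian groups, with finite domains
from which one can efficiently sample, up to a negligible statistical error uniformly. Group
elements are encoded by strings of a fixed length. -/
structure HomFun where
  D : ℕ → Type
  R : ℕ → Type
  [instD : ∀ n, AddCommGroup (D n)]
  [instR : ∀ n, AddCommGroup (R n)]
  [finD : ∀ n, Fintype (D n)]
  H : ∀ n, D n →+ R n
  encD : ∀ n, D n → Str
  encR : ∀ n, R n → Str
  encD_inj : ∀ n, Function.Injective (encD n)
  encR_inj : ∀ n, Function.Injective (encR n)
  lenD : ℕ → ℕ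
  lenR : ℕ → ℕ
  encD_length : ∀ n x, (encD n x).length = lenD n
  encR_length : ∀ n x, (encR n x).length = lenR n
  sample : ∀ n, PMF (D n)
  sampleProg : Prog
  sample_ppt : IsPPT sampleProg
  sample_spec : ∀ n, output noOracle sampleProg (unary n) = (sample n).map (encD n)
  sample_uniform : Negligible fun n =>
    ∑ x : D n, |(sample n x).toReal - 1 / (Fintype.card (D n) : ℝ)|
  addProg : Prog
  add_ppt : IsPPT addProg
  add_spec : ∀ n x y, output noOracle addProg (pairStr (unary n) (pairStr (encD n x) (encD n y)))
    = PMF.pure (encD n (x + y))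
  evalProg : Prog
  eval_ppt : IsPPT evalProg
  eval_spec : ∀ n x, output noOracle evalProg (pairStr (unary n) (encD n x))
    = PMF.pure (encR n (H n x))

attribute [instance] HomFun.instD HomFun.instR HomFun.finD

/-- The inversion game: find a preimage of `H x` for a random `x`. -/
def HomFun.invertGame (F : HomFun) (A : Prog) (n : ℕ) : PMF Bool :=
  open Classical in do
  let x ← F.sample n
  let a ← output noOracle A (pairStr (unary n) (F.encR n (F.H n x)))
  pure (decide (∃ x', F.encD n x' = a ∧ F.H n x' = F.H n x))

/-- One-wayness. -/
def HomFun.OneWay (F : HomFun) : Prop :=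
  ∀ A : Prog, IsPPT A → Negligible fun n => (F.invertGame A n true).toReal

/-! ## Payment channel networks -/

/-- A payment channel network with parties `0, ..., N - 1`. -/
structure Network where
  N : ℕ
  /-- The open channels. -/
  chan : SimpleGraph (Fin N)
  /-- `bal P Q` is the balance of `P` in its channel with `Q`. -/
  bal : Fin N → Fin N → ℕ
  /-- The public fee for forwarding over the channel from `P` to `Q`. -/
  fee : Fin N → Fin N → ℕ
  /-- The public timelock value of the channel from `P` to `Q`. -/
  lock : Fin N → Fin N → ℕ
  /-- The timelock value that a party expects when it is the receiver. -/
  endLock : Fin N → ℕ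

/-- Identifier of a party, as a string of length `N`. -/
def partyStr {N : ℕ} (P : Fin N) : Str := List.ofFn fun j => decide (j = P)

section Protocol

variable (F : HomFun) (net : Network) (n : ℕ)

/-- A conditional payment `(v, Y, T)`. -/
structure CondPay where
  amount : ℕ
  cond : F.R n
  time : ℕ

/-- The payload `M_i = (P_{i+1}, v_i, (Y_{i-1}, Y_i, ℓ_i), T_i, E(M_{i+1}))` of an intermediary. -/
structure HopMsg where
  next : Fin net.N
  amount : ℕ
  condIn : F.R n
  condOut : F.R n
  secret : F.D n
  time : ℕ
  onion : Str

/-- Payloads: that of an intermediary, or that of the receiver, which describes the conditional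
payment of the last channel. -/
inductive Payload where
  | hop (M : HopMsg F net n)
  | last (cp : CondPay F n)

variable {F net n}

/-- Payloads as strings. -/
def Payload.toStr : Payload F net n → Str
  | .hop M => true :: pairStr (partyStr M.next) (pairStr (Nat.bits M.amount)
      (pairStr (F.encR n M.condIn) (pairStr (F.encR n M.condOut)
        (pairStr (F.encD n M.secret) (pairStr (Nat.bits M.time) M.onion)))))
  | .last cp => false :: pairStr (Nat.bits cp.amount)
      (pairStr (F.encR n cp.cond) (Nat.bits cp.time))

open Classical in
/-- The payload that a string represents, if any. -/
def Payload.ofStr (w : Str) : Option (Payload F net n) :=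
  if h : ∃ M : Payload F net n, M.toStr = w then some h.choose else none

variable (F net n)

/-! ### Setup by the sender

The path is `P₀, ..., P_k`, with channel `i` from `P_i` to `P_{i+1}`; `ℓ₀, ..., ℓ_{k-1}` are the
random secrets of the sender. -/

/-- `y_j = ℓ₀ + ... + ℓ_j`. -/
def witness (ℓ : ℕ → F.D n) (j : ℕ) : F.D n := ∑ i ∈ Finset.range (j + 1), ℓ i

/-- `v_i = v + f_{i+1} + ... + f_{k-1}`. -/
def amountAt (path : ℕ → Fin net.N) (k v i : ℕ) : ℕ :=
  v + ∑ j ∈ Finset.Ioo i k, net.fee (path j) (path (j + 1))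

/-- `T_i = TL_{i+1} + ... + TL_{k-1}`, plus the timelock value expected by the receiver. -/
def timeAt (path : ℕ → Fin net.N) (k i : ℕ) : ℕ :=
  ∑ j ∈ Finset.Ioo i k, net.lock (path j) (path (j + 1)) + net.endLock (path k)

/-- The conditional payment of channel `i`, with condition `Y_i = H(y_i)`. -/
def condPay (path : ℕ → Fin net.N) (k v : ℕ) (ℓ : ℕ → F.D n) (i : ℕ) : CondPay F n where
  amount := amountAt net path k v i
  cond := F.H n (witness F n ℓ i)
  time := timeAt net path k i

/-- The payload `M_i` of the intermediary `P_i`, for a given encryption of `M_{i+1}`. -/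
def hopMsg (path : ℕ → Fin net.N) (k v : ℕ) (ℓ : ℕ → F.D n) (i : ℕ) (onion : Str) :
    HopMsg F net n where
  next := path (i + 1)
  amount := amountAt net path k v i
  condIn := F.H n (witness F n ℓ (i - 1))
  condOut := F.H n (witness F n ℓ i)
  secret := ℓ i
  time := timeAt net path k i
  onion := onion

variable (E : PKE) (pad : Padding E)

/-- Encryption followed by padding to the common length. -/
def encryptPad (pk m : Str) : PMF Str :=
  (E.encrypt n pk m).map (padStr (pad.len n m.length))

/-- `onionAt d i` is the layered encryption `E(M_i)` for the party `P_i` at distance `d = k - i`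
from the receiver. -/
def onionAt (pk : Fin net.N → Str) (path : ℕ → Fin net.N) (k v : ℕ) (ℓ : ℕ → F.D n) :
    ℕ → ℕ → PMF Str
  | 0, i => encryptPad n E pad (pk (path i))
      (Payload.last (net := net) (condPay F net n path k v ℓ (i - 1))).toStr
  | d + 1, i => (onionAt pk path k v ℓ d (i + 1)).bind fun c =>
      encryptPad n E pad (pk (path i)) (Payload.hop (hopMsg F net n path k v ℓ i c)).toStr

/-- What the sender prepares: the conditional payment of the first channel, the encryption of `M₁`,
and the witness `y_{k-1}` for the receiver. -/
structure Setup where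
  cp : CondPay F n
  onion : Str
  wit : F.D n

/-- The setup phase for a payment of value `v` on the path `P₀, ..., P_k`. -/
def setup (pk : Fin net.N → Str) (path : ℕ → Fin net.N) (k v : ℕ) : PMF (Setup F n) := do
  let r ← iid (F.sample n) k
  let ℓ : ℕ → F.D n := fun i => if h : i < k then r ⟨i, h⟩ else 0
  let c ← onionAt F net n E pad pk path k v ℓ (k - 1) 1
  pure ⟨condPay F net n path k v ℓ 0, c, witness F n ℓ (k - 1)⟩

/-! ### Locking and payment -/

/-- Coins of `P` in its channel with `Q` become locked. -/
def lockCoins (bal : Fin net.N → Fin net.N → ℕ) (P Q : Fin net.N) (v : ℕ) :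
    Fin net.N → Fin net.N → ℕ :=
  fun P' Q' => if P' = P ∧ Q' = Q then bal P' Q' - v else bal P' Q'

/-- The checks of an intermediary `P` before it locks coins for the next hop: there is a channel
with enough balance, the fee and the timelock difference are as expected, and
`H(ℓ_i) + Y_{i-1} = Y_i`. -/
def accepts (bal : Fin net.N → Fin net.N → ℕ) (P : Fin net.N) (prev : CondPay F n)
    (M : HopMsg F net n) : Prop :=
  net.chan.Adj P M.next ∧ M.amount ≤ bal P M.next ∧
    M.amount + net.fee P M.next ≤ prev.amount ∧ M.time + net.lock P M.next ≤ prev.time ∧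
    M.condIn = prev.cond ∧ F.H n M.secret + prev.cond = M.condOut

open Classical in
/-- The locking phase from the party `P` on, which has been offered the conditional payment `prev`
and sent the ciphertext `c`; the first argument bounds the number of hops. The result is the
receiver, the new balances, and the payloads of the intermediaries in the order of the path. -/
def lockFrom (sk : Fin net.N → Str) : ℕ → (Fin net.N → Fin net.N → ℕ) → Fin net.N → CondPay F n →
    Str → Option (Fin net.N × (Fin net.N → Fin net.N → ℕ) × List (Fin net.N × HopMsg F net n))
  | 0, _, _, _, _ => none
  | fuel + 1, bal, P, prev, c =>
    match (E.dec (sk P) (unpadStr c)).bind (Payload.ofStr (F := F) (net := net) (n := n)) with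
    | none => none
    | some (.last _) => if net.endLock P ≤ prev.time then some (P, bal, []) else none
    | some (.hop M) =>
      if accepts F net n bal P prev M then
        (lockFrom sk fuel (lockCoins net bal P M.next M.amount) M.next
          ⟨M.amount, M.condOut, M.time⟩ M.onion).map fun z => (z.1, z.2.1, (P, M) :: z.2.2)
      else none

open Classical in
/-- The locking phase of a payment from `s` to `r` whose first intermediary is `P₁`. -/
def lockPhase (sk : Fin net.N → Str) (bal : Fin net.N → Fin net.N → ℕ) (s P₁ r : Fin net.N)
    (S : Setup F n) :
    Option ((Fin net.N → Fin net.N → ℕ) × List (Fin net.N × HopMsg F net n)) :=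
  if net.chan.Adj s P₁ ∧ S.cp.amount ≤ bal s P₁ then
    (lockFrom F net n E sk net.N (lockCoins net bal s P₁ S.cp.amount) P₁ S.cp S.onion).bind
      fun z => if z.1 = r then some z.2 else none
  else none

/-- What an intermediary `P_i` holds after a successful payment: its payload `M_i` and the witness
`y_i` that it received from its successor. -/
structure Entry where
  party : Fin net.N
  msg : HopMsg F net n
  wit : F.D n

open Classical in
/-- The payment phase: the witness travels from the receiver backwards; `P_i` checks
`H(y_i) = Y_i` and passes `y_{i-1} = y_i - ℓ_i` on. The result is the witness that the first party
of the list passes on, with what the parties hold at the end. -/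
def payBack (y : F.D n) :
    List (Fin net.N × HopMsg F net n) → Option (F.D n × List (Entry F net n))
  | [] => some (y, [])
  | (P, M) :: l => (payBack y l).bind fun z =>
      if F.H n z.1 = M.condOut then some (z.1 - M.secret, ⟨P, M, z.1⟩ :: z.2) else none

open Classical in
/-- The payment phase, with the final check `H(y₀) = Y₀` by the sender. -/
def payPhase (S : Setup F n) (l : List (Fin net.N × HopMsg F net n)) :
    Option (List (Entry F net n)) :=
  (payBack F net n S.wit l).bind fun z => if F.H n z.1 = S.cp.cond then some z.2 else none

/-! ### The relationship anonymity game -/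

/-- The choice of the adversary: candidate senders `s⁰, s¹`, candidate receivers `r⁰, r¹`, the value
of the two payments, and the shared path segment. -/
structure Choice where
  s : Bool → Fin net.N
  r : Bool → Fin net.N
  value : ℕ
  seg : List (Fin net.N)

variable {net} in
/-- Choices as strings. -/
def Choice.toStr (c : Choice net) : Str :=
  joinStr ([partyStr (c.s false), partyStr (c.s true), partyStr (c.r false), partyStr (c.r true),
    Nat.bits c.value] ++ c.seg.map partyStr)

open Classical in
/-- The choice that a string represents, if any. -/
def Choice.ofStr (w : Str) : Option (Choice net) :=
  if h : ∃ c : Choice net, c.toStr = w then some h.choose else none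

variable {net} in
/-- The choice is legal for the set `C` of corrupted parties: some party of the segment is honest,
the candidate endpoints are honest, every combination of a sender and a receiver gives a simple
path in the network, and the fees and timelocks for both receivers agree. -/
def Choice.Legal (c : Choice net) (C : Finset (Fin net.N)) : Prop :=
  (∃ P ∈ c.seg, P ∉ C) ∧ (∀ i, c.s i ∉ C ∧ c.r i ∉ C) ∧
  (∀ i j, (c.s i :: c.seg ++ [c.r j]).Nodup ∧
    (c.s i :: c.seg ++ [c.r j]).IsChain net.chan.Adj) ∧
  (∀ P ∈ c.seg.getLast?, net.fee P (c.r false) = net.fee P (c.r true) ∧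
    net.lock P (c.r false) = net.lock P (c.r true)) ∧
  net.endLock (c.r false) = net.endLock (c.r true)

variable {net} in
/-- The path from `sⁱ` to `rʲ` over the segment, as a sequence `P₀, ..., P_k`. -/
def Choice.path (c : Choice net) (i j : Bool) (t : ℕ) : Fin net.N :=
  (c.s i :: c.seg ++ [c.r j]).getD t (c.s i)

/-- The payload and the witness of one payment, as a string. -/
def Entry.toStr {F : HomFun} {net : Network} {n : ℕ} (e : Entry F net n) : Str :=
  pairStr (Payload.hop e.msg).toStr (F.encD n e.wit)

/-- The view of the corrupted parties, from the entries of both payments along the segment. The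
bit `τ` tells whether the two payments are currently presented in swapped order. The first party
gets them in the order of their senders `s⁰, s¹`, a corrupted party keeps the order, and an honest
party forwards the two payments in random order. -/
def view (C : Finset (Fin net.N)) : Bool → List (Entry F net n) → List (Entry F net n) →
    PMF (List Str)
  | τ, a :: as, b :: bs =>
    if a.party ∈ C then
      (view C τ as bs).map fun w =>
        (if τ then pairStr b.toStr a.toStr else pairStr a.toStr b.toStr) :: w
    else coin.bind fun τ' => view C τ' as bs
  | _, _, _ => PMF.pure []

/-- Two simultaneous payments over the segment. For `b = 0` they go from `s⁰` to `r⁰` and from `s¹` to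
`r¹`; for `b = 1` they go from `s⁰` to `r¹` and from `s¹` to `r⁰`. The result is what the
intermediaries hold if both payments are successful. -/
def twoPayments (keys : Fin net.N → Str × Str) (c : Choice net) (b : Bool) :
    PMF (Option (List (Entry F net n) × List (Entry F net n))) := do
  let pk := fun P => (keys P).1
  let sk := fun P => (keys P).2
  let k := c.seg.length + 1
  let p₀ := c.path false b
  let p₁ := c.path true (!b)
  let S₀ ← setup F net n E pad pk p₀ k c.value
  let S₁ ← setup F net n E pad pk p₁ k c.value
  pure ((lockPhase F net n E sk net.bal (p₀ 0) (p₀ 1) (p₀ k) S₀).bind fun l₀ =>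
    (lockPhase F net n E sk l₀.1 (p₁ 0) (p₁ 1) (p₁ k) S₁).bind fun l₁ =>
      (payPhase F net n S₀ l₀.2).bind fun e₀ => (payPhase F net n S₁ l₁.2).map fun e₁ => (e₀, e₁))

open Classical in
/-- The relationship anonymity game. Every party has a key pair; `A₁` gets the public keys and the
secret keys of the corrupted parties in `C` and returns a choice and a state; `A₂` gets the view of
the corrupted parties and the state. The result is true if the bit is guessed; an illegal choice
or an unsuccessful payment only earns a fair coin. -/
def anonymityGame (C : Finset (Fin net.N)) (A₁ A₂ : Prog) : PMF Bool := do
  let keys ← iid (E.keys n) net.N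
  let pks := joinStr (List.ofFn fun P => (keys P).1)
  let sks := joinStr (List.ofFn fun P => if P ∈ C then (keys P).2 else [])
  let a ← output noOracle A₁ (pairStr (unary n) (pairStr pks sks))
  match Choice.ofStr net (unpairStr a).1 with
  | none => coin
  | some c =>
    if c.Legal C then do
      let b ← coin
      let res ← twoPayments F net n E pad keys c b
      match res with
      | none => coin
      | some e => do
        let w ← view F net n C false e.1 e.2
        let g ← output noOracle A₂ (pairStr (unary n) (pairStr (joinStr w) (unpairStr a).2))
        pure (bitOf g == b)
    else coin

end Protocol

/-- The multi-hop payment protocol, with encryption scheme `E` and homomorphic function `F` on the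
network `net`, satisfies relationship anonymity: for every set of corrupted parties and every
probabilistic polynomial-time adversary, the probability of winning the game is `1/2` up to a
negligible amount. -/
def RelationshipAnonymity (E : PKE) (pad : Padding E) (F : HomFun) (net : Network) : Prop :=
  ∀ (C : Finset (Fin net.N)) (A₁ A₂ : Prog), IsPPT A₁ → IsPPT A₂ →
    NegligibleAdvantage fun n => anonymityGame F net n E pad C A₁ A₂

end

end SyncPCN

namespace SyncPCN

noncomputable section

/-! ## Success probabilities -/

/-! Fix an honest party `P_h` of the segment. What corrupted parties see before `P_h` and what they
see after it are linked only by the ciphertext for `P_h`, by the secret group elements and by the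
order of the two payments. All three links can be cut, and then nothing tells which front part
belongs to which back part. As the receiver influences only the back part, exchanging back parts is
the same as exchanging receivers.

Ciphertext: IND-CCA security allows the plaintext `M_h` to be replaced by zeros, in one payment
after the other (`negligible_payExp_sub`, `negligible_twoExp_sub`). The reduction gives the
challenge key to `P_h` and draws all other keys itself; it makes no decryption queries. The number
of zeros is the same for all endpoints, since padding makes the length of every layer independent of
the randomness and legality equates amounts and timelocks (`length_eq_of_mem_trace`).

Group elements: the front involves only `ℓ_t` with `t < h`, the back only `y_h` and `ℓ_t` with `t >
h`. Once `M_h` is hidden, `ℓ_h` occurs only inside `y_h`, where it acts as a one-time pad: up to the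
sampling error, `y_h` is uniform and independent of the front (`abs_prob_twoParts_swap_le`).

Order: `P_h` forwards in a fresh random order, so the view splits at `P_h` and its second part is
symmetric in the two payments (`viewStr_append`, `coin_bind_viewStr_swap`). Together these facts
give `negligible_twoExp_swap`.

It remains to pass from a fixed choice to the game. By perfect correctness, success of the payments
is decided by balances alone (`setup_bind_setup_eq`), and it does not depend on the secret bit
(`Choice.Legal.feasible_false_iff_true`). As the network is fixed, only finitely many choices are
feasible, the same for all `n` (`finite_feasible`). The advantage is thus a finite sum over choices
`c` of half the difference of two experiments in which `c` is hard-wired and only runs announcing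
`c` count (`prob_gameAfter`).

Efficiency of the reductions is proved compositionally: `Real` and `Det` are closed under the
operations from which the reductions are built. -/

theorem pmf_bind_congr {α β : Type*} {p : PMF α} {f g : α → PMF β}
    (h : ∀ a ∈ p.support, f a = g a) : p.bind f = p.bind g := by
  ext b
  simp only [PMF.bind_apply]
  refine tsum_congr fun a => ?_
  by_cases ha : p a = 0
  · simp [ha]
  · rw [h a ((p.mem_support_iff a).2 ha)]

/-- The probability that a random bit is true. -/
def prob (p : PMF Bool) : ℝ := (p true).toReal

theorem prob_nonneg (p : PMF Bool) : 0 ≤ prob p := ENNReal.toReal_nonneg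

theorem prob_le_one (p : PMF Bool) : prob p ≤ 1 :=
  ENNReal.toReal_mono ENNReal.one_ne_top (p.coe_le_one true)

theorem prob_pure (b : Bool) : prob (PMF.pure b) = if b then 1 else 0 := by
  cases b <;> simp [prob, PMF.pure_apply]

theorem summable_toReal {α : Type*} (p : PMF α) : Summable fun a => (p a).toReal :=
  ENNReal.summable_toReal p.tsum_coe_ne_top

theorem tsum_toReal {α : Type*} (p : PMF α) : ∑' a, (p a).toReal = 1 := by
  rw [← ENNReal.tsum_toReal_eq fun a => p.apply_ne_top a, p.tsum_coe, ENNReal.toReal_one]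

theorem prob_bind {α : Type*} (p : PMF α) (f : α → PMF Bool) :
    prob (p.bind f) = ∑' a, (p a).toReal * prob (f a) := by
  rw [prob, PMF.bind_apply, ENNReal.tsum_toReal_eq
    fun a => ENNReal.mul_ne_top (p.apply_ne_top a) ((f a).apply_ne_top true)]
  simp [prob, ENNReal.toReal_mul]

theorem summable_mul_prob {α : Type*} (p : PMF α) (f : α → PMF Bool) :
    Summable fun a => (p a).toReal * prob (f a) :=
  Summable.of_nonneg_of_le (fun _ => mul_nonneg ENNReal.toReal_nonneg (prob_nonneg _))
    (fun _ => mul_le_of_le_one_right ENNReal.toReal_nonneg (prob_le_one _)) (summable_toReal p)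

theorem prob_bind_bool (p : PMF Bool) (f : Bool → PMF Bool) :
    prob (p.bind f) = prob p * prob (f true) + (1 - prob p) * prob (f false) := by
  have h := tsum_toReal p
  rw [tsum_bool] at h
  rw [prob_bind, tsum_bool, ← h]
  simp only [prob]
  ring

theorem prob_coin : prob coin = 1 / 2 := by
  simp [prob, coin, PMF.uniformOfFintype_apply]

theorem prob_coin_bind (f : Bool → PMF Bool) :
    prob (coin.bind f) = (prob (f true) + prob (f false)) / 2 := by
  rw [prob_bind_bool, prob_coin]
  ring

/-- If a success probability is `1/2` plus a combination of others conditionally on `a`, then also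
on average. -/
theorem prob_bind_eq_half_add {α ι : Type*} (p : PMF α) (S : Finset ι) (f : α → PMF Bool)
    (g g' : ι → α → PMF Bool)
    (h : ∀ a ∈ p.support, prob (f a) = 1 / 2 + ∑ c ∈ S, (prob (g c a) - prob (g' c a)) / 2) :
    prob (p.bind f) =
      1 / 2 + ∑ c ∈ S, (prob (p.bind (g c)) - prob (p.bind (g' c))) / 2 := by
  have key : ∀ a, (p a).toReal * prob (f a) = (p a).toReal * (1 / 2) +
      ∑ c ∈ S, ((p a).toReal * prob (g c a) - (p a).toReal * prob (g' c a)) / 2 := by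
    intro a
    by_cases ha : p a = 0
    · simp [ha]
    · rw [h a ((p.mem_support_iff a).2 ha), mul_add, Finset.mul_sum]
      congr 1
      refine Finset.sum_congr rfl fun c _ => ?_
      ring
  have hs : ∀ c ∈ S, Summable fun a =>
      ((p a).toReal * prob (g c a) - (p a).toReal * prob (g' c a)) / 2 := fun c _ =>
    ((summable_mul_prob p _).sub (summable_mul_prob p _)).div_const 2
  rw [prob_bind, tsum_congr key, Summable.tsum_add ((summable_toReal p).mul_right _)
    (summable_sum hs), tsum_mul_right, tsum_toReal, one_mul, Summable.tsum_finsetSum hs]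
  congr 1
  refine Finset.sum_congr rfl fun c _ => ?_
  rw [tsum_div_const, (summable_mul_prob p _).tsum_sub (summable_mul_prob p _), prob_bind, prob_bind]

/-- A bound that is uniform in a shared random value survives averaging over it. This permits fixing
the keys and the adversary's first output before two experiments are compared. -/
theorem abs_prob_bind_sub_le {α : Type*} (p : PMF α) (f g : α → PMF Bool) (ε : ℝ)
    (h : ∀ a ∈ p.support, |prob (f a) - prob (g a)| ≤ ε) :
    |prob (p.bind f) - prob (p.bind g)| ≤ ε := by
  rw [prob_bind, prob_bind, ← (summable_mul_prob p _).tsum_sub (summable_mul_prob p _)]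
  have hb : ∀ a, ‖(p a).toReal * prob (f a) - (p a).toReal * prob (g a)‖ ≤ (p a).toReal * ε := by
    intro a
    by_cases ha : p a = 0
    · simp [ha]
    · rw [← mul_sub, norm_mul, Real.norm_of_nonneg ENNReal.toReal_nonneg]
      exact mul_le_mul_of_nonneg_left (h a ((p.mem_support_iff a).2 ha)) ENNReal.toReal_nonneg
  have := tsum_of_norm_bounded ((summable_toReal p).mul_right ε).hasSum hb
  rwa [tsum_mul_right, tsum_toReal, one_mul] at this

theorem abs_prob_bind_sub_le_sum {α : Type*} [Fintype α] (p q : PMF α) (f : α → PMF Bool) :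
    |prob (p.bind f) - prob (q.bind f)| ≤ ∑ a, |(p a).toReal - (q a).toReal| := by
  rw [prob_bind, prob_bind, tsum_fintype, tsum_fintype, ← Finset.sum_sub_distrib]
  refine (Finset.abs_sum_le_sum_abs _ _).trans (Finset.sum_le_sum fun a _ => ?_)
  rw [← sub_mul, abs_mul, abs_of_nonneg (prob_nonneg _)]
  exact mul_le_of_le_one_right (abs_nonneg _) (prob_le_one _)

/-! ## Independent samples -/

theorem iid_succ_bind {α β : Type} (p : PMF α) (k : ℕ) (f : (Fin (k + 1) → α) → PMF β) :
    (iid p (k + 1)).bind f = p.bind fun a => (iid p k).bind fun r => f (Fin.cons a r) := by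
  simp [iid, PMF.bind_bind, PMF.bind_map, Function.comp_def]

/-- One of the samples may be drawn separately. -/
theorem iid_bind_update {α β : Type} (p : PMF α) (k : ℕ) (h : Fin k)
    (f : (Fin k → α) → PMF β) :
    (iid p k).bind f = p.bind fun x => (iid p k).bind fun r => f (Function.update r h x) := by
  induction k with
  | zero => exact h.elim0
  | succ k ih =>
    simp only [iid_succ_bind]
    refine Fin.cases ?_ (fun j => ?_) h
    -- The sample that is overwritten has no effect, so its draw disappears.
    · simp only [Fin.update_cons_zero, PMF.bind_const]
    · rw [PMF.bind_comm p p]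
      simp only [← Fin.cons_update]
      congr 1
      funext a
      exact ih j fun r => f (Fin.cons a r)

/-- Two families of samples may exchange some of their members. -/
theorem iid_bind_swap {α β : Type} (p : PMF α) (k : ℕ) (s : Fin k → Prop) [DecidablePred s]
    (f : (Fin k → α) → (Fin k → α) → PMF β) :
    ((iid p k).bind fun r => (iid p k).bind fun r' => f r r') =
      (iid p k).bind fun r => (iid p k).bind fun r' =>
        f (fun i => if s i then r' i else r i) (fun i => if s i then r i else r' i) := by
  induction k with
  | zero =>
    simp only [iid, PMF.pure_bind]
    congr 1 <;> exact Subsingleton.elim _ _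
  | succ k ih =>
    simp only [iid_succ_bind]
    have e : ∀ F : α → (Fin k → α) → α → (Fin k → α) → PMF β,
        (p.bind fun a => (iid p k).bind fun r => p.bind fun a' => (iid p k).bind fun r' =>
          F a r a' r') =
        p.bind fun a => p.bind fun a' => (iid p k).bind fun r => (iid p k).bind fun r' =>
          F a r a' r' := by
      intro F
      congr 1
      funext a
      rw [PMF.bind_comm]
    rw [e, e]
    have c : ∀ (x y : α) (u w : Fin k → α),
        (fun i => if s i then (Fin.cons y w : Fin (k + 1) → α) i
          else (Fin.cons x u : Fin (k + 1) → α) i) =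
        Fin.cons (if s 0 then y else x) (fun i : Fin k => if s i.succ then w i else u i) := by
      intro x y u w
      funext i
      refine Fin.cases ?_ (fun j => ?_) i <;> simp
    simp only [c]
    -- If the first members are exchanged, commuting their two draws undoes the exchange.
    by_cases h0 : s 0
    · simp only [h0, if_true]
      rw [PMF.bind_comm p p]
      congr 1; funext a; congr 1; funext a'
      exact ih (fun i => s i.succ) fun r r' => f (Fin.cons a' r) (Fin.cons a r')
    · simp only [h0, if_false]
      congr 1; funext a; congr 1; funext a'
      exact ih (fun i => s i.succ) fun r r' => f (Fin.cons a r) (Fin.cons a' r')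

theorem mem_support_of_mem_iid {α : Type} {p : PMF α} {k : ℕ} {r : Fin k → α}
    (hr : r ∈ (iid p k).support) (i : Fin k) : r i ∈ p.support := by
  induction k with
  | zero => exact i.elim0
  | succ k ih =>
    simp only [iid, PMF.mem_support_bind_iff, PMF.support_map, Set.mem_image] at hr
    obtain ⟨a, ha, t, ht, rfl⟩ := hr
    refine Fin.cases ?_ (fun j => ?_) i
    · simpa using ha
    · simpa using ih ht j

/-- The uniform distribution on an abelian group is invariant under translations. -/
theorem uniform_bind_sub {G β : Type} [AddCommGroup G] [Fintype G] (y : G) (f : G → PMF β) :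
    ((PMF.uniformOfFintype G).bind fun u => f (u - y)) = (PMF.uniformOfFintype G).bind f := by
  ext b
  simp only [PMF.bind_apply, PMF.uniformOfFintype_apply]
  exact (Equiv.subRight y).tsum_eq fun u => (Fintype.card G : ENNReal)⁻¹ * f u b

/-! ## Negligible functions -/

theorem Negligible.add {f g : ℕ → ℝ} (hf : Negligible f) (hg : Negligible g) :
    Negligible fun n => f n + g n :=
  Asymptotics.SuperpolynomialDecay.add hf hg

theorem Negligible.const_mul {f : ℕ → ℝ} (hf : Negligible f) (c : ℝ) :
    Negligible fun n => c * f n :=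
  Asymptotics.SuperpolynomialDecay.const_mul hf c

theorem Negligible.sub {f g : ℕ → ℝ} (hf : Negligible f) (hg : Negligible g) :
    Negligible fun n => f n - g n := by
  simpa [sub_eq_add_neg] using hf.add (hg.const_mul (-1))

theorem Negligible.sum {ι : Type*} {f : ι → ℕ → ℝ} (S : Finset ι)
    (h : ∀ c ∈ S, Negligible (f c)) : Negligible fun n => ∑ c ∈ S, f c n := by
  classical
  induction S using Finset.induction_on with
  | empty =>
    simp only [Finset.sum_empty]
    exact Asymptotics.superpolynomialDecay_zero _ _
  | insert a S ha ih =>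
    simp only [Finset.sum_insert ha]
    exact (h a (Finset.mem_insert_self a S)).add
      (ih fun c hc => h c (Finset.mem_insert_of_mem hc))

theorem Negligible.of_abs_le {f g : ℕ → ℝ} (hg : Negligible g) (h : ∀ n, |f n| ≤ g n) :
    Negligible f :=
  Asymptotics.SuperpolynomialDecay.trans_abs_le hg fun n => (h n).trans (le_abs_self _)

/-! ## Programs and their costs -/

theorem length_pairStr (x y : Str) : (pairStr x y).length = 2 * x.length + 2 + y.length := by
  induction x with
  | nil => simp [pairStr]; omega
  | cons b x ih => simp only [pairStr, List.length_cons, ih]; omega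

theorem length_unpairStr : ∀ x : Str,
    2 * (unpairStr x).1.length + (unpairStr x).2.length ≤ x.length
  | [] => by simp [unpairStr]
  | [_] => by simp [unpairStr]
  | b :: c :: w => by
    have := length_unpairStr w
    by_cases h : b = c
    · simp [unpairStr, h]
      omega
    · simp [unpairStr, h]
      omega

theorem mem_support_basic {x y : Str} {z : Str × ℕ} :
    z ∈ (basic x y).support ↔ z = (y, 1 + x.length + y.length) := by
  simp [basic]

theorem length_le_of_mem_rounds {F : Str → PMF (Str × ℕ)}
    (hF : ∀ w, ∀ z ∈ (F w).support, z.1.length ≤ z.2) (k : ℕ) (w : Str) :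
    ∀ z ∈ (rounds F k w).support, z.1.length ≤ z.2 + w.length := by
  induction k generalizing w with
  | zero => simp [rounds]
  | succ k ih =>
    simp only [rounds, PMF.mem_support_bind_iff, PMF.support_map, Set.mem_image]
    rintro _ ⟨a, ha, z, hz, rfl⟩
    have := ih _ z hz
    have := hF _ a ha
    dsimp only
    omega

/-- The output is not longer than the running time. -/
theorem length_le_of_mem_run (O : Str → Str) (P : Prog) (x : Str) :
    ∀ z ∈ (run O P x).support, z.1.length ≤ z.2 := by
  have bas : ∀ x y : Str, ∀ z ∈ (basic x y).support, z.1.length ≤ z.2 := by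
    intro x y z hz
    rw [mem_support_basic.1 hz]
    dsimp only
    omega
  induction P generalizing x with
  | id => exact bas _ _
  | const w => exact bas _ _
  | comp g f ihg ihf =>
    simp only [run, PMF.mem_support_bind_iff, PMF.support_map, Set.mem_image]
    rintro _ ⟨a, ha, z, hz, rfl⟩
    have := ihg _ z hz
    dsimp only
    omega
  | pair f g ihf ihg =>
    simp only [run, PMF.mem_support_bind_iff, PMF.support_map, Set.mem_image]
    rintro _ ⟨a, ha, z, hz, rfl⟩
    dsimp only
    omega
  | fst => exact bas _ _
  | snd => exact bas _ _
  | push b => exact bas _ _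
  | pop => exact bas _ _
  | isNil => exact bas _ _
  | cond c f g ihc ihf ihg =>
    simp only [run, PMF.mem_support_bind_iff, PMF.support_map, Set.mem_image]
    rintro _ ⟨a, ha, z, hz, rfl⟩
    have : z.1.length ≤ z.2 := by
      split_ifs at hz
      exacts [ihf _ z hz, ihg _ z hz]
    dsimp only
    omega
  | loop f ih =>
    simp only [run, PMF.support_map, Set.mem_image]
    rintro _ ⟨z, hz, rfl⟩
    have := length_le_of_mem_rounds ih _ _ z hz
    have := length_unpairStr x
    dsimp only
    omega
  | toss =>
    simp only [run, PMF.mem_support_bind_iff]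
    rintro z ⟨b, -, hz⟩
    exact bas _ _ z hz
  | query => exact bas _ _

theorem eval_monotone (p : Polynomial ℕ) : Monotone fun n : ℕ => p.eval n := by
  induction p using Polynomial.induction_on' with
  | add p q hp hq => simpa only [Polynomial.eval_add] using hp.add hq
  | monomial k a =>
    intro m n h
    simp only [Polynomial.eval_monomial]
    gcongr

theorem isPPT_of_basic {P : Prog} {g : (Str → Str) → Str → Str} (c : ℕ)
    (h : ∀ O x, run O P x = basic x (g O x)) (hg : ∀ O x, (g O x).length ≤ x.length + c) :
    IsPPT P := by
  refine ⟨2 * Polynomial.X + Polynomial.C (c + 1), fun O x z hz => ?_⟩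
  rw [h] at hz
  rw [mem_support_basic.1 hz]
  have := hg O x
  simp only [Polynomial.eval_add, Polynomial.eval_mul, Polynomial.eval_ofNat, Polynomial.eval_X,
    Polynomial.eval_C]
  omega

theorem isPPT_id : IsPPT .id := isPPT_of_basic (g := fun _ x => x) 0 (fun _ _ => rfl) (by simp)

theorem isPPT_const (w : Str) : IsPPT (.const w) :=
  isPPT_of_basic (g := fun _ _ => w) w.length (fun _ _ => rfl) (by simp)

theorem isPPT_fst : IsPPT .fst :=
  isPPT_of_basic (g := fun _ x => (unpairStr x).1) 0 (fun _ _ => rfl) fun _ x => by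
    have := length_unpairStr x
    omega

theorem isPPT_snd : IsPPT .snd :=
  isPPT_of_basic (g := fun _ x => (unpairStr x).2) 0 (fun _ _ => rfl) fun _ x => by
    have := length_unpairStr x
    omega

theorem isPPT_push (b : Bool) : IsPPT (.push b) :=
  isPPT_of_basic (g := fun _ x => b :: x) 1 (fun _ _ => rfl) (by simp)

theorem isPPT_pop : IsPPT .pop :=
  isPPT_of_basic (g := fun _ x => x.tail) 0 (fun _ _ => rfl) (by simp)

theorem isPPT_isNil : IsPPT .isNil :=
  isPPT_of_basic (g := fun _ x => [x.isEmpty]) 1 (fun _ _ => rfl) (by simp)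

theorem isPPT_toss : IsPPT .toss := by
  refine ⟨Polynomial.X + 2, fun O x z hz => ?_⟩
  simp only [run, PMF.mem_support_bind_iff] at hz
  obtain ⟨b, -, hz⟩ := hz
  rw [mem_support_basic.1 hz]
  simp only [List.length_cons, List.length_nil, Polynomial.eval_add, Polynomial.eval_X,
    Polynomial.eval_ofNat]
  omega

/-- The intermediate string is no longer than the time spent on producing it, so the second time
bound may be evaluated at the first. -/
theorem IsPPT.comp {g f : Prog} (hg : IsPPT g) (hf : IsPPT f) : IsPPT (.comp g f) := by
  obtain ⟨p, hp⟩ := hf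
  obtain ⟨q, hq⟩ := hg
  refine ⟨p + q.comp p + 1, fun O x z hz => ?_⟩
  simp only [run, PMF.mem_support_bind_iff, PMF.support_map, Set.mem_image] at hz
  obtain ⟨a, ha, z, hz, rfl⟩ := hz
  have h1 := hp O x a ha
  have h2 := hq O _ z hz
  have h3 := eval_monotone q ((length_le_of_mem_run O f x a ha).trans h1)
  simp only [Polynomial.eval_add, Polynomial.eval_comp, Polynomial.eval_one]
  dsimp only at h3
  omega

theorem IsPPT.pair {f g : Prog} (hf : IsPPT f) (hg : IsPPT g) : IsPPT (.pair f g) := by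
  obtain ⟨p, hp⟩ := hf
  obtain ⟨q, hq⟩ := hg
  refine ⟨3 * p + 2 * q + Polynomial.X + 3, fun O x z hz => ?_⟩
  simp only [run, PMF.mem_support_bind_iff, PMF.support_map, Set.mem_image] at hz
  obtain ⟨a, ha, z, hz, rfl⟩ := hz
  have h1 := hp O x a ha
  have h2 := hq O x z hz
  have h3 := length_le_of_mem_run O f x a ha
  have h4 := length_le_of_mem_run O g x z hz
  simp only [length_pairStr, Polynomial.eval_add, Polynomial.eval_mul, Polynomial.eval_ofNat,
    Polynomial.eval_X]
  omega

theorem IsPPT.cond {c f g : Prog} (hc : IsPPT c) (hf : IsPPT f) (hg : IsPPT g) :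
    IsPPT (.cond c f g) := by
  obtain ⟨o, ho⟩ := hc
  obtain ⟨p, hp⟩ := hf
  obtain ⟨q, hq⟩ := hg
  refine ⟨o + p + q + Polynomial.X + 1, fun O x z hz => ?_⟩
  simp only [run, PMF.mem_support_bind_iff, PMF.support_map, Set.mem_image] at hz
  obtain ⟨a, ha, z, hz, rfl⟩ := hz
  have h1 := ho O x a ha
  have h2 : z.2 ≤ p.eval x.length + q.eval x.length := by
    split_ifs at hz
    exacts [(hp O x z hz).trans (Nat.le_add_right _ _), (hq O x z hz).trans (Nat.le_add_left _ _)]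
  simp only [Polynomial.eval_add, Polynomial.eval_X, Polynomial.eval_one]
  omega

/-- `B` bounds every string on which the body is run, because a round adds at most `c` bits. Without
such linear growth, lengths could double in each round and the total cost be exponential. -/
theorem cost_le_of_mem_rounds {F : Str → PMF (Str × ℕ)} {p : Polynomial ℕ} {c : ℕ}
    (hF : ∀ w, ∀ z ∈ (F w).support, z.2 ≤ p.eval w.length)
    (hc : ∀ w, ∀ z ∈ (F w).support, z.1.length ≤ w.length + c) (k B : ℕ) (w : Str)
    (hB : w.length + c * k ≤ B) :
    ∀ z ∈ (rounds F k w).support, z.2 ≤ k * (p.eval B + 1) := by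
  induction k generalizing w with
  | zero => simp [rounds]
  | succ k ih =>
    simp only [rounds, PMF.mem_support_bind_iff, PMF.support_map, Set.mem_image]
    rintro _ ⟨a, ha, z, hz, rfl⟩
    rw [Nat.mul_succ] at hB
    have h1 := ih a.1 (by have := hc w a ha; omega) z hz
    have h2 := hF w a ha
    have h3 : p.eval w.length ≤ p.eval B := eval_monotone p (by omega)
    rw [Nat.succ_mul]
    dsimp only
    omega

/-- A loop is polynomial if its body lengthens the string by at most a constant. -/
theorem IsPPT.loop {f : Prog} (hf : IsPPT f) (c : ℕ)
    (hc : ∀ O w, ∀ z ∈ (run O f w).support, z.1.length ≤ w.length + c) : IsPPT (.loop f) := by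
  obtain ⟨p, hp⟩ := hf
  refine ⟨Polynomial.X * (p.comp (Polynomial.X + Polynomial.C c * Polynomial.X) + 1) +
    Polynomial.X + 1, fun O x z hz => ?_⟩
  simp only [run, PMF.support_map, Set.mem_image] at hz
  obtain ⟨z, hz, rfl⟩ := hz
  have h0 := length_unpairStr x
  have hk : (unpairStr x).1.length ≤ x.length := by omega
  have h1 := cost_le_of_mem_rounds (hp O) (hc O) (unpairStr x).1.length
    (x.length + c * x.length) (unpairStr x).2
    (by have := Nat.mul_le_mul_left c hk; omega) z hz
  have h2 := h1.trans (Nat.mul_le_mul_right _ hk)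
  simp only [Polynomial.eval_add, Polynomial.eval_mul, Polynomial.eval_comp, Polynomial.eval_X,
    Polynomial.eval_C, Polynomial.eval_one]
  omega

/-- The program with all oracle queries answered by the empty string. -/
def noQuery : Prog → Prog
  | .comp g f => .comp (noQuery g) (noQuery f)
  | .pair f g => .pair (noQuery f) (noQuery g)
  | .cond c f g => .cond (noQuery c) (noQuery f) (noQuery g)
  | .loop f => .loop (noQuery f)
  | .query => .const []
  | P => P

/-- The anonymity adversary runs without oracle, whereas the reduction that simulates it is run with
a decryption oracle. The simulated copy must not notice the difference. -/
theorem run_noQuery (O : Str → Str) (P : Prog) (x : Str) :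
    run O (noQuery P) x = run noOracle P x := by
  induction P generalizing x with
  | comp g f ihg ihf => simp [noQuery, run, ihg, ihf]
  | pair f g ihf ihg => simp [noQuery, run, ihg, ihf]
  | cond c f g ihc ihf ihg => simp [noQuery, run, ihg, ihf, ihc]
  | loop f ih =>
    have : run O (noQuery f) = run noOracle f := funext ih
    simp [noQuery, run, this]
  | query => simp [noQuery, run, noOracle]
  | _ => rfl

theorem isPPT_noQuery {P : Prog} (hP : IsPPT P) : IsPPT (noQuery P) := by
  obtain ⟨p, hp⟩ := hP
  refine ⟨p, fun O x z hz => hp noOracle x z ?_⟩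
  rwa [run_noQuery] at hz

theorem output_comp (O : Str → Str) (g f : Prog) (x : Str) :
    output O (.comp g f) x = (output O f x).bind (output O g) := by
  simp only [output, run, PMF.map_bind, PMF.bind_map, PMF.map_comp]
  rfl

theorem output_pair (O : Str → Str) (f g : Prog) (x : Str) :
    output O (.pair f g) x = (output O f x).bind fun a => (output O g x).map (pairStr a) := by
  simp only [output, run, PMF.map_bind, PMF.bind_map, PMF.map_comp]
  rfl

theorem output_cond (O : Str → Str) (c f g : Prog) (x : Str) :
    output O (.cond c f g) x =
      (output O c x).bind fun a => if bitOf a then output O f x else output O g x := by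
  simp only [output, run, PMF.map_bind, PMF.bind_map, PMF.map_comp]
  congr 1
  funext a
  simp only [Function.comp_apply]
  split_ifs <;> rfl

theorem output_basic {O : Str → Str} {P : Prog} {x y : Str} (h : run O P x = basic x y) :
    output O P x = PMF.pure y := by
  simp [output, h, basic, PMF.pure_map]

theorem output_toss (O : Str → Str) (x : Str) :
    output O .toss x = coin.map fun b => [b] := by
  simp only [output, run, basic, PMF.map_bind, PMF.pure_map]
  rfl

theorem rounds_map_fst {F : Str → PMF (Str × ℕ)} {g : Str → Str}
    (h : ∀ w, (F w).map Prod.fst = PMF.pure (g w)) (k : ℕ) (w : Str) :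
    (rounds F k w).map Prod.fst = PMF.pure (g^[k] w) := by
  induction k generalizing w with
  | zero => simp [rounds, PMF.pure_map]
  | succ k ih =>
    have : (rounds F (k + 1) w).map Prod.fst =
        ((F w).map Prod.fst).bind fun a => (rounds F k a).map Prod.fst := by
      simp only [rounds, PMF.map_bind, PMF.bind_map, PMF.map_comp]
      rfl
    rw [this, h, PMF.pure_bind, ih, Function.iterate_succ_apply]

theorem output_loop {O : Str → Str} {f : Prog} {g : Str → Str}
    (h : ∀ w, output O f w = PMF.pure (g w)) (x : Str) :
    output O (.loop f) x = PMF.pure (g^[(unpairStr x).1.length] (unpairStr x).2) := by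
  simp only [output, run, PMF.map_comp]
  exact rounds_map_fst h _ _

/-! ## Efficiently computable random functions

The input `i` is given to the program as the string `e i`. -/

/-- Some probabilistic polynomial-time program computes `κ i` from `e i`, with any oracle. -/
def Real {ι : Type*} (e : ι → Str) (κ : ι → PMF Str) : Prop :=
  ∃ P, IsPPT P ∧ ∀ O i, output O P (e i) = κ i

/-- Some polynomial-time program computes `g i` from `e i`. -/
abbrev Det {ι : Type*} (e g : ι → Str) : Prop := Real e fun i => PMF.pure (g i)

section Real

variable {ι ι' : Type*} {e : ι → Str} {e' : ι' → Str}

theorem IsPPT.real {P : Prog} (hP : IsPPT P) : Real (fun x : Str => x) (output noOracle P) :=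
  ⟨noQuery P, isPPT_noQuery hP, fun O i => by simp [output, run_noQuery]⟩

theorem Real.congr {κ κ' : ι → PMF Str} (h : Real e κ) (hκ : ∀ i, κ i = κ' i) : Real e κ' := by
  rwa [← funext hκ]

theorem Real.comp {κ : ι → PMF ι'} {f : ι' → PMF Str} (hκ : Real e fun i => (κ i).map e')
    (hf : Real e' f) : Real e fun i => (κ i).bind f := by
  obtain ⟨P, hP, hP'⟩ := hκ
  obtain ⟨Q, hQ, hQ'⟩ := hf
  refine ⟨.comp Q P, hQ.comp hP, fun O i => ?_⟩
  rw [output_comp, hP', PMF.bind_map]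
  congr 1
  funext j
  exact hQ' O j

theorem Real.reindex {f : ι' → PMF Str} (hf : Real e' f) (g : ι → ι')
    (hg : Det e fun i => e' (g i)) : Real e fun i => f (g i) := by
  have : Real e fun i => (PMF.pure (g i)).map e' := by simpa only [PMF.pure_map] using hg
  simpa only [PMF.pure_bind] using this.comp hf

theorem Real.of_str {f : Str → PMF Str} (hf : Real (fun x => x) f) {g : ι → Str} (hg : Det e g) :
    Real e fun i => f (g i) :=
  hf.reindex g hg

theorem Real.pair {κ κ' : ι → PMF Str} (h : Real e κ) (h' : Real e κ') :
    Real e fun i => (κ i).bind fun a => (κ' i).map (pairStr a) := by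
  obtain ⟨P, hP, hP'⟩ := h
  obtain ⟨Q, hQ, hQ'⟩ := h'
  exact ⟨.pair P Q, hP.pair hQ, fun O i => by rw [output_pair, hP', hQ']⟩

theorem Real.cond {κc κ κ' : ι → PMF Str} (hc : Real e κc) (h : Real e κ) (h' : Real e κ') :
    Real e fun i => (κc i).bind fun a => if bitOf a then κ i else κ' i := by
  obtain ⟨C, hC, hC'⟩ := hc
  obtain ⟨P, hP, hP'⟩ := h
  obtain ⟨Q, hQ, hQ'⟩ := h'
  exact ⟨.cond C P Q, hC.cond hP hQ, fun O i => by rw [output_cond, hC', hP', hQ']⟩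

theorem det_id : Det e e := ⟨.id, isPPT_id, fun _ _ => output_basic rfl⟩

theorem det_const (w : Str) : Det e fun _ => w :=
  ⟨.const w, isPPT_const w, fun _ _ => output_basic rfl⟩

theorem Det.fst {g : ι → Str} (h : Det e g) : Det e fun i => (unpairStr (g i)).1 :=
  Real.of_str (f := fun x => PMF.pure (unpairStr x).1)
    ⟨.fst, isPPT_fst, fun _ _ => output_basic rfl⟩ h

theorem Det.snd {g : ι → Str} (h : Det e g) : Det e fun i => (unpairStr (g i)).2 :=
  Real.of_str (f := fun x => PMF.pure (unpairStr x).2)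
    ⟨.snd, isPPT_snd, fun _ _ => output_basic rfl⟩ h

theorem Det.push {g : ι → Str} (h : Det e g) (b : Bool) : Det e fun i => b :: g i :=
  Real.of_str (f := fun x => PMF.pure (b :: x))
    ⟨.push b, isPPT_push b, fun _ _ => output_basic rfl⟩ h

theorem Det.tail {g : ι → Str} (h : Det e g) : Det e fun i => (g i).tail :=
  Real.of_str (f := fun x => PMF.pure x.tail) ⟨.pop, isPPT_pop, fun _ _ => output_basic rfl⟩ h

theorem Det.isEmpty {g : ι → Str} (h : Det e g) : Det e fun i => [(g i).isEmpty] :=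
  Real.of_str (f := fun x => PMF.pure [x.isEmpty])
    ⟨.isNil, isPPT_isNil, fun _ _ => output_basic rfl⟩ h

theorem Det.pair {g g' : ι → Str} (h : Det e g) (h' : Det e g') :
    Det e fun i => pairStr (g i) (g' i) :=
  (Real.pair h h').congr fun i => by simp [PMF.pure_map]

theorem Real.ite {g : ι → Str} (hg : Det e g) {κ κ' : ι → PMF Str} (h : Real e κ)
    (h' : Real e κ') : Real e fun i => if bitOf (g i) then κ i else κ' i :=
  (hg.cond h h').congr fun i => by simp

theorem Det.ite {g a a' : ι → Str} (hg : Det e g) (h : Det e a) (h' : Det e a') :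
    Det e fun i => if bitOf (g i) then a i else a' i :=
  (Real.ite hg h h').congr fun i => by dsimp only; split_ifs <;> rfl

theorem real_coin_bind {κ : Bool → ι → PMF Str} (h : ∀ b, Real e (κ b)) :
    Real e fun i => coin.bind fun b => κ b i := by
  have ht : Real e fun _ => coin.map fun b => [b] :=
    ⟨.toss, isPPT_toss, fun O i => output_toss O _⟩
  refine (ht.cond (h true) (h false)).congr fun i => ?_
  rw [PMF.bind_map]
  congr 1
  funext b
  cases b <;> simp [bitOf]

/-- Evaluation in an extended context. -/
theorem Real.bind {β : ι → Type*} {κ : ∀ i, PMF (β i)} {out : ∀ i, β i → Str}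
    {f : ∀ i, β i → PMF Str} (hκ : Real e fun i => (κ i).map (out i))
    (hf : Real (fun p : Σ i, β i => pairStr (e p.1) (out p.1 p.2)) fun p => f p.1 p.2) :
    Real e fun i => (κ i).bind (f i) := by
  have h1 : Real e fun i => ((κ i).map (Sigma.mk i)).map
      fun p : Σ i, β i => pairStr (e p.1) (out p.1 p.2) :=
    (Real.pair det_id hκ).congr fun i => by
      simp only [PMF.pure_bind, PMF.map_comp]
      rfl
  refine (h1.comp hf).congr fun i => ?_
  rw [PMF.bind_map]
  rfl

/-- Contexts are nested pairs: the first projection keeps the earlier variables available after a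
new sample, and the second one (`det_last`) reads the new sample. -/
theorem Real.weaken {β : ι → Type*} {out : ∀ i, β i → Str} {κ : ι → PMF Str} (h : Real e κ) :
    Real (fun p : Σ i, β i => pairStr (e p.1) (out p.1 p.2)) fun p => κ p.1 :=
  h.reindex (fun p : Σ i, β i => p.1) (by simpa [unpairStr_pairStr] using
    (det_id (e := fun p : Σ i, β i => pairStr (e p.1) (out p.1 p.2))).fst)

theorem det_last {β : ι → Type*} {out : ∀ i, β i → Str} :
    Det (fun p : Σ i, β i => pairStr (e p.1) (out p.1 p.2)) fun p => out p.1 p.2 := by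
  simpa [unpairStr_pairStr] using
    (det_id (e := fun p : Σ i, β i => pairStr (e p.1) (out p.1 p.2))).snd

theorem Real.map {κ : ι → PMF Str} (hκ : Real e κ) {f : Str → Str}
    (hf : Det (fun x => x) f) : Real e fun i => (κ i).map f := by
  have : Real e fun i => (κ i).map fun x => x := by
    have h : (fun x : Str => x) = id := rfl
    simpa only [h, PMF.map_id] using hκ
  exact (this.comp hf).congr fun i => rfl

theorem det_iterate {g : Str → Str} (hg : Det (fun x => x) g) (c : ℕ)
    (hc : ∀ w, (g w).length ≤ w.length + c) :
    Det (fun x => x) fun x => g^[(unpairStr x).1.length] (unpairStr x).2 := by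
  obtain ⟨P, hP, hP'⟩ := hg
  refine ⟨.loop P, hP.loop c fun O w z hz => ?_, fun O x => output_loop (hP' O) x⟩
  have h1 : z.1 ∈ (output O P w).support := by
    rw [output, PMF.support_map]
    exact Set.mem_image_of_mem _ hz
  rw [hP', PMF.support_pure, Set.mem_singleton_iff] at h1
  rw [h1]
  exact hc w

/-- Iteration of a map, as often as a string has bits. -/
theorem Det.iterate {g : Str → Str} (hg : Det (fun x => x) g) (c : ℕ)
    (hc : ∀ w, (g w).length ≤ w.length + c) {u w : ι → Str} (hu : Det e u) (hw : Det e w) :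
    Det e fun i => g^[(u i).length] (w i) := by
  simpa only [unpairStr_pairStr] using Real.of_str (det_iterate hg c hc) (hu.pair hw)

end Real

/-! ## Some polynomial-time string operations -/

section Strings

variable {ι : Type*} {e : ι → Str}

theorem iterate_push (b : Bool) (k : ℕ) (w : Str) :
    (fun x : Str => b :: x)^[k] w = List.replicate k b ++ w := by
  induction k generalizing w with
  | zero => rfl
  | succ k ih =>
    rw [Function.iterate_succ_apply, ih, List.replicate_succ']
    simp

theorem iterate_tail (k : ℕ) (w : Str) : List.tail^[k] w = w.drop k := by
  induction k generalizing w with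
  | zero => rfl
  | succ k ih => rw [Function.iterate_succ_apply, ih, List.drop_tail]

theorem Det.replicate {u : ι → Str} (hu : Det e u) (b : Bool) :
    Det e fun i => List.replicate (u i).length b := by
  simpa [iterate_push] using Det.iterate (det_id.push b) 1 (by simp) hu (det_const (e := e) [])

theorem Det.drop {u w : ι → Str} (hu : Det e u) (hw : Det e w) :
    Det e fun i => (w i).drop (u i).length := by
  simpa [iterate_tail] using Det.iterate det_id.tail 0 (by simp) hu hw

/-- Move the first bit of one string to the front of another. -/
def moveBit (w : Str) : Str :=
  if bitOf (unpairStr w).1 then pairStr (unpairStr w).1.tail (true :: (unpairStr w).2)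
  else pairStr (unpairStr w).1.tail (false :: (unpairStr w).2)

theorem length_moveBit_le (w : Str) : (moveBit w).length ≤ w.length + 3 := by
  have := length_unpairStr w
  unfold moveBit
  split_ifs <;> simp only [length_pairStr, List.length_tail, List.length_cons] <;> omega

theorem det_moveBit : Det (fun x => x) moveBit :=
  Det.ite det_id.fst (det_id.fst.tail.pair (det_id.snd.push true))
    (det_id.fst.tail.pair (det_id.snd.push false))

theorem iterate_moveBit (x y : Str) :
    moveBit^[x.length] (pairStr x y) = pairStr [] (x.reverse ++ y) := by
  induction x generalizing y with
  | nil => rfl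
  | cons b x ih =>
    have : moveBit (pairStr (b :: x) y) = pairStr x (b :: y) := by
      cases b <;> simp [moveBit, unpairStr_pairStr, bitOf]
    rw [List.length_cons, Function.iterate_succ_apply, this, ih]
    simp

/-- Moving bits one at a time reverses the string; two reversals give concatenation below. -/
theorem Det.reverseAppend {u w : ι → Str} (hu : Det e u) (hw : Det e w) :
    Det e fun i => (u i).reverse ++ w i := by
  simpa [iterate_moveBit, unpairStr_pairStr] using
    (Det.iterate det_moveBit 3 length_moveBit_le hu (hu.pair hw)).snd

theorem Det.append {u w : ι → Str} (hu : Det e u) (hw : Det e w) :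
    Det e fun i => u i ++ w i := by
  simpa using (hu.reverseAppend (det_const [])).reverseAppend hw

theorem Det.padStr {L : ι → ℕ} {c : ι → Str} (hL : Det e fun i => unary (L i)) (hc : Det e c) :
    Det e fun i => padStr (L i) (c i) := by
  -- Dropping `|c|` bits from the unary string of length `L` leaves a string as long as the padding
  -- by `false`.
  simpa [SyncPCN.padStr, unary] using
    hc.append (((hc.drop hL).replicate false).push true)

theorem length_padStr {L : ℕ} {c : Str} (h : c.length ≤ L) : (padStr L c).length = L + 1 := by
  simp [padStr]
  omega

/-- The marker is the last `true` of the padded string, whatever the bits of `c` are. -/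
theorem unpadStr_padStr (L : ℕ) (c : Str) : unpadStr (padStr L c) = c := by
  have : ∀ (m : ℕ) (l : Str), (List.replicate m false ++ true :: l).dropWhile (fun b => !b) =
      true :: l := by
    intro m l
    induction m with
    | zero => rfl
    | succ m ih => simp [List.replicate_succ, ih]
  simp [unpadStr, padStr, this]

/-- Comparison with a fixed string. -/
theorem Det.decide_eq (w : Str) {u : ι → Str} (hu : Det e u) :
    Det e fun i => [decide (u i = w)] := by
  induction w generalizing u with
  | nil =>
    refine hu.isEmpty.congr fun i => ?_
    dsimp only
    cases u i <;> simp
  | cons b w ih =>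
    have hb : Det e fun i => [decide (bitOf (u i) = b)] := by
      refine (Det.ite hu (det_const [b]) (det_const [!b])).congr fun i => ?_
      dsimp only
      cases bitOf (u i) <;> cases b <;> simp
    refine (Det.ite hu.isEmpty (det_const [false])
      (Det.ite hb (ih hu.tail) (det_const [false]))).congr fun i => ?_
    dsimp only
    rcases u i with _ | ⟨a, x⟩
    · simp [bitOf]
    · by_cases h : a = b <;> simp [bitOf, h]

theorem unpairStr_joinStr_fst (l : List Str) : (unpairStr (joinStr l)).1 = l.headD [] := by
  cases l <;> simp [joinStr, unpairStr, unpairStr_pairStr]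

theorem unpairStr_joinStr_snd (l : List Str) : (unpairStr (joinStr l)).2 = joinStr l.tail := by
  cases l <;> simp [joinStr, unpairStr, unpairStr_pairStr]

theorem Det.joinStr_headD {l : ι → List Str} (h : Det e fun i => joinStr (l i)) :
    Det e fun i => (l i).headD [] := by
  simpa only [unpairStr_joinStr_fst] using h.fst

theorem Det.joinStr_tail {l : ι → List Str} (h : Det e fun i => joinStr (l i)) :
    Det e fun i => joinStr (l i).tail := by
  simpa only [unpairStr_joinStr_snd] using h.snd

theorem Det.joinStr_cons {a : ι → Str} {l : ι → List Str} (ha : Det e a)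
    (h : Det e fun i => joinStr (l i)) : Det e fun i => joinStr (a i :: l i) :=
  ha.pair h

theorem pairStr_append (x y z : Str) : pairStr x (y ++ z) = pairStr x y ++ z := by
  induction x with
  | nil => rfl
  | cons b x ih => simp [pairStr, ih]

theorem joinStr_append (l l' : List Str) : joinStr (l ++ l') = joinStr l ++ joinStr l' := by
  induction l with
  | nil => rfl
  | cons a l ih => exact (congrArg (pairStr a) ih).trans (pairStr_append _ _ _)

theorem Det.joinStr_append {l l' : ι → List Str} (h : Det e fun i => joinStr (l i))
    (h' : Det e fun i => joinStr (l' i)) : Det e fun i => joinStr (l i ++ l' i) := by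
  simpa only [SyncPCN.joinStr_append] using h.append h'

theorem Det.joinStr_ofFn {k : ℕ} {a : ι → Fin k → Str} (h : ∀ j, Det e fun i => a i j) :
    Det e fun i => joinStr (List.ofFn (a i)) := by
  induction k with
  | zero => simpa using det_const (joinStr [])
  | succ k ih => simpa using (h 0).joinStr_cons (ih fun j => h j.succ)

theorem Det.joinStr_ofFn_apply {k : ℕ} {a : ι → Fin k → Str}
    (h : Det e fun i => joinStr (List.ofFn (a i))) (j : Fin k) : Det e fun i => a i j := by
  induction k with
  | zero => exact j.elim0
  | succ k ih =>
    refine Fin.cases ?_ (fun j => ?_) j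
    · simpa using h.joinStr_headD
    · exact ih (a := fun i j => a i j.succ) (by simpa using h.joinStr_tail) j

theorem Real.iid {α : ι → Type} {p : ∀ i, PMF (α i)} {out : ∀ i, α i → Str}
    (h : Real e fun i => (p i).map (out i)) (k : ℕ) :
    Real e fun i => (iid (p i) k).map fun r => joinStr (List.ofFn fun j => out i (r j)) := by
  induction k with
  | zero =>
    refine (det_const (joinStr [])).congr fun i => ?_
    simp [SyncPCN.iid, PMF.pure_map]
  | succ k ih =>
    refine (h.pair ih).congr fun i => ?_
    simp only [SyncPCN.iid, PMF.bind_map, PMF.map_bind, PMF.map_comp, Function.comp_def]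
    simp [joinStr]

end Strings

/-! ## Encryption and group operations -/

section Crypto

variable {ι : Type*} {e : ι → Str} {N : ι → ℕ}

theorem Real.encryptPad (E : PKE) (pad : Padding E) {pk m : ι → Str}
    (hN : Det e fun i => unary (N i)) (hpk : Det e pk) (hm : Det e m) :
    Real e fun i => encryptPad (N i) E pad (pk i) (m i) := by
  have hc : Real e fun i => (E.encrypt (N i) (pk i) (m i)).map fun c => c := by
    have h : (fun x : Str => x) = id := rfl
    simp only [h, PMF.map_id]
    exact Real.of_str E.enc_ppt.real (hN.pair (hpk.pair hm))
  refine Real.bind hc (f := fun i c => PMF.pure (padStr (pad.len (N i) (m i).length) c))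
    (Det.padStr ?_ (det_last (out := fun _ c => c)))
  have hu : Det e fun i => unary (m i).length := hm.replicate true
  exact Real.weaken (out := fun _ c => c) ((Real.of_str pad.prog_ppt.real (hN.pair hu)).congr fun _ =>
    pad.prog_spec _ _)

variable (F : HomFun)

theorem Det.encD_add {x y : ∀ i, F.D (N i)} (hN : Det e fun i => unary (N i))
    (hx : Det e fun i => F.encD _ (x i)) (hy : Det e fun i => F.encD _ (y i)) :
    Det e fun i => F.encD _ (x i + y i) :=
  (Real.of_str F.add_ppt.real (hN.pair (hx.pair hy))).congr fun _ => F.add_spec _ _ _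

theorem Det.encR_eval {x : ∀ i, F.D (N i)} (hN : Det e fun i => unary (N i))
    (hx : Det e fun i => F.encD _ (x i)) : Det e fun i => F.encR _ (F.H _ (x i)) :=
  (Real.of_str F.eval_ppt.real (hN.pair hx)).congr fun _ => F.eval_spec _ _

theorem Det.encD_witness {ℓ : ∀ i, ℕ → F.D (N i)} (hN : Det e fun i => unary (N i)) {j : ℕ}
    (hℓ : ∀ t ≤ j, Det e fun i => F.encD _ (ℓ i t)) :
    Det e fun i => F.encD _ (witness F (N i) (ℓ i) j) := by
  induction j with
  | zero => simpa [witness] using hℓ 0 le_rfl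
  | succ j ih =>
    have := Det.encD_add F hN (ih fun t ht => hℓ t (ht.trans (Nat.le_succ j)))
      (hℓ (j + 1) le_rfl)
    refine this.congr fun i => ?_
    simp [witness, Finset.sum_range_succ _ (j + 1)]

theorem real_sample (hN : Det e fun i => unary (N i)) :
    Real e fun i => (F.sample (N i)).map (F.encD (N i)) :=
  (Real.of_str F.sample_ppt.real hN).congr fun _ => F.sample_spec _

theorem real_keys (E : PKE) (hN : Det e fun i => unary (N i)) :
    Real e fun i => (E.keys (N i)).map fun k => pairStr k.1 k.2 := by
  refine (Real.map (Real.of_str E.keyGen_ppt.real hN)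
    (f := fun x => pairStr (unpairStr x).1 (unpairStr x).2)
    (det_id.fst.pair det_id.snd)).congr fun i => ?_
  rw [PKE.keys, PMF.map_comp]
  rfl

end Crypto

/-! ## The payloads along the path

For the security proof, the plaintext for the `i`-th party is passed through a function `φ i`. -/

section Trace

variable (F : HomFun) (net : Network) (n : ℕ) (E : PKE) (pad : Padding E)
  (pk : Fin net.N → Str) (φ : ℕ → Str → Str) (path : ℕ → Fin net.N) (k v : ℕ) (ℓ : ℕ → F.D n)

/-- What `P_i` holds after the payment, if it forwarded the ciphertext `c`. -/
def entryAt (i : ℕ) (c : Str) : Entry F net n :=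
  ⟨path i, hopMsg F net n path k v ℓ i c, witness F n ℓ i⟩

/-- The plaintext `M_i`, which contains the ciphertext `c` for the next party. -/
def hopStr (i : ℕ) (c : Str) : Str := (Payload.hop (hopMsg F net n path k v ℓ i c)).toStr

/-- The ciphertext for the intermediary `P_i`. -/
def hopCt (i : ℕ) (c : Str) : PMF Str :=
  encryptPad n E pad (pk (path i)) (φ i (hopStr F net n path k v ℓ i c))

/-- The ciphertext for the receiver `P_i`. -/
def lastCt (i : ℕ) : PMF Str :=
  encryptPad n E pad (pk (path i))
    (Payload.last (net := net) (condPay F net n path k v ℓ (i - 1))).toStr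

/-- The ciphertext for `P_i` and the entries of `P_i, ..., P_{i+m-1}`, given the ciphertext `c` for
`P_{i+m}`. -/
def ext : ℕ → ℕ → Str → PMF (Str × List (Entry F net n))
  | 0, _, c => PMF.pure (c, [])
  | m + 1, i, c => (ext m (i + 1) c).bind fun z =>
      (hopCt F net n E pad pk φ path k v ℓ i z.1).map fun c' =>
        (c', entryAt F net n path k v ℓ i z.1 :: z.2)

/-- The ciphertext for `P_i` and the entries of `P_i, ..., P_{i+d-1}`, if `P_{i+d}` is the
receiver. -/
def trace (d i : ℕ) : PMF (Str × List (Entry F net n)) :=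
  (lastCt F net n E pad pk path k v ℓ (i + d)).bind (ext F net n E pad pk φ path k v ℓ d i)

/-- The secrets as a sequence. -/
def secrets {F : HomFun} {n k : ℕ} (r : Fin k → F.D n) : ℕ → F.D n :=
  fun i => if h : i < k then r ⟨i, h⟩ else 0

/-- The entries of the intermediaries in a payment, as strings. -/
def pay : PMF (List Str) :=
  (iid (F.sample n) k).bind fun r =>
    (trace F net n E pad pk φ path k v (secrets r) (k - 1) 1).map fun z => z.2.map Entry.toStr

variable {F net n E pad pk φ path k v ℓ}

/-- Layers are added from the receiver outwards, and outer layers use the inner ones only through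
the last ciphertext. This allows the onion to be cut at any intermediary. -/
theorem ext_add (m₁ m₂ i : ℕ) (c : Str) :
    ext F net n E pad pk φ path k v ℓ (m₁ + m₂) i c =
      (ext F net n E pad pk φ path k v ℓ m₂ (i + m₁) c).bind fun z =>
        (ext F net n E pad pk φ path k v ℓ m₁ i z.1).map fun w => (w.1, w.2 ++ z.2) := by
  induction m₁ generalizing i with
  | zero =>
    simp only [Nat.zero_add, Nat.add_zero, ext, PMF.pure_map, List.nil_append]
    exact (PMF.bind_pure _).symm
  | succ m₁ ih =>
    rw [Nat.succ_add, ext, ih, Nat.add_right_comm i 1, Nat.add_assoc i m₁ 1]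
    simp only [ext, PMF.bind_bind, PMF.bind_map, PMF.map_bind, PMF.map_comp, Function.comp_def,
      List.cons_append]

theorem party_of_mem_ext (m i : ℕ) (c : Str) :
    ∀ z ∈ (ext F net n E pad pk φ path k v ℓ m i c).support,
      z.2.map Entry.party = (List.range' i m).map path := by
  induction m generalizing i with
  | zero => simp [ext]
  | succ m ih =>
    simp only [ext, PMF.mem_support_bind_iff, PMF.support_map, Set.mem_image]
    rintro _ ⟨z, hz, c', -, rfl⟩
    simp [ih _ z hz, List.range'_succ, entryAt]

theorem onionAt_eq (d i : ℕ) :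
    onionAt F net n E pad pk path k v ℓ d i =
      (trace F net n E pad pk (fun _ m => m) path k v ℓ d i).map Prod.fst := by
  induction d generalizing i with
  | zero =>
    simp only [onionAt, trace, ext, PMF.map_bind, PMF.pure_map]
    exact (PMF.bind_pure _).symm
  | succ d ih =>
    rw [onionAt, ih, trace, trace, show i + 1 + d = i + (d + 1) by omega]
    simp only [ext, PMF.bind_bind, PMF.bind_map, PMF.map_bind, PMF.map_comp, Function.comp_def]
    congr 1; funext c; congr 1; funext z
    exact (PMF.map_id _).symm

/-- Records exactly which data a stretch of the path uses. Witnesses are needed from `i - 1` on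
because `M_i` contains `Y_{i-1}`, and `path` up to `i + m` because a payload names the next party.
-/
theorem ext_congr {φ' : ℕ → Str → Str} {path' : ℕ → Fin net.N} {ℓ' : ℕ → F.D n} (m i : ℕ) (c : Str)
    (hφ : ∀ t, i ≤ t → t < i + m → φ t = φ' t)
    (hp : ∀ t, i ≤ t → t ≤ i + m → path t = path' t)
    (ha : ∀ t, i ≤ t → t < i + m → amountAt net path k v t = amountAt net path' k v t)
    (ht : ∀ t, i ≤ t → t < i + m → timeAt net path k t = timeAt net path' k t)
    (hw : ∀ t, i ≤ t + 1 → t < i + m → witness F n ℓ t = witness F n ℓ' t)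
    (hℓ : ∀ t, i ≤ t → t < i + m → ℓ t = ℓ' t) :
    ext F net n E pad pk φ path k v ℓ m i c = ext F net n E pad pk φ' path' k v ℓ' m i c := by
  induction m generalizing i with
  | zero => rfl
  | succ m ih =>
    have hm : ∀ c, hopMsg F net n path k v ℓ i c = hopMsg F net n path' k v ℓ' i c := by
      intro c
      simp only [hopMsg]
      rw [hp (i + 1) (by omega) (by omega), ha i le_rfl (by omega), ht i le_rfl (by omega),
        hw i (by omega) (by omega), hw (i - 1) (by omega) (by omega), hℓ i le_rfl (by omega)]
    rw [ext, ext, ih (i + 1) (fun t h h' => hφ t (by omega) (by omega))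
      (fun t h h' => hp t (by omega) (by omega)) (fun t h h' => ha t (by omega) (by omega))
      (fun t h h' => ht t (by omega) (by omega)) (fun t h h' => hw t (by omega) (by omega))
      (fun t h h' => hℓ t (by omega) (by omega))]
    simp only [hopCt, hopStr, entryAt, hm, hφ i le_rfl (by omega), hp i le_rfl (by omega),
      hw i (by omega) (by omega)]

theorem lastCt_congr {path' : ℕ → Fin net.N} {ℓ' : ℕ → F.D n} (i : ℕ)
    (hp : path i = path' i)
    (ha : amountAt net path k v (i - 1) = amountAt net path' k v (i - 1))
    (ht : timeAt net path k (i - 1) = timeAt net path' k (i - 1))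
    (hw : witness F n ℓ (i - 1) = witness F n ℓ' (i - 1)) :
    lastCt F net n E pad pk path k v ℓ i = lastCt F net n E pad pk path' k v ℓ' i := by
  simp only [lastCt, condPay, hp, ha, ht, hw]

end Trace

/-- The view of the corrupted parties, if the entries of the parties `ps` are given as strings. -/
def viewStr {N : ℕ} (C : Finset (Fin N)) :
    Bool → List (Fin N) → List Str → List Str → PMF (List Str)
  | _, [], _, _ => PMF.pure []
  | τ, P :: ps, as, bs =>
    if P ∈ C then
      (viewStr C τ ps as.tail bs.tail).map fun w =>
        (if τ then pairStr (bs.headD []) (as.headD []) else pairStr (as.headD []) (bs.headD []))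
          :: w
    else coin.bind fun τ' => viewStr C τ' ps as.tail bs.tail

/-- The parties along the segment are known in advance, so they can be hard-wired and the view
computed from strings alone. -/
theorem view_eq_viewStr {F : HomFun} {net : Network} {n : ℕ} (C : Finset (Fin net.N)) (τ : Bool)
    (ps : List (Fin net.N)) (as bs : List (Entry F net n)) (ha : as.map Entry.party = ps)
    (hb : bs.map Entry.party = ps) :
    view F net n C τ as bs = viewStr C τ ps (as.map Entry.toStr) (bs.map Entry.toStr) := by
  induction ps generalizing τ as bs with
  | nil =>
    rw [List.map_eq_nil_iff] at ha
    subst ha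
    simp [view, viewStr]
  | cons P ps ih =>
    rcases as with _ | ⟨a, as⟩
    · simp at ha
    rcases bs with _ | ⟨b, bs⟩
    · simp at hb
    simp only [List.map_cons, List.cons.injEq] at ha hb
    simp only [view, viewStr, ha.1, ih _ as bs ha.2 hb.2, List.map_cons, List.tail_cons,
      List.headD_cons]

/-! ## Efficiency -/

section Efficiency

variable {ι : Type*} {e : ι → Str} {N : ι → ℕ} {F : HomFun} {net : Network}
  {E : PKE} (pad : Padding E) {pk : ι → Fin net.N → Str} {φ : ℕ → Str → Str}
  (path : ℕ → Fin net.N) (k v : ℕ) {ℓ : ∀ i, ℕ → F.D (N i)}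

/-- Path, amounts and timelocks do not depend on the security parameter and are constants of the
program; only group elements and the inner ciphertext are computed. -/
theorem Det.hopStr {c : ι → Str} (hN : Det e fun i => unary (N i))
    (hℓ : ∀ t < k, Det e fun i => F.encD _ (ℓ i t)) (hc : Det e c) {j : ℕ} (hj : j < k) :
    Det e fun i => hopStr F net (N i) path k v (ℓ i) j (c i) := by
  have hw : ∀ t < k, Det e fun i => F.encD _ (witness F (N i) (ℓ i) t) := fun t ht =>
    Det.encD_witness F hN fun s hs => hℓ s (by omega)
  exact ((det_const (partyStr (path (j + 1)))).pair
    ((det_const (Nat.bits (amountAt net path k v j))).pair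
      ((Det.encR_eval F hN (hw (j - 1) (by omega))).pair ((Det.encR_eval F hN (hw j hj)).pair
        ((hℓ j hj).pair ((det_const (Nat.bits (timeAt net path k j))).pair hc)))))).push true

theorem Det.entryAt_toStr {c : ι → Str} (hN : Det e fun i => unary (N i))
    (hℓ : ∀ t < k, Det e fun i => F.encD _ (ℓ i t)) (hc : Det e c) {j : ℕ} (hj : j < k) :
    Det e fun i => (entryAt F net (N i) path k v (ℓ i) j (c i)).toStr :=
  (Det.hopStr path k v hN hℓ hc hj).pair
    (Det.encD_witness F hN fun s hs => hℓ s (by omega))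

/-- A ciphertext and some entries, as a string. -/
def traceStr {F : HomFun} {net : Network} {n : ℕ} (z : Str × List (Entry F net n)) : Str :=
  pairStr z.1 (joinStr (z.2.map Entry.toStr))

theorem Real.ext {c : ι → Str} (hN : Det e fun i => unary (N i))
    (hpk : ∀ P, Det e fun i => pk i P) (hφ : ∀ t, Det (fun x => x) (φ t))
    (hℓ : ∀ t < k, Det e fun i => F.encD _ (ℓ i t)) (hc : Det e c) (m : ℕ) {j : ℕ}
    (hj : j + m ≤ k) :
    Real e fun i => (ext F net (N i) E pad (pk i) φ path k v (ℓ i) m j (c i)).map traceStr := by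
  induction m generalizing j with
  | zero =>
    refine (hc.pair (det_const (joinStr []))).congr fun i => ?_
    simp [SyncPCN.ext, PMF.pure_map, traceStr]
  | succ m ih =>
    have h := Real.bind (out := fun i => traceStr (F := F) (net := net) (n := N i))
      (f := fun i z => (hopCt F net (N i) E pad (pk i) φ path k v (ℓ i) j z.1).map fun c' =>
        traceStr (c', entryAt F net (N i) path k v (ℓ i) j z.1 :: z.2))
      (ih (j := j + 1) (by omega)) ?_
    · refine h.congr fun i => ?_
      simp only [SyncPCN.ext, PMF.map_bind, PMF.map_comp, Function.comp_def]
    have hz := det_last (e := e) (out := fun i => traceStr (F := F) (net := net) (n := N i))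
    have hz1 := hz.fst
    have hz2 := hz.snd
    simp only [traceStr, unpairStr_pairStr] at hz1 hz2
    have hN' := Real.weaken (out := fun i => traceStr (F := F) (net := net) (n := N i)) hN
    have hℓ' := fun t ht => Real.weaken
      (out := fun i => traceStr (F := F) (net := net) (n := N i)) (hℓ t ht)
    have hct := Real.encryptPad E pad hN'
      (Real.weaken (out := fun i => traceStr (F := F) (net := net) (n := N i)) (hpk (path j)))
      (Real.of_str (hφ j) (Det.hopStr (net := net) path k v (ℓ := fun p => ℓ p.1) hN' hℓ' hz1
        (by omega : j < k)))
    refine (hct.pair (Det.joinStr_cons (Det.entryAt_toStr path k v (ℓ := fun p => ℓ p.1) hN' hℓ' hz1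
      (by omega : j < k)) hz2)).congr fun p => ?_
    simp only [PMF.pure_map]
    rfl

theorem Real.lastCt (hN : Det e fun i => unary (N i)) (hpk : ∀ P, Det e fun i => pk i P)
    (hℓ : ∀ t < k, Det e fun i => F.encD _ (ℓ i t)) {j : ℕ} (hj : j - 1 < k) :
    Real e fun i => lastCt F net (N i) E pad (pk i) path k v (ℓ i) j := by
  have hw : Det e fun i => F.encD _ (witness F (N i) (ℓ i) (j - 1)) :=
    Det.encD_witness F hN fun s hs => hℓ s (by omega)
  exact Real.encryptPad E pad hN (hpk _)
    (((det_const (Nat.bits (amountAt net path k v (j - 1)))).pair ((Det.encR_eval F hN hw).pair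
      (det_const (Nat.bits (timeAt net path k (j - 1)))))).push false)

theorem Real.trace (hN : Det e fun i => unary (N i))
    (hpk : ∀ P, Det e fun i => pk i P) (hφ : ∀ t, Det (fun x => x) (φ t))
    (hℓ : ∀ t < k, Det e fun i => F.encD _ (ℓ i t)) (d : ℕ) {j : ℕ} (hj : j + d ≤ k)
    (hk : 0 < k) :
    Real e fun i => (trace F net (N i) E pad (pk i) φ path k v (ℓ i) d j).map traceStr := by
  simp only [SyncPCN.trace, PMF.map_bind]
  refine Real.bind (out := fun _ c => c) ?_ ?_
  · have h : (fun x : Str => x) = id := rfl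
    simp only [h, PMF.map_id]
    exact Real.lastCt pad path k v hN hpk hℓ (by omega)
  · exact Real.ext (F := F) pad path k v (N := fun p : Σ _ : ι, Str => N p.1)
      (pk := fun p => pk p.1) (ℓ := fun p => ℓ p.1) (Real.weaken (out := fun _ c => c) hN)
      (fun P => Real.weaken (out := fun _ c => c) (hpk P)) hφ
      (fun t ht => Real.weaken (out := fun _ c => c) (hℓ t ht))
      (det_last (out := fun _ c => c)) d hj

theorem real_secrets (hN : Det e fun i => unary (N i)) :
    Real e fun i => (iid (F.sample (N i)) k).map fun r =>
      joinStr (List.ofFn fun j => F.encD _ (r j)) :=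
  Real.iid (real_sample F hN) k

theorem det_secrets (r : ∀ i, Fin k → F.D (N i))
    (h : Det e fun i => joinStr (List.ofFn fun j => F.encD _ (r i j))) :
    ∀ t < k, Det e fun i => F.encD _ (secrets (r i) t) := by
  intro t ht
  simpa [secrets, ht] using
    Det.joinStr_ofFn_apply (a := fun i j => F.encD _ (r i j)) h ⟨t, ht⟩

theorem Real.pay (hN : Det e fun i => unary (N i)) (hpk : ∀ P, Det e fun i => pk i P)
    (hφ : ∀ t, Det (fun x => x) (φ t)) (hk : 0 < k) :
    Real e fun i => (pay F net (N i) E pad (pk i) φ path k v).map joinStr := by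
  simp only [SyncPCN.pay, PMF.map_bind, PMF.map_comp]
  let out : ∀ i, (Fin k → F.D (N i)) → Str := fun i r =>
    joinStr (List.ofFn fun j => F.encD _ (r j))
  refine Real.bind (out := out) (real_secrets (F := F) k hN) ?_
  have h := Real.trace pad path k v (N := fun p : Σ i, (Fin k → F.D (N i)) => N p.1)
    (pk := fun p => pk p.1) (ℓ := fun p => secrets p.2) (Real.weaken (out := out) hN)
    (fun P => Real.weaken (out := out) (hpk P)) hφ
    (det_secrets k _ (det_last (e := e) (out := out))) (k - 1) (j := 1) (by omega) hk
  refine (Real.map h det_id.snd).congr fun p => ?_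
  rw [PMF.map_comp]
  congr 1
  funext z
  simp [traceStr, unpairStr_pairStr]

theorem Real.viewStr (C : Finset (Fin net.N)) (τ : Bool) (ps : List (Fin net.N))
    {as bs : ι → List Str} (ha : Det e fun i => joinStr (as i))
    (hb : Det e fun i => joinStr (bs i)) :
    Real e fun i => (viewStr C τ ps (as i) (bs i)).map joinStr := by
  induction ps generalizing τ as bs with
  | nil =>
    simp only [SyncPCN.viewStr, PMF.pure_map]
    exact det_const _
  | cons P ps ih =>
    by_cases hP : P ∈ C
    · simp only [SyncPCN.viewStr, hP, if_true, PMF.map_comp]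
      have hd : Det e fun i => if τ then pairStr ((bs i).headD []) ((as i).headD []) else
          pairStr ((as i).headD []) ((bs i).headD []) := by
        cases τ
        · exact ha.joinStr_headD.pair hb.joinStr_headD
        · exact hb.joinStr_headD.pair ha.joinStr_headD
      refine (Real.pair hd (ih τ ha.joinStr_tail hb.joinStr_tail)).congr fun i => ?_
      rw [PMF.pure_bind, PMF.map_comp]
      rfl
    · simp only [SyncPCN.viewStr, hP, if_false, PMF.map_bind]
      exact real_coin_bind fun τ' => ih τ' ha.joinStr_tail hb.joinStr_tail

end Efficiency

/-! ## Replacing the plaintext of an honest party -/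

/-- The identity, or, at the position `h` if `flag` is set, the replacement of a string by zeros. -/
def hide (h : ℕ) (flag : Bool) (i : ℕ) (m : Str) : Str :=
  if flag = true ∧ i = h then List.replicate m.length false else m

theorem hide_of_ne {h i : ℕ} (flag : Bool) (hi : i ≠ h) : hide h flag i = fun m => m := by
  funext m
  simp [hide, hi]

theorem hide_false (h : ℕ) : hide h false = fun _ m => m := by
  funext i m
  simp [hide]

theorem hide_self (h : ℕ) (flag : Bool) (m : Str) :
    hide h flag h m = if flag then List.replicate m.length false else m := by
  simp [hide]

theorem length_hide (h : ℕ) (flag : Bool) (i : ℕ) (m : Str) :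
    (hide h flag i m).length = m.length := by
  unfold hide
  split_ifs <;> simp

theorem det_hide (h : ℕ) (flag : Bool) (i : ℕ) : Det (fun x => x) (hide h flag i) := by
  by_cases hh : flag = true ∧ i = h
  · exact (det_id.replicate false).congr fun m => by simp [hide, hh]
  · exact det_id.congr fun m => by simp [hide, hh]

section

variable {F : HomFun} {net : Network} {n : ℕ} {E : PKE} {pad : Padding E}
  {pk : Fin net.N → Str} {path : ℕ → Fin net.N} {v : ℕ}

/-- There are `m₁` intermediaries before the distinguished one and `m₂` after it, so `k - 1 = m₁ + 1
+ m₂`. Hiding changes one layer only; with the encryption of that layer isolated, a challenge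
ciphertext can take its place. -/
theorem pay_hide_eq (m₁ m₂ : ℕ) {k : ℕ} (hk : k = m₁ + m₂ + 2) (flag : Bool) :
    pay F net n E pad pk (hide (m₁ + 1) flag) path k v =
      (iid (F.sample n) k).bind fun r =>
        (trace F net n E pad pk (fun _ m => m) path k v (secrets r) m₂ (m₁ + 2)).bind
          fun z => (encryptPad n E pad (pk (path (m₁ + 1))) (hide (m₁ + 1) flag (m₁ + 1)
              (hopStr F net n path k v (secrets r) (m₁ + 1) z.1))).bind
            fun c => (ext F net n E pad pk (fun _ m => m) path k v
              (secrets r) m₁ 1 c).map fun w => w.2.map Entry.toStr ++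
                (entryAt F net n path k v (secrets r) (m₁ + 1) z.1).toStr ::
                z.2.map Entry.toStr := by
  rw [pay]
  congr 1
  funext r
  have h1 : ∀ c, ext F net n E pad pk (hide (m₁ + 1) flag) path k v (secrets r) m₂
      (m₁ + 2) c = ext F net n E pad pk (fun _ m => m) path k v (secrets r) m₂
      (m₁ + 2) c := fun c =>
    ext_congr _ _ _ (fun t ht _ => hide_of_ne _ (by omega)) (fun _ _ _ => rfl)
      (fun _ _ _ => rfl) (fun _ _ _ => rfl) (fun _ _ _ => rfl) (fun _ _ _ => rfl)
  have h2 : ∀ c, ext F net n E pad pk (hide (m₁ + 1) flag) path k v (secrets r) m₁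
      1 c = ext F net n E pad pk (fun _ m => m) path k v (secrets r) m₁ 1 c :=
    fun c => ext_congr _ _ _ (fun t _ ht => hide_of_ne _ (by omega)) (fun _ _ _ => rfl)
      (fun _ _ _ => rfl) (fun _ _ _ => rfl) (fun _ _ _ => rfl) (fun _ _ _ => rfl)
  rw [show k - 1 = m₁ + (m₂ + 1) by omega, trace, trace,
    show 1 + (m₁ + (m₂ + 1)) = m₁ + 2 + m₂ by omega]
  simp only [PMF.bind_bind, PMF.map_bind, ext_add m₁ (m₂ + 1), show 1 + m₁ = m₁ + 1 by omega]
  simp only [ext, h1, h2, hopCt,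
    PMF.bind_bind, PMF.bind_map, PMF.map_comp, Function.comp_def, List.map_append,
    List.map_cons]

end

/-! ### The IND-CCA reduction and its first phase -/

section Hybrid

variable (E : PKE) (pad : Padding E) (F : HomFun) (net : Network) (C : Finset (Fin net.N))
  (A Q : Prog) (path : ℕ → Fin net.N) (v m₁ m₂ : ℕ)

/-- The input of the adversary: all public keys, and the secret keys of corrupted parties. -/
def advInput (n : ℕ) (pks sks : Fin net.N → Str) : Str :=
  pairStr (unary n) (pairStr (joinStr (List.ofFn pks)) (joinStr (List.ofFn sks)))

/-- The secret keys of the corrupted parties. -/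
def corruptKeys (K : Fin net.N → Str × Str) (P : Fin net.N) : Str :=
  if P ∈ C then (K P).2 else []

/-- The experiment with one payment: `A` gets the keys, and `Q` the entries of the payment, in which
the plaintext at position `m₁ + 1` may be replaced by zeros. -/
def payExp (flag : Bool) (n : ℕ) : PMF Bool :=
  (iid (E.keys n) net.N).bind fun K =>
    (output noOracle A (advInput net n (fun P => (K P).1) (corruptKeys net C K))).bind fun a =>
      (pay F net n E pad (fun P => (K P).1) (hide (m₁ + 1) flag) path (m₁ + m₂ + 2) v).bind
        fun es => (output noOracle Q (pairStr (unary n) (pairStr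
          (joinStr (List.ofFn fun P => (K P).1)) (pairStr a (joinStr es))))).map bitOf

/-- What the reduction remembers when it asks for the challenge: public keys, the output of `A`, the
secrets and the part of the payment after the honest party. -/
abbrev Memory (n : ℕ) : Type :=
  (Fin net.N → Str) × Str × (Fin (m₁ + m₂ + 2) → F.D n) × (Str × List (Entry F net n))

variable {net F m₁ m₂} in
def Memory.toStr {n : ℕ} (s : Memory F net m₁ m₂ n) : Str :=
  pairStr (joinStr (List.ofFn s.1)) (pairStr s.2.1
    (pairStr (joinStr (List.ofFn fun j => F.encD _ (s.2.2.1 j))) (traceStr s.2.2.2)))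

variable {net F m₁ m₂} in
/-- The plaintext for the honest party. -/
def Memory.plain {n : ℕ} (s : Memory F net m₁ m₂ n) : Str :=
  hopStr F net n path (m₁ + m₂ + 2) v (secrets s.2.2.1) (m₁ + 1) s.2.2.2.1

/-- The public keys, if that of the party `P₀` is `pk`. -/
def pubKeys (P₀ : Fin net.N) (pk : Str) (K : Fin net.N → Str × Str) (P : Fin net.N) : Str :=
  if P = P₀ then pk else (K P).1

/-- The reduction, before the challenge. -/
def reduction₁ (n : ℕ) (pk : Str) : PMF (Memory F net m₁ m₂ n) :=
  (iid (E.keys n) net.N).bind fun K =>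
    (output noOracle A (advInput net n (pubKeys net (path (m₁ + 1)) pk K)
      (corruptKeys net C K))).bind fun a =>
      (iid (F.sample n) (m₁ + m₂ + 2)).bind fun r =>
        (trace F net n E pad (pubKeys net (path (m₁ + 1)) pk K) (fun _ m => m) path (m₁ + m₂ + 2) v
          (secrets r) m₂ (m₁ + 2)).map fun z => (pubKeys net (path (m₁ + 1)) pk K, a, r, z)

/-- The reduction, with the challenge `c`. -/
def reduction₂ (n : ℕ) (c : Str) (s : Memory F net m₁ m₂ n) : PMF Str :=
  (ext F net n E pad s.1 (fun _ m => m) path (m₁ + m₂ + 2) v (secrets s.2.2.1) m₁ 1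
    (padStr (pad.len n (s.plain path v).length) c)).bind fun w =>
      output noOracle Q (pairStr (unary n) (pairStr (joinStr (List.ofFn s.1)) (pairStr s.2.1
        (joinStr (w.2.map Entry.toStr ++ (entryAt F net n path (m₁ + m₂ + 2) v
          (secrets s.2.2.1) (m₁ + 1) s.2.2.2.1).toStr :: s.2.2.2.2.map Entry.toStr)))))

/-- The output has the format of the first phase of the CCA game: the true plaintext, zeros of the
same length, and the state. -/
theorem real_reduction₁ (hA : IsPPT A) :
    Real (fun i : ℕ × Str => pairStr (unary i.1) i.2) fun i =>
      (reduction₁ E pad F net C A path v m₁ m₂ i.1 i.2).map fun s =>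
        pairStr (s.plain path v) (pairStr (List.replicate (s.plain path v).length false) s.toStr) := by
  simp only [reduction₁, PMF.map_bind, PMF.map_comp]
  have hN : Det (fun i : ℕ × Str => pairStr (unary i.1) i.2) fun i => unary i.1 := by
    simpa [unpairStr_pairStr] using
      (det_id (e := fun i : ℕ × Str => pairStr (unary i.1) i.2)).fst
  have hpk : Det (fun i : ℕ × Str => pairStr (unary i.1) i.2) fun i => i.2 := by
    simpa [unpairStr_pairStr] using
      (det_id (e := fun i : ℕ × Str => pairStr (unary i.1) i.2)).snd
  -- The context grows by one sample at a time: `oK` encodes the keys, `oA` the output of `A`, `oR`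
  -- the secrets, `oT` the payment beyond the honest party. Digits in the names of the facts below
  -- count the samples drawn so far.
  let oK : ℕ × Str → (Fin net.N → Str × Str) → Str := fun _ K =>
    joinStr (List.ofFn fun P => pairStr (K P).1 (K P).2)
  refine Real.bind (out := oK) (Real.iid (real_keys E hN) net.N) ?_
  have hN1 := Real.weaken (out := oK) hN
  have hpk1 := Real.weaken (out := oK) hpk
  have hK1 := Det.joinStr_ofFn_apply (det_last (e := fun i : ℕ × Str => pairStr (unary i.1) i.2)
    (out := oK))
  have hpks1 : ∀ P, Det (fun p : Σ _ : ℕ × Str, (Fin net.N → Str × Str) =>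
      pairStr (pairStr (unary p.1.1) p.1.2) (oK p.1 p.2)) fun p =>
      pubKeys net (path (m₁ + 1)) p.1.2 p.2 P := by
    intro P
    by_cases hP : P = path (m₁ + 1)
    · simpa only [pubKeys, hP, if_true] using hpk1
    · simpa only [pubKeys, hP, if_false, unpairStr_pairStr] using (hK1 P).fst
  have hsks1 : ∀ P, Det (fun p : Σ _ : ℕ × Str, (Fin net.N → Str × Str) =>
      pairStr (pairStr (unary p.1.1) p.1.2) (oK p.1 p.2)) fun p => corruptKeys net C p.2 P := by
    intro P
    by_cases hP : P ∈ C
    · simpa only [corruptKeys, hP, if_true, unpairStr_pairStr] using (hK1 P).snd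
    · simpa only [corruptKeys, hP, if_false] using det_const []
  let oA : (Σ _ : ℕ × Str, (Fin net.N → Str × Str)) → Str → Str := fun _ a => a
  refine Real.bind (out := oA) ?_ ?_
  · have h : oA = fun _ => id := rfl
    simp only [h, PMF.map_id]
    exact Real.of_str hA.real
      (Det.pair hN1 ((Det.joinStr_ofFn hpks1).pair (Det.joinStr_ofFn hsks1)))
  have hN2 := Real.weaken (out := oA) hN1
  have hpks2 := fun P => Real.weaken (out := oA) (hpks1 P)
  have ha2 := det_last (e := fun p : Σ _ : ℕ × Str, (Fin net.N → Str × Str) =>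
      pairStr (pairStr (unary p.1.1) p.1.2) (oK p.1 p.2)) (out := oA)
  let oR : ∀ p : (Σ _ : (Σ _ : ℕ × Str, (Fin net.N → Str × Str)), Str),
      (Fin (m₁ + m₂ + 2) → F.D p.1.1.1) → Str := fun p r =>
    joinStr (List.ofFn fun j => F.encD _ (r j))
  refine Real.bind (out := oR) (real_secrets _ hN2) ?_
  have hN3 := Real.weaken (out := oR) hN2
  have hpks3 := fun P => Real.weaken (out := oR) (hpks2 P)
  have ha3 := Real.weaken (out := oR) ha2
  have hr3 := det_last (e := fun p : (Σ _ : (Σ _ : ℕ × Str, (Fin net.N → Str × Str)), Str) =>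
      pairStr (pairStr (pairStr (unary p.1.1.1) p.1.1.2) (oK p.1.1 p.1.2)) (oA p.1 p.2)) (out := oR)
  have hℓ3 := det_secrets (F := F) (m₁ + m₂ + 2) (fun p : Σ p : (Σ _ : (Σ _ : ℕ × Str,
    (Fin net.N → Str × Str)), Str), (Fin (m₁ + m₂ + 2) → F.D p.1.1.1) => p.2) hr3
  let oT : ∀ p : Σ p : (Σ _ : (Σ _ : ℕ × Str, (Fin net.N → Str × Str)), Str),
      (Fin (m₁ + m₂ + 2) → F.D p.1.1.1), (Str × List (Entry F net p.1.1.1.1)) → Str :=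
    fun _ => traceStr
  refine Real.bind (out := oT) (Real.trace pad path (m₁ + m₂ + 2) v hN3 hpks3
    (fun _ => det_id) hℓ3 m₂ (by omega) (by omega)) ?_
  have hN4 := Real.weaken (out := oT) hN3
  have hpks4 := fun P => Real.weaken (out := oT) (hpks3 P)
  have ha4 := Real.weaken (out := oT) ha3
  have hr4 := Real.weaken (out := oT) hr3
  have hℓ4 := fun t ht => Real.weaken (out := oT) (hℓ3 t ht)
  have hz4 := det_last (e := fun p : Σ p : (Σ _ : (Σ _ : ℕ × Str, (Fin net.N → Str × Str)), Str),
      (Fin (m₁ + m₂ + 2) → F.D p.1.1.1) => pairStr (pairStr (pairStr (pairStr (unary p.1.1.1.1)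
      p.1.1.1.2) (oK p.1.1.1 p.1.1.2)) (oA p.1.1 p.1.2)) (oR p.1 p.2)) (out := oT)
  have hc4 := hz4.fst
  simp only [oT, traceStr, unpairStr_pairStr] at hc4
  have hm := Det.hopStr (F := F) (net := net) path (m₁ + m₂ + 2) v hN4 hℓ4 hc4
    (j := m₁ + 1) (by omega)
  exact hm.pair ((hm.replicate false).pair
    ((Det.joinStr_ofFn hpks4).pair (Det.pair ha4 (Det.pair hr4 hz4))))

end Hybrid

/-! ### The second phase of the reduction and the hybrid step -/

section Hybrid

variable (E : PKE) (pad : Padding E) (F : HomFun) (net : Network) (C : Finset (Fin net.N))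
  (A Q : Prog) (path : ℕ → Fin net.N) (v m₁ m₂ : ℕ)

theorem real_reduction₂ (hQ : IsPPT Q) :
    Real (fun i : Σ n : ℕ, Str × Memory F net m₁ m₂ n =>
      pairStr (unary i.1) (pairStr i.2.1 i.2.2.toStr)) fun i =>
      reduction₂ E pad F net Q path v m₁ m₂ i.1 i.2.1 i.2.2 := by
  set e : (Σ n : ℕ, Str × Memory F net m₁ m₂ n) → Str := fun i =>
    pairStr (unary i.1) (pairStr i.2.1 i.2.2.toStr) with he
  have hN : Det e fun i => unary i.1 := by
    simpa [he, unpairStr_pairStr] using (det_id (e := e)).fst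
  have h2 := (det_id (e := e)).snd
  have hc : Det e fun i => i.2.1 := by simpa [he, unpairStr_pairStr] using h2.fst
  have h3 : Det e fun i => Memory.toStr i.2.2 := by simpa [he, unpairStr_pairStr] using h2.snd
  simp only [Memory.toStr] at h3
  have hpks : ∀ P, Det e fun i => i.2.2.1 P := Det.joinStr_ofFn_apply (by
    simpa only [unpairStr_pairStr] using h3.fst)
  have h4 := h3.snd
  have ha : Det e fun i => i.2.2.2.1 := by simpa only [unpairStr_pairStr] using h4.fst
  have h5 := h4.snd
  have hℓ := det_secrets (F := F) (m₁ + m₂ + 2) (e := e) (fun i => i.2.2.2.2.1) (by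
    simpa only [unpairStr_pairStr] using h5.fst)
  have hz : Det e fun i => traceStr i.2.2.2.2.2 := by simpa only [unpairStr_pairStr] using h5.snd
  simp only [traceStr] at hz
  have hz1 : Det e fun i => i.2.2.2.2.2.1 := by simpa only [unpairStr_pairStr] using hz.fst
  have hz2 : Det e fun i => joinStr (i.2.2.2.2.2.2.map Entry.toStr) := by
    simpa only [unpairStr_pairStr] using hz.snd
  have hm : Det e fun i => i.2.2.plain path v :=
    Det.hopStr (F := F) (net := net) path (m₁ + m₂ + 2) v hN hℓ hz1 (j := m₁ + 1) (by omega)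
  have hlen : Det e fun i => unary (pad.len i.1 (i.2.2.plain path v).length) :=
    (Real.of_str pad.prog_ppt.real (hN.pair (hm.replicate true))).congr fun _ => pad.prog_spec _ _
  have hent := Det.entryAt_toStr (F := F) (net := net) path (m₁ + m₂ + 2) v hN hℓ hz1
    (j := m₁ + 1) (by omega)
  let out : ∀ i : Σ n : ℕ, Str × Memory F net m₁ m₂ n, (Str × List (Entry F net i.1)) → Str :=
    fun _ => traceStr
  refine Real.bind (out := out) (Real.ext pad path (m₁ + m₂ + 2) v hN hpks (fun _ => det_id) hℓ
    (Det.padStr hlen hc) m₁ (by omega)) ?_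
  refine Real.of_str hQ.real (Det.pair (Real.weaken (out := out) hN) (Det.pair
    (Real.weaken (out := out) (Det.joinStr_ofFn hpks)) (Det.pair (Real.weaken (out := out) ha) ?_)))
  refine Det.joinStr_append ?_ (Det.joinStr_cons (Real.weaken (out := out) hent)
    (Real.weaken (out := out) hz2))
  simpa only [out, traceStr, unpairStr_pairStr] using (det_last (e := e) (out := out)).snd

/-- The experiment with one payment, in terms of the reduction. -/
theorem payExp_eq (hh : path (m₁ + 1) ∉ C) (flag : Bool) (n : ℕ) :
    payExp E pad F net C A Q path v m₁ m₂ flag n =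
      (E.keys n).bind fun k => (reduction₁ E pad F net C A path v m₁ m₂ n k.1).bind fun s =>
        (E.encrypt n k.1 (if flag then List.replicate (s.plain path v).length false
          else s.plain path v)).bind fun c =>
            (reduction₂ E pad F net Q path v m₁ m₂ n c s).map bitOf := by
  obtain ⟨h, hP⟩ : ∃ h : Fin net.N, h = path (m₁ + 1) := ⟨_, rfl⟩
  have hpub : ∀ (K : Fin net.N → Str × Str) (k : Str × Str),
      (fun P => (Function.update K h k P).1) = pubKeys net (path (m₁ + 1)) k.1 K := by
    intro K k
    funext P
    by_cases hPh : P = h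
    · subst hPh
      simp [pubKeys, hP]
    · simp [pubKeys, ← hP, hPh]
  have hsec : ∀ (K : Fin net.N → Str × Str) (k : Str × Str),
      corruptKeys net C (Function.update K h k) = corruptKeys net C K := by
    intro K k
    funext P
    by_cases hPh : P = h
    · subst hPh
      simp [corruptKeys, hP, hh]
    · simp [corruptKeys, hPh]
  have hself : ∀ (K : Fin net.N → Str × Str) (pk : Str),
      pubKeys net (path (m₁ + 1)) pk K (path (m₁ + 1)) = pk := by simp [pubKeys]
  -- The key pair of the honest party is drawn separately and plays the role of the challenge key.
  -- By `hsec` its secret half is not handed to the adversary.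
  rw [payExp, iid_bind_update _ _ h]
  simp only [hpub, hsec, pay_hide_eq m₁ m₂ rfl, reduction₁, reduction₂, PMF.bind_bind,
    PMF.bind_map, PMF.map_bind, Function.comp_def, hself, encryptPad, length_hide]
  simp only [hide_self]
  rfl

/-- The two messages have equal length, so the fair-coin branch never occurs; as `P₁` and `P₂`
behave alike for all oracles, the refusal of the challenge plays no role. The bit then commutes to
the front. -/
theorem ccaGame_eq {P₁ P₂ : Prog} (n : ℕ)
    (h₁ : ∀ O pk, output O P₁ (pairStr (unary n) pk) =
      (reduction₁ E pad F net C A path v m₁ m₂ n pk).map fun s =>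
        pairStr (s.plain path v) (pairStr (List.replicate (s.plain path v).length false) s.toStr))
    (h₂ : ∀ O c (s : Memory F net m₁ m₂ n), output O P₂ (pairStr (unary n) (pairStr c s.toStr)) =
      reduction₂ E pad F net Q path v m₁ m₂ n c s) :
    E.ccaGame P₁ P₂ n = coin.bind fun b => (((E.keys n).bind fun k =>
      (reduction₁ E pad F net C A path v m₁ m₂ n k.1).bind fun s =>
        (E.encrypt n k.1 (if b then List.replicate (s.plain path v).length false
          else s.plain path v)).bind fun c =>
            (reduction₂ E pad F net Q path v m₁ m₂ n c s).map bitOf)).map (· == b) := by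
  have : E.ccaGame P₁ P₂ n = (E.keys n).bind fun k =>
      (output (E.decOracle k.2 ∅) P₁ (pairStr (unary n) k.1)).bind fun a =>
        if (unpairStr a).1.length = (unpairStr (unpairStr a).2).1.length then
          coin.bind fun b => (E.encrypt n k.1 (if b then (unpairStr (unpairStr a).2).1
            else (unpairStr a).1)).bind fun c => (output (E.decOracle k.2 {c}) P₂ (pairStr (unary n)
              (pairStr c (unpairStr (unpairStr a).2).2))).bind fun g => PMF.pure (bitOf g == b)
        else coin := rfl
  rw [this]
  simp only [h₁, PMF.bind_map, Function.comp_def, unpairStr_pairStr, List.length_replicate,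
    if_true, h₂, PMF.map_bind, PMF.map_comp]
  simp only [PMF.bind_comm coin]
  rfl

theorem prob_map_beq_true (p : PMF Bool) : prob (p.map (· == true)) = prob p := by
  have : (fun b : Bool => b == true) = id := by funext b; simp
  rw [this, PMF.map_id]

theorem prob_map_beq_false (p : PMF Bool) : prob (p.map (· == false)) = 1 - prob p := by
  rw [← PMF.bind_pure_comp, prob_bind_bool]
  simp [prob_pure]

/-- The plaintext of an honest party may be replaced by zeros. -/
theorem negligible_payExp_sub (hE : E.INDCCA) (hA : IsPPT A) (hQ : IsPPT Q)
    (hh : path (m₁ + 1) ∉ C) :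
    Negligible fun n => prob (payExp E pad F net C A Q path v m₁ m₂ true n) -
      prob (payExp E pad F net C A Q path v m₁ m₂ false n) := by
  obtain ⟨P₁, hP₁, h₁⟩ := real_reduction₁ E pad F net C A path v m₁ m₂ hA
  obtain ⟨P₂, hP₂, h₂⟩ := real_reduction₂ E pad F net Q path v m₁ m₂ hQ
  -- If `p₁` and `p₀` are the probabilities of output `true` with and without zeros, the game is won
  -- with probability `(p₁ + 1 - p₀) / 2`; hence the factor 2.
  refine ((hE P₁ P₂ hP₁ hP₂).const_mul 2).congr fun n => ?_
  have h := ccaGame_eq E pad F net C A Q path v m₁ m₂ n (fun O pk => h₁ O (n, pk))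
    (fun O c s => h₂ O ⟨n, c, s⟩)
  change 2 * (prob (E.ccaGame P₁ P₂ n) - 1 / 2) = _
  rw [h, prob_coin_bind, prob_map_beq_true, prob_map_beq_false, ← payExp_eq E pad F net C A Q path v
    m₁ m₂ hh, ← payExp_eq E pad F net C A Q path v m₁ m₂ hh]
  ring

end Hybrid

/-! ## Independence of the two parts of a payment -/

section Independence

variable {F : HomFun} {n k : ℕ}

/-- The distance of the sampled secrets from uniform. -/
def sampleError (F : HomFun) (n : ℕ) : ℝ :=
  ∑ x : F.D n, |(F.sample n x).toReal - 1 / (Fintype.card (F.D n) : ℝ)|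

/-- The secrets in which the one at position `h` is chosen so that `y_h = u`. -/
def rebase (h : Fin k) (u : F.D n) (r : Fin k → F.D n) : Fin k → F.D n :=
  Function.update r h (u - ∑ t ∈ Finset.range h, secrets r t)

theorem secrets_update_of_ne (h : Fin k) (x : F.D n) (r : Fin k → F.D n) {t : ℕ} (ht : t ≠ h) :
    secrets (Function.update r h x) t = secrets r t := by
  unfold secrets
  split_ifs with h1
  · rw [Function.update_of_ne]
    exact fun h2 => ht (congrArg Fin.val h2)
  · rfl

theorem secrets_update_self (h : Fin k) (x : F.D n) (r : Fin k → F.D n) :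
    secrets (Function.update r h x) h = x := by
  simp [secrets]

theorem witness_rebase (h : Fin k) (u : F.D n) (r : Fin k → F.D n) :
    witness F n (secrets (rebase h u r)) h = u := by
  have h1 : ∀ x, ∑ t ∈ Finset.range h, secrets (Function.update r h x) t =
      ∑ t ∈ Finset.range h, secrets r t := fun x =>
    Finset.sum_congr rfl fun t ht => secrets_update_of_ne h x r (Finset.mem_range.1 ht).ne
  rw [witness, Finset.sum_range_succ, rebase, secrets_update_self, h1]
  abel

/-- Making `ℓ_h` uniform costs the sampling error once. A translate of a uniform element is uniform,
so `y_h = u` may be drawn instead, with `ℓ_h` obtained by subtracting the earlier secrets. -/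
theorem abs_prob_iid_sub_le (h : Fin k) (T : (Fin k → F.D n) → PMF Bool) :
    |prob ((iid (F.sample n) k).bind T) - prob ((iid (F.sample n) k).bind fun r =>
      (PMF.uniformOfFintype (F.D n)).bind fun u => T (rebase h u r))| ≤ sampleError F n := by
  have h1 : ((iid (F.sample n) k).bind fun r =>
      (PMF.uniformOfFintype (F.D n)).bind fun u => T (rebase h u r)) =
      (PMF.uniformOfFintype (F.D n)).bind fun x =>
        (iid (F.sample n) k).bind fun r => T (Function.update r h x) := by
    conv_rhs => rw [PMF.bind_comm]
    congr 1
    funext r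
    exact uniform_bind_sub (∑ t ∈ Finset.range h, secrets r t) fun x => T (Function.update r h x)
  rw [h1, iid_bind_update _ _ h T]
  refine (abs_prob_bind_sub_le_sum _ _ _).trans (le_of_eq ?_)
  simp [sampleError, PMF.uniformOfFintype_apply]

variable {X Z : Type} (h : Fin k) (front : (ℕ → F.D n) → PMF X) (B B' : (ℕ → F.D n) → PMF Z)
  (G : X → Z → X → Z → PMF Bool)

/-- Two payments, with first parts `front` and second parts `B` and `B'`. -/
def twoParts : PMF Bool :=
  (iid (F.sample n) k).bind fun r => (B (secrets r)).bind fun z => (front (secrets r)).bind fun x =>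
    (iid (F.sample n) k).bind fun r' => (B' (secrets r')).bind fun z' =>
      (front (secrets r')).bind fun x' => G x z x' z'

/-- The same with a uniform secret at position `h`. -/
def twoPartsUnif : PMF Bool :=
  (iid (F.sample n) k).bind fun r => (PMF.uniformOfFintype (F.D n)).bind fun u =>
    (B (secrets (rebase h u r))).bind fun z => (front (secrets (rebase h u r))).bind fun x =>
      (iid (F.sample n) k).bind fun r' => (PMF.uniformOfFintype (F.D n)).bind fun u' =>
        (B' (secrets (rebase h u' r'))).bind fun z' =>
          (front (secrets (rebase h u' r'))).bind fun x' => G x z x' z'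

/-- One replacement for each of the two payments. -/
theorem abs_prob_twoParts_sub_le :
    |prob (twoParts (k := k) front B B' G) - prob (twoPartsUnif h front B B' G)| ≤
      2 * sampleError F n := by
  refine (abs_sub_le _ _ _).trans ((add_le_add (abs_prob_iid_sub_le h _) ?_).trans
    (two_mul _).ge)
  refine abs_prob_bind_sub_le _ _ _ _ fun r _ => abs_prob_bind_sub_le _ _ _ _ fun u _ =>
    abs_prob_bind_sub_le _ _ _ _ fun z _ => abs_prob_bind_sub_le _ _ _ _ fun x _ => ?_
  exact abs_prob_iid_sub_le h fun r' => (B' (secrets r')).bind fun z' =>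
    (front (secrets r')).bind fun x' => G x z x' z'

variable {front B B' G}

/-- With `y_h` drawn directly, front and back use disjoint independent samples: the front those
before `h`, the back `u` and those after `h`. Renaming the latter between the payments exchanges the
back parts, and symmetry of `G` in them absorbs the exchange. -/
theorem twoPartsUnif_swap
    (hf : ∀ ℓ ℓ', (∀ t < (h : ℕ), ℓ t = ℓ' t) → front ℓ = front ℓ')
    (hB : ∀ ℓ ℓ', witness F n ℓ h = witness F n ℓ' h → (∀ t > (h : ℕ), ℓ t = ℓ' t) → B ℓ = B ℓ')
    (hB' : ∀ ℓ ℓ', witness F n ℓ h = witness F n ℓ' h → (∀ t > (h : ℕ), ℓ t = ℓ' t) →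
      B' ℓ = B' ℓ')
    (hG : ∀ x z x' z', G x z x' z' = G x z' x' z) :
    twoPartsUnif h front B B' G = twoPartsUnif h front B' B G := by
  have e : ∀ B B' : (ℕ → F.D n) → PMF Z, twoPartsUnif h front B B' G =
      (iid (F.sample n) k).bind fun r => (iid (F.sample n) k).bind fun r' =>
        (PMF.uniformOfFintype (F.D n)).bind fun u => (PMF.uniformOfFintype (F.D n)).bind fun u' =>
          (B (secrets (rebase h u r))).bind fun z => (B' (secrets (rebase h u' r'))).bind fun z' =>
            (front (secrets r)).bind fun x => (front (secrets r')).bind fun x' => G x z x' z' := by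
    intro B B'
    have hf' : ∀ u r, front (secrets (rebase h u r)) = front (secrets r) := fun u r =>
      hf _ _ fun t ht => secrets_update_of_ne h _ r ht.ne
    rw [twoPartsUnif]
    simp only [hf']
    congr 1; funext r
    conv_rhs => rw [PMF.bind_comm]
    congr 1; funext u
    conv_rhs =>
      enter [2, r']
      rw [PMF.bind_comm]
    conv_rhs => rw [PMF.bind_comm]
    congr 1; funext z
    conv_lhs => rw [PMF.bind_comm]
    congr 1; funext r'
    conv_lhs => rw [PMF.bind_comm]
    congr 1; funext u'
    conv_lhs => rw [PMF.bind_comm]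
  -- Only secrets strictly after `h` change hands here; the uniform values `u` and `u'` are
  -- exchanged further down by commuting their draws.
  rw [e, e, iid_bind_swap _ _ (fun i => h < i)]
  congr 1; funext r; congr 1; funext r'
  have hf1 : ∀ r r' : Fin k → F.D n,
      front (secrets fun i => if h < i then r' i else r i) = front (secrets r) := by
    refine fun r r' => hf _ _ fun t ht => ?_
    unfold secrets
    split_ifs with h1
    · exact if_neg (not_lt.2 (le_of_lt ht))
    · rfl
  have hb : ∀ B : (ℕ → F.D n) → PMF Z, (∀ ℓ ℓ', witness F n ℓ h = witness F n ℓ' h →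
      (∀ t > (h : ℕ), ℓ t = ℓ' t) → B ℓ = B ℓ') → ∀ (u) (r r' : Fin k → F.D n),
      B (secrets (rebase h u fun i => if h < i then r' i else r i)) =
        B (secrets (rebase h u r')) := by
    intro B hB u r r'
    refine hB _ _ (by rw [witness_rebase, witness_rebase]) fun t ht => ?_
    rw [rebase, rebase, secrets_update_of_ne h _ _ (ne_of_gt ht),
      secrets_update_of_ne h _ _ (ne_of_gt ht)]
    unfold secrets
    split_ifs with h1
    · exact if_pos ht
    · rfl
  simp only [hf1, hb B hB, hb B' hB']
  conv_rhs => rw [PMF.bind_comm]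
  congr 1; funext u; congr 1; funext u'
  conv_rhs => rw [PMF.bind_comm]
  congr 1; funext z; congr 1; funext z'; congr 1; funext x; congr 1; funext x'
  exact hG _ _ _ _

/-- Up to the error of sampling, the second parts can be exchanged. -/
theorem abs_prob_twoParts_swap_le
    (hf : ∀ ℓ ℓ', (∀ t < (h : ℕ), ℓ t = ℓ' t) → front ℓ = front ℓ')
    (hB : ∀ ℓ ℓ', witness F n ℓ h = witness F n ℓ' h → (∀ t > (h : ℕ), ℓ t = ℓ' t) → B ℓ = B ℓ')
    (hB' : ∀ ℓ ℓ', witness F n ℓ h = witness F n ℓ' h → (∀ t > (h : ℕ), ℓ t = ℓ' t) →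
      B' ℓ = B' ℓ')
    (hG : ∀ x z x' z', G x z x' z' = G x z' x' z) :
    |prob (twoParts (k := k) front B' B G) - prob (twoParts (k := k) front B B' G)| ≤
      4 * sampleError F n := by
  have h1 := abs_prob_twoParts_sub_le h front B B' G
  have h2 := abs_prob_twoParts_sub_le h front B' B G
  rw [← twoPartsUnif_swap h hf hB hB' hG] at h2
  rw [abs_sub_le_iff] at *
  constructor <;> linarith [h1.1, h1.2, h2.1, h2.2]

end Independence

/-! ## Symmetry of the view -/

theorem coin_bind_not {β : Type} (f : Bool → PMF β) :
    (coin.bind fun b => f !b) = coin.bind f := by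
  ext x
  simp [PMF.bind_apply, coin, PMF.uniformOfFintype_apply, add_comm]

/-- Exchanging the two lists and flipping the presentation bit cancel at each corrupted party; at an
honest one the bit is redrawn. -/
theorem viewStr_not {N : ℕ} (C : Finset (Fin N)) (τ : Bool) (ps : List (Fin N))
    (as bs : List Str) : viewStr C (!τ) ps bs as = viewStr C τ ps as bs := by
  induction ps generalizing τ as bs with
  | nil => rfl
  | cons P ps ih =>
    simp only [viewStr]
    by_cases hP : P ∈ C
    · rw [if_pos hP, if_pos hP, ih]
      cases τ <;> rfl
    · rw [if_neg hP, if_neg hP, ← coin_bind_not]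
      simp only [ih]

/-- With a random presentation order, as after an honest party, it cannot be seen which list is the
first. -/
theorem coin_bind_viewStr_swap {N : ℕ} {β : Type} (C : Finset (Fin N)) (ps : List (Fin N))
    (as bs : List Str) (f : List Str → PMF β) :
    (coin.bind fun τ => (viewStr C τ ps as bs).bind f) =
      coin.bind fun τ => (viewStr C τ ps bs as).bind f := by
  rw [← coin_bind_not]
  simp only [viewStr_not]

/-- An honest party on the path separates the view into two parts. -/
theorem viewStr_append {N : ℕ} {C : Finset (Fin N)} {P : Fin N} (hP : P ∉ C)
    (ps ps' : List (Fin N)) (τ : Bool) {as bs : List Str} (ha : as.length = ps.length)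
    (hb : bs.length = ps.length) (a b : Str) (as' bs' : List Str) :
    viewStr C τ (ps ++ P :: ps') (as ++ a :: as') (bs ++ b :: bs') =
      (viewStr C τ ps as bs).bind fun w => coin.bind fun τ' =>
        (viewStr C τ' ps' as' bs').map fun w' => w ++ w' := by
  induction ps generalizing τ as bs with
  | nil =>
    rw [List.length_nil, List.length_eq_zero_iff] at ha hb
    subst ha hb
    simp only [List.nil_append, viewStr, hP, if_false, List.tail_cons, PMF.pure_bind]
    congr 1
    funext τ'
    exact (PMF.map_id _).symm
  | cons P' ps ih =>
    rcases as with _ | ⟨x, as⟩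
    · simp at ha
    rcases bs with _ | ⟨y, bs⟩
    · simp at hb
    simp only [List.length_cons, Nat.add_right_cancel_iff] at ha hb
    simp only [List.cons_append, viewStr, List.tail_cons, List.headD_cons]
    by_cases hP' : P' ∈ C
    · simp only [hP', if_true, ih _ ha hb, PMF.map_bind, PMF.map_comp, PMF.bind_map,
        Function.comp_def, List.cons_append]
    · simp only [hP', if_false, ih _ ha hb, PMF.bind_bind]

/-! ## Payments without information about the other part -/

section Lengths

variable {F : HomFun} {net : Network} {n : ℕ} {E : PKE} {pad : Padding E}
  {pk : Fin net.N → Str} {path path₀ : ℕ → Fin net.N} {k v : ℕ} {ℓ ℓ₀ : ℕ → F.D n}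

theorem length_of_mem_encryptPad {p sk m c : Str} (hk : (p, sk) ∈ (E.keys n).support)
    (hc : c ∈ (encryptPad n E pad p m).support) : c.length = pad.len n m.length + 1 := by
  simp only [encryptPad, PMF.support_map, Set.mem_image] at hc
  obtain ⟨c, hc, rfl⟩ := hc
  exact length_padStr (pad.bound n m _ hk c hc)

theorem length_partyStr {N : ℕ} (P : Fin N) : (partyStr P).length = N := by
  simp [partyStr]

theorem length_hopStr_congr {c c₀ : Str} (i : ℕ)
    (ha : amountAt net path k v i = amountAt net path₀ k v i)
    (ht : timeAt net path k i = timeAt net path₀ k i) (hc : c.length = c₀.length) :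
    (hopStr F net n path k v ℓ i c).length = (hopStr F net n path₀ k v ℓ₀ i c₀).length := by
  simp [hopStr, Payload.toStr, hopMsg, length_pairStr, length_partyStr, F.encR_length,
    F.encD_length, ha, ht, hc]

theorem length_eq_of_mem_ext (hpk : ∀ P, ∃ sk, (pk P, sk) ∈ (E.keys n).support)
    (ha : ∀ t, amountAt net path k v t = amountAt net path₀ k v t)
    (ht : ∀ t, timeAt net path k t = timeAt net path₀ k t) (m i : ℕ) {c c₀ : Str}
    (hc : c.length = c₀.length) :
    ∀ z ∈ (ext F net n E pad pk (fun _ m => m) path k v ℓ m i c).support,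
      ∀ z₀ ∈ (ext F net n E pad pk (fun _ m => m) path₀ k v ℓ₀ m i c₀).support,
        z.1.length = z₀.1.length := by
  induction m generalizing i with
  | zero =>
    simp [ext, hc]
  | succ m ih =>
    simp only [ext, PMF.mem_support_bind_iff, PMF.support_map, Set.mem_image]
    rintro _ ⟨z, hz, d, hd, rfl⟩ _ ⟨z₀, hz₀, d₀, hd₀, rfl⟩
    obtain ⟨sk, hsk⟩ := hpk (path i)
    obtain ⟨sk₀, hsk₀⟩ := hpk (path₀ i)
    dsimp only
    rw [length_of_mem_encryptPad hsk hd, length_of_mem_encryptPad hsk₀ hd₀,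
      length_hopStr_congr i (ha i) (ht i) (ih _ z hz z₀ hz₀)]

/-- Each field of a payload has a length fixed by `n`, by the network or by the equal amounts and
times, and padding passes this on to the next layer. The lengths thus reveal neither the receiver
nor the randomness. The key hypothesis is there because the padding bound holds for generated keys.
-/
theorem length_eq_of_mem_trace (hpk : ∀ P, ∃ sk, (pk P, sk) ∈ (E.keys n).support)
    (ha : ∀ t, amountAt net path k v t = amountAt net path₀ k v t)
    (ht : ∀ t, timeAt net path k t = timeAt net path₀ k t) (d i : ℕ) :
    ∀ z ∈ (trace F net n E pad pk (fun _ m => m) path k v ℓ d i).support,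
      ∀ z₀ ∈ (trace F net n E pad pk (fun _ m => m) path₀ k v ℓ₀ d i).support,
        z.1.length = z₀.1.length := by
  intro z hz z₀ hz₀
  rw [trace, PMF.mem_support_bind_iff] at hz hz₀
  obtain ⟨c, hc, hz⟩ := hz
  obtain ⟨c₀, hc₀, hz₀⟩ := hz₀
  refine length_eq_of_mem_ext hpk ha ht d i ?_ z hz z₀ hz₀
  obtain ⟨sk, hsk⟩ := hpk (path (i + d))
  obtain ⟨sk₀, hsk₀⟩ := hpk (path₀ (i + d))
  rw [length_of_mem_encryptPad hsk hc, length_of_mem_encryptPad hsk₀ hc₀]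
  simp [Payload.toStr, condPay, length_pairStr, F.encR_length, ha, ht]

end Lengths

/-! ### Splitting a payment at the honest party -/

section Parts

variable (F : HomFun) (net : Network) (n : ℕ) (E : PKE) (pad : Padding E)
  (pk : Fin net.N → Str) (path : ℕ → Fin net.N) (v m₁ m₂ : ℕ)

/-- The entries before position `m₁ + 1`, if the plaintext there consists of `L` zeros. -/
def frontPart (L : ℕ) (ℓ : ℕ → F.D n) : PMF (List Str) :=
  (encryptPad n E pad (pk (path (m₁ + 1))) (List.replicate L false)).bind fun c =>
    (ext F net n E pad pk (fun _ m => m) path (m₁ + m₂ + 2) v ℓ m₁ 1 c).map fun w =>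
      w.2.map Entry.toStr

/-- The entries after position `m₁ + 1`. -/
def backPart (ℓ : ℕ → F.D n) : PMF (List Str) :=
  (trace F net n E pad pk (fun _ m => m) path (m₁ + m₂ + 2) v ℓ m₂ (m₁ + 2)).map fun z =>
    z.2.map Entry.toStr

variable {F net n E pad pk path v m₁ m₂}

theorem frontPart_congr (L : ℕ) {ℓ ℓ' : ℕ → F.D n} (h : ∀ t < m₁ + 1, ℓ t = ℓ' t) :
    frontPart F net n E pad pk path v m₁ m₂ L ℓ = frontPart F net n E pad pk path v m₁ m₂ L ℓ' := by
  unfold frontPart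
  congr 1
  funext c
  rw [ext_congr m₁ 1 c (fun _ _ _ => rfl) (fun _ _ _ => rfl) (fun _ _ _ => rfl)
    (fun _ _ _ => rfl) (fun t _ ht => ?_) (fun t _ ht => h t (by omega))]
  exact Finset.sum_congr rfl fun s hs => h s (by have := Finset.mem_range.1 hs; omega)

/-- All later witnesses are obtained from `y_h`, where `h = m₁ + 1`, by adding later secrets;
neither the sender nor the earlier secrets enter otherwise. -/
theorem backPart_congr {path' : ℕ → Fin net.N} {ℓ ℓ' : ℕ → F.D n}
    (hp : ∀ t, 1 ≤ t → t ≤ m₁ + m₂ + 2 → path t = path' t)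
    (ha : ∀ t, amountAt net path (m₁ + m₂ + 2) v t = amountAt net path' (m₁ + m₂ + 2) v t)
    (ht : ∀ t, timeAt net path (m₁ + m₂ + 2) t = timeAt net path' (m₁ + m₂ + 2) t)
    (hw : witness F n ℓ (m₁ + 1) = witness F n ℓ' (m₁ + 1))
    (h : ∀ t > m₁ + 1, ℓ t = ℓ' t) :
    backPart F net n E pad pk path v m₁ m₂ ℓ = backPart F net n E pad pk path' v m₁ m₂ ℓ' := by
  have hw' : ∀ t, m₁ + 1 ≤ t → witness F n ℓ t = witness F n ℓ' t := by
    intro t ht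
    induction t, ht using Nat.le_induction with
    | base => exact hw
    | succ t ht ih =>
      simp only [witness] at ih ⊢
      rw [Finset.sum_range_succ, ih, h (t + 1) (by omega), Finset.sum_range_succ _ (t + 1)]
  unfold backPart trace
  rw [lastCt_congr _ (hp _ (by omega) (by omega)) (ha _) (ht _) (hw' _ (by omega))]
  congr 2
  funext c
  exact ext_congr m₂ (m₁ + 2) c (fun _ _ _ => rfl) (fun t h1 h2 => hp t (by omega) (by omega))
    (fun t _ _ => ha t) (fun t _ _ => ht t) (fun t h1 _ => hw' t (by omega))
    (fun t h1 _ => h t (by omega))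

/-- If the plaintext at position `m₁ + 1` is replaced by zeros, a payment consists of two parts. -/
theorem pay_hide_bind {path₀ : ℕ → Fin net.N} {β : Type} {L : ℕ}
    (hp : ∀ t, 1 ≤ t → t < m₁ + m₂ + 2 → path t = path₀ t)
    (ha : ∀ t, amountAt net path (m₁ + m₂ + 2) v t = amountAt net path₀ (m₁ + m₂ + 2) v t)
    (ht : ∀ t, timeAt net path (m₁ + m₂ + 2) t = timeAt net path₀ (m₁ + m₂ + 2) t)
    (hL : ∀ ℓ : ℕ → F.D n, ∀ z ∈ (trace F net n E pad pk (fun _ m => m) path (m₁ + m₂ + 2) v ℓ m₂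
      (m₁ + 2)).support, (hopStr F net n path (m₁ + m₂ + 2) v ℓ (m₁ + 1) z.1).length = L)
    (G : List Str → PMF β) (G' : List Str → List Str → PMF β)
    (hG : ∀ x y z, x.length = m₁ → G (x ++ y :: z) = G' x z) :
    (pay F net n E pad pk (hide (m₁ + 1) true) path (m₁ + m₂ + 2) v).bind G =
      (iid (F.sample n) (m₁ + m₂ + 2)).bind fun r =>
        (backPart F net n E pad pk path v m₁ m₂ (secrets r)).bind fun z =>
          (frontPart F net n E pad pk path₀ v m₁ m₂ L (secrets r)).bind fun x => G' x z := by
  rw [pay_hide_eq m₁ m₂ rfl, PMF.bind_bind]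
  congr 1
  funext r
  rw [PMF.bind_bind, backPart, PMF.bind_map]
  refine pmf_bind_congr fun z hz => ?_
  -- The hidden plaintext matters only through its length, which is `L` for every `z`; this is where
  -- the front loses its dependence on the back.
  rw [hide_self, if_pos rfl, hL _ z hz, hp (m₁ + 1) (by omega) (by omega)]
  simp only [Function.comp_def, frontPart, PMF.bind_bind, PMF.bind_map]
  congr 1
  funext c
  rw [ext_congr (path' := path₀) m₁ 1 c (fun _ _ _ => rfl)
    (fun t h1 h2 => hp t (by omega) (by omega)) (fun t _ _ => ha t) (fun t _ _ => ht t)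
    (fun _ _ _ => rfl) (fun _ _ _ => rfl)]
  refine pmf_bind_congr fun w hw => hG _ _ _ ?_
  have := congrArg List.length (party_of_mem_ext _ _ _ w hw)
  simpa using this

end Parts

/-! ## The experiment with two payments -/

section World

variable (E : PKE) (pad : Padding E) (F : HomFun) (net : Network) (C : Finset (Fin net.N))
  (A₁ A₂ : Prog) (key : Str) (ps : List (Fin net.N))

/-- The final output of the adversary, if its choice was given by the string `key`. -/
def finish (n : ℕ) (a : Str) (es es' : List Str) : PMF Str :=
  if (unpairStr a).1 = key then
    (viewStr C false ps es es').bind fun w =>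
      output noOracle A₂ (pairStr (unary n) (pairStr (joinStr w) (unpairStr a).2))
  else PMF.pure [false]

theorem Real.finish (hA₂ : IsPPT A₂) {ι : Type*} {e : ι → Str} {N : ι → ℕ} {a : ι → Str}
    {es es' : ι → List Str} (hN : Det e fun i => unary (N i)) (ha : Det e a)
    (h : Det e fun i => joinStr (es i)) (h' : Det e fun i => joinStr (es' i)) :
    Real e fun i => finish net C A₂ key ps (N i) (a i) (es i) (es' i) := by
  have hv : Real e fun i => (SyncPCN.viewStr C false ps (es i) (es' i)).bind fun w =>
      output noOracle A₂ (pairStr (unary (N i)) (pairStr (joinStr w) (unpairStr (a i)).2)) := by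
    let out : ι → List Str → Str := fun _ => joinStr
    exact Real.bind (out := out) (Real.viewStr C false ps h h') (Real.of_str hA₂.real
      (Det.pair (Real.weaken (out := out) hN) (Det.pair (det_last (e := e) (out := out))
        (Real.weaken (out := out) ha.snd))))
  refine (Real.ite (Det.decide_eq key ha.fst) hv (det_const [false])).congr fun i => ?_
  by_cases hk : (unpairStr (a i)).1 = key <;> simp [SyncPCN.finish, hk, bitOf]

variable (path path' : ℕ → Fin net.N) (v m₁ m₂ : ℕ)

/-- The experiment with payments on `path` and on `path'`, where the plaintexts at position
`m₁ + 1` may be replaced by zeros. -/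
def twoExp (flag flag' : Bool) (n : ℕ) : PMF Bool :=
  (iid (E.keys n) net.N).bind fun K =>
    (output noOracle A₁ (advInput net n (fun P => (K P).1) (corruptKeys net C K))).bind fun a =>
      (pay F net n E pad (fun P => (K P).1) (hide (m₁ + 1) flag) path (m₁ + m₂ + 2) v).bind
        fun es => (pay F net n E pad (fun P => (K P).1) (hide (m₁ + 1) flag') path'
          (m₁ + m₂ + 2) v).bind fun es' => (finish net C A₂ key ps n a es es').map bitOf

/-- While one payment is being attacked, the distinguisher makes the other one itself from the
public keys. The parameter `swap` puts the two into the right order. -/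
theorem exists_finish (hA₂ : IsPPT A₂) (flag swap : Bool) :
    ∃ Q, IsPPT Q ∧ ∀ n pks a es, output noOracle Q (pairStr (unary n) (pairStr
      (joinStr (List.ofFn pks)) (pairStr a (joinStr es)))) =
        (pay F net n E pad pks (hide (m₁ + 1) flag) path (m₁ + m₂ + 2) v).bind fun es' =>
          if swap then finish net C A₂ key ps n a es' es else finish net C A₂ key ps n a es es' := by
  let e : ℕ × (Fin net.N → Str) × Str × List Str → Str := fun i =>
    pairStr (unary i.1) (pairStr (joinStr (List.ofFn i.2.1)) (pairStr i.2.2.1 (joinStr i.2.2.2)))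
  have hN : Det e fun i => unary i.1 := by
    simpa [e, unpairStr_pairStr] using (det_id (e := e)).fst
  have h2 := (det_id (e := e)).snd
  have hpks : ∀ P, Det e fun i => i.2.1 P := Det.joinStr_ofFn_apply (by
    simpa [e, unpairStr_pairStr] using h2.fst)
  have h3 := h2.snd
  have ha : Det e fun i => i.2.2.1 := by simpa [e, unpairStr_pairStr] using h3.fst
  have hes : Det e fun i => joinStr i.2.2.2 := by simpa [e, unpairStr_pairStr] using h3.snd
  let out : ℕ × (Fin net.N → Str) × Str × List Str → List Str → Str := fun _ => joinStr
  have key : Real e fun i => (pay F net i.1 E pad i.2.1 (hide (m₁ + 1) flag) path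
      (m₁ + m₂ + 2) v).bind fun es' => if swap then finish net C A₂ key ps i.1 i.2.2.1 es' i.2.2.2
        else finish net C A₂ key ps i.1 i.2.2.1 i.2.2.2 es' := by
    refine Real.bind (out := out) (Real.pay pad path (m₁ + m₂ + 2) v hN hpks (det_hide _ _)
      (by omega)) ?_
    cases swap
    · exact Real.finish net C A₂ key ps hA₂ (Real.weaken (out := out) hN)
        (Real.weaken (out := out) ha) (Real.weaken (out := out) hes)
        (det_last (e := e) (out := out))
    · exact Real.finish net C A₂ key ps hA₂ (Real.weaken (out := out) hN)
        (Real.weaken (out := out) ha) (det_last (e := e) (out := out))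
        (Real.weaken (out := out) hes)
  obtain ⟨Q, hQ, hQ'⟩ := key
  exact ⟨Q, hQ, fun n pks a es => hQ' noOracle (n, pks, a, es)⟩

theorem negligible_twoExp_sub_left (hE : E.INDCCA) (hA₁ : IsPPT A₁) (hA₂ : IsPPT A₂)
    (hh : path (m₁ + 1) ∉ C) (flag' : Bool) :
    Negligible fun n =>
      prob (twoExp E pad F net C A₁ A₂ key ps path path' v m₁ m₂ true flag' n) -
        prob (twoExp E pad F net C A₁ A₂ key ps path path' v m₁ m₂ false flag' n) := by
  obtain ⟨Q, hQ, hQ'⟩ := exists_finish E pad F net C A₂ key ps path' v m₁ m₂ hA₂ flag' false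
  refine (negligible_payExp_sub E pad F net C A₁ Q path v m₁ m₂ hE hA₁ hQ hh).congr fun n => ?_
  have : ∀ flag, payExp E pad F net C A₁ Q path v m₁ m₂ flag n =
      twoExp E pad F net C A₁ A₂ key ps path path' v m₁ m₂ flag flag' n := by
    intro flag
    simp only [payExp, hQ' n, twoExp, PMF.map_bind, Bool.false_eq_true, if_false]
  rw [this, this]

theorem negligible_twoExp_sub_right (hE : E.INDCCA) (hA₁ : IsPPT A₁) (hA₂ : IsPPT A₂)
    (hh : path' (m₁ + 1) ∉ C) (flag : Bool) :
    Negligible fun n =>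
      prob (twoExp E pad F net C A₁ A₂ key ps path path' v m₁ m₂ flag true n) -
        prob (twoExp E pad F net C A₁ A₂ key ps path path' v m₁ m₂ flag false n) := by
  obtain ⟨Q, hQ, hQ'⟩ := exists_finish E pad F net C A₂ key ps path v m₁ m₂ hA₂ flag true
  refine (negligible_payExp_sub E pad F net C A₁ Q path' v m₁ m₂ hE hA₁ hQ hh).congr fun n => ?_
  have : ∀ flag', payExp E pad F net C A₁ Q path' v m₁ m₂ flag' n =
      twoExp E pad F net C A₁ A₂ key ps path path' v m₁ m₂ flag flag' n := by
    intro flag'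
    simp only [payExp, hQ' n, twoExp, PMF.map_bind, if_true]
    refine congrArg _ (funext fun K => congrArg _ (funext fun a => ?_))
    -- The distinguisher makes the payment on `path` after the attacked one, while the experiment
    -- makes it before.
    rw [PMF.bind_comm]
  rw [this, this]

theorem negligible_twoExp_sub (hE : E.INDCCA) (hA₁ : IsPPT A₁) (hA₂ : IsPPT A₂)
    (hh : path (m₁ + 1) ∉ C) (hh' : path' (m₁ + 1) ∉ C) :
    Negligible fun n =>
      prob (twoExp E pad F net C A₁ A₂ key ps path path' v m₁ m₂ true true n) -
        prob (twoExp E pad F net C A₁ A₂ key ps path path' v m₁ m₂ false false n) :=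
  ((negligible_twoExp_sub_left E pad F net C A₁ A₂ key ps path path' v m₁ m₂ hE hA₁ hA₂ hh
    true).add (negligible_twoExp_sub_right E pad F net C A₁ A₂ key ps path path' v m₁ m₂ hE hA₁ hA₂
      hh' false)).congr fun n => by ring

end World

/-! ## The paths of a choice -/

section Paths

variable {net : Network} (c : Choice net) {C : Finset (Fin net.N)}

theorem Choice.path_succ (i j : Bool) {t : ℕ} (ht : t < c.seg.length) :
    c.path i j (t + 1) = c.seg[t] := by
  simp [Choice.path, List.getElem?_append_left ht, List.getElem?_eq_getElem ht]

theorem Choice.path_last (i j : Bool) : c.path i j (c.seg.length + 1) = c.r j := by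
  simp [Choice.path]

theorem Choice.path_eq (i j i' j' : Bool) {t : ℕ} (h1 : 1 ≤ t) (h2 : t < c.seg.length + 1) :
    c.path i j t = c.path i' j' t := by
  obtain ⟨t, rfl⟩ := Nat.exists_eq_add_of_le' h1
  rw [c.path_succ i j (by omega), c.path_succ i' j' (by omega)]

theorem Choice.path_eq_of_pos (i i' j : Bool) {t : ℕ} (h1 : 1 ≤ t) (h2 : t ≤ c.seg.length + 1) :
    c.path i j t = c.path i' j t := by
  rcases h2.lt_or_eq with h | rfl
  · exact c.path_eq i j i' j h1 h
  · rw [c.path_last, c.path_last]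

/-- The channel from the sender is excluded from the sum, interior channels are shared, and on the
last one `f` agrees for both receivers. -/
theorem Choice.sum_path_eq (f : Fin net.N → Fin net.N → ℕ)
    (hf : ∀ P ∈ c.seg.getLast?, f P (c.r false) = f P (c.r true)) (i j : Bool) (t : ℕ) :
    ∑ q ∈ Finset.Ioo t (c.seg.length + 1), f (c.path i j q) (c.path i j (q + 1)) =
      ∑ q ∈ Finset.Ioo t (c.seg.length + 1),
        f (c.path false false q) (c.path false false (q + 1)) := by
  refine Finset.sum_congr rfl fun q hq => ?_
  rw [Finset.mem_Ioo] at hq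
  rw [c.path_eq i j false false (t := q) (by omega) hq.2]
  by_cases h : q < c.seg.length
  · rw [c.path_eq i j false false (t := q + 1) (by omega) (by omega)]
  · obtain rfl : q = c.seg.length := by omega
    rw [c.path_last, c.path_last]
    cases j
    · rfl
    · refine (hf _ ?_).symm
      have hpos : 0 < c.seg.length := by omega
      have := c.path_succ false false (t := c.seg.length - 1) (by omega)
      rw [Nat.sub_add_cancel hpos] at this
      rw [this, List.getLast?_eq_getElem?, List.getElem?_eq_getElem (by omega)]
      rfl

variable {c}

theorem Choice.Legal.amountAt_eq (hc : c.Legal C) (v : ℕ) (i j : Bool) (t : ℕ) :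
    amountAt net (c.path i j) (c.seg.length + 1) v t =
      amountAt net (c.path false false) (c.seg.length + 1) v t := by
  rw [amountAt, amountAt, c.sum_path_eq net.fee fun P hP => (hc.2.2.2.1 P hP).1]

theorem Choice.Legal.timeAt_eq (hc : c.Legal C) (i j : Bool) (t : ℕ) :
    timeAt net (c.path i j) (c.seg.length + 1) t =
      timeAt net (c.path false false) (c.seg.length + 1) t := by
  rw [timeAt, timeAt, c.sum_path_eq net.lock fun P hP => (hc.2.2.2.1 P hP).2, c.path_last,
    c.path_last]
  cases j
  · rfl
  · rw [hc.2.2.2.2]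

end Paths

/-! ### Exchanging the receivers -/

section Exchange

variable (E : PKE) (pad : Padding E) (F : HomFun) {net : Network} {C : Finset (Fin net.N)}
  (A₁ A₂ : Prog) (key : Str) {c : Choice net}

/-- With both honest plaintexts hidden, the comparison is purely statistical and holds for each
fixed tuple of generated keys and each output of `A₁`. The factor 4 is two payments in each of two
experiments. -/
theorem abs_prob_twoExp_swap_le (hc : c.Legal C) {l l' : List (Fin net.N)} {P : Fin net.N}
    (hseg : c.seg = l ++ P :: l') (hP : P ∉ C) (n : ℕ) :
    |prob (twoExp E pad F net C A₁ A₂ key c.seg (c.path false true) (c.path true false) c.value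
        l.length l'.length true true n) -
      prob (twoExp E pad F net C A₁ A₂ key c.seg (c.path false false) (c.path true true) c.value
        l.length l'.length true true n)| ≤ 4 * sampleError F n := by
  have hk : c.seg.length + 1 = l.length + l'.length + 2 := by
    rw [hseg, List.length_append, List.length_cons]
    omega
  have ha := fun i j t => hc.amountAt_eq c.value i j t
  have ht := fun i j t => hc.timeAt_eq i j t
  have hp := fun i j i' j' t (h1 : 1 ≤ t) (h2 : t < c.seg.length + 1) => c.path_eq i j i' j' h1 h2
  have hp' := fun i i' j t (h1 : 1 ≤ t) (h2 : t ≤ c.seg.length + 1) => c.path_eq_of_pos i i' j h1 h2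
  rw [hk] at ha ht hp hp'
  refine abs_prob_bind_sub_le _ _ _ _ fun K hK => abs_prob_bind_sub_le _ _ _ _ fun a _ => ?_
  have hpk : ∀ Q, ∃ sk, ((K Q).1, sk) ∈ (E.keys n).support := fun Q =>
    ⟨(K Q).2, mem_support_of_mem_iid hK Q⟩
  -- The common length `L` is read off an arbitrary reference run, with zero secrets and fixed
  -- endpoints.
  obtain ⟨z₀, hz₀⟩ := (trace F net n E pad (fun P => (K P).1) (fun _ m => m) (c.path false false)
    (l.length + l'.length + 2) c.value 0 l'.length (l.length + 2)).support_nonempty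
  obtain ⟨L, hL₀⟩ : ∃ L, (hopStr F net n (c.path false false) (l.length + l'.length + 2) c.value 0
    (l.length + 1) z₀.1).length = L := ⟨_, rfl⟩
  have hL : ∀ i j, ∀ ℓ : ℕ → F.D n, ∀ z ∈ (trace F net n E pad (fun P => (K P).1) (fun _ m => m)
      (c.path i j) (l.length + l'.length + 2) c.value ℓ l'.length (l.length + 2)).support,
      (hopStr F net n (c.path i j) (l.length + l'.length + 2) c.value ℓ (l.length + 1)
        z.1).length = L := by
    intro i j ℓ z hz
    rw [← hL₀]
    exact length_hopStr_congr _ (ha i j _) (ht i j _)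
      (length_eq_of_mem_trace hpk (ha i j) (ht i j) _ _ z hz z₀ hz₀)
  -- The adversary's guess as a function of the fronts `x, x'` and backs `z, z'`: the entries of the
  -- honest party drop out, and its coin separates the two halves of the view.
  let G : List Str → List Str → List Str → List Str → PMF Bool := fun x z x' z' =>
    if (unpairStr a).1 = key then (viewStr C false l x x').bind fun w => coin.bind fun τ =>
      (viewStr C τ l' z z').bind fun w' => (output noOracle A₂ (pairStr (unary n)
        (pairStr (joinStr (w ++ w')) (unpairStr a).2))).map bitOf
    else PMF.pure false
  have hfin : ∀ x y z x' y' z', x.length = l.length → x'.length = l.length →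
      (finish net C A₂ key c.seg n a (x ++ y :: z) (x' ++ y' :: z')).map bitOf = G x z x' z' := by
    intro x y z x' y' z' hx hx'
    simp only [finish, G]
    split_ifs
    · rw [hseg, viewStr_append hP _ _ _ hx hx']
      simp only [PMF.map_bind, PMF.bind_bind, PMF.bind_map]
      rfl
    · simp [PMF.pure_map, bitOf]
  -- The fronts have a common law for all endpoints and the backs depend only on the receiver, so
  -- both worlds are instances of `twoParts` with the backs in opposite order.
  have key : ∀ j j' : Bool,
      ((pay F net n E pad (fun P => (K P).1) (hide (l.length + 1) true) (c.path false j)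
        (l.length + l'.length + 2) c.value).bind fun es =>
        (pay F net n E pad (fun P => (K P).1) (hide (l.length + 1) true) (c.path true j')
          (l.length + l'.length + 2) c.value).bind fun es' =>
            (finish net C A₂ key c.seg n a es es').map bitOf) =
      twoParts (k := l.length + l'.length + 2)
        (frontPart F net n E pad (fun P => (K P).1) (c.path false false) c.value l.length
          l'.length L)
        (backPart F net n E pad (fun P => (K P).1) (c.path false j) c.value l.length l'.length)
        (backPart F net n E pad (fun P => (K P).1) (c.path false j') c.value l.length l'.length)
        G := by
    intro j j'
    rw [twoParts]
    refine pay_hide_bind (hp _ _ _ _) (ha _ _) (ht _ _) (hL _ _) _ _ fun x y z hx => ?_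
    have hb : ∀ ℓ, backPart F net n E pad (fun P => (K P).1) (c.path false j') c.value l.length
        l'.length ℓ = backPart F net n E pad (fun P => (K P).1) (c.path true j') c.value l.length
        l'.length ℓ := fun ℓ => backPart_congr (hp' _ _ _)
          (fun t => (ha _ _ t).trans (ha _ _ t).symm) (fun t => (ht _ _ t).trans (ht _ _ t).symm)
          rfl fun _ _ => rfl
    simp only [hb]
    exact pay_hide_bind (hp _ _ _ _) (ha _ _) (ht _ _) (hL _ _) _ _ fun x' y' z' hx' =>
      hfin x y z x' y' z' hx hx'
  rw [key, key]
  refine abs_prob_twoParts_swap_le (F := F) ⟨l.length + 1, by omega⟩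
    (fun ℓ ℓ' h => frontPart_congr L h)
    (fun ℓ ℓ' h1 h2 => backPart_congr (fun _ _ _ => rfl) (fun _ => rfl) (fun _ => rfl) h1 h2)
    (fun ℓ ℓ' h1 h2 => backPart_congr (fun _ _ _ => rfl) (fun _ => rfl) (fun _ => rfl) h1 h2) ?_
  intro x z x' z'
  simp only [G]
  congr 1
  congr 1
  funext w
  exact coin_bind_viewStr_swap C l' z z' _

/-- Exchanging the receivers changes the output of the adversary only with negligible
probability. -/
theorem negligible_twoExp_swap (hE : E.INDCCA) (hA₁ : IsPPT A₁) (hA₂ : IsPPT A₂) (hc : c.Legal C)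
    {l l' : List (Fin net.N)} {P : Fin net.N} (hseg : c.seg = l ++ P :: l') (hP : P ∉ C) :
    Negligible fun n =>
      prob (twoExp E pad F net C A₁ A₂ key c.seg (c.path false true) (c.path true false) c.value
        l.length l'.length false false n) -
      prob (twoExp E pad F net C A₁ A₂ key c.seg (c.path false false) (c.path true true) c.value
        l.length l'.length false false n) := by
  have hh : ∀ i j, c.path i j (l.length + 1) ∉ C := by
    intro i j
    rw [c.path_succ i j (by simp [hseg])]
    simpa [hseg] using hP
  have h1 := negligible_twoExp_sub E pad F net C A₁ A₂ key c.seg (c.path false true)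
    (c.path true false) c.value l.length l'.length hE hA₁ hA₂ (hh _ _) (hh _ _)
  have h2 := negligible_twoExp_sub E pad F net C A₁ A₂ key c.seg (c.path false false)
    (c.path true true) c.value l.length l'.length hE hA₁ hA₂ (hh _ _) (hh _ _)
  have h3 := Negligible.of_abs_le (F.sample_uniform.const_mul 4)
    (abs_prob_twoExp_swap_le E pad F A₁ A₂ key hc hseg hP)
  refine ((h3.sub h1).add h2).congr fun n => ?_
  ring

end Exchange

/-! ## Correctness of the protocol -/

theorem pairStr_inj {x y x' y' : Str} (h : pairStr x y = pairStr x' y') : x = x' ∧ y = y' := by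
  have := congrArg unpairStr h
  simpa [unpairStr_pairStr] using this

theorem partyStr_injective {N : ℕ} : Function.Injective (partyStr (N := N)) := by
  intro P Q h
  have := congrFun (List.ofFn_injective h) P
  simpa using this

theorem bits_injective : Function.Injective Nat.bits := by
  intro a b h
  have hd := congrArg (fun l : Str => l.foldr Nat.bit 0) h
  have : ∀ m : ℕ, m.bits.foldr Nat.bit 0 = m := by
    intro m
    induction m using Nat.binaryRec' with
    | zero => simp
    | bit b m hm ih => rw [Nat.bits_append_bit m b hm, List.foldr_cons, ih]
  simpa only [this] using hd

/-- `Payload.ofStr` returns a chosen preimage, so injectivity is needed to recover the payload that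
was sent. -/
theorem payload_toStr_injective {F : HomFun} {net : Network} {n : ℕ} :
    Function.Injective (Payload.toStr (F := F) (net := net) (n := n)) := by
  rintro (⟨P, a, y, y', l, t, o⟩ | ⟨a, y, t⟩) (⟨P', a', z, z', l', t', o'⟩ | ⟨a', z, t'⟩) h <;>
    simp only [Payload.toStr, List.cons.injEq, true_and, reduceCtorEq, false_and] at h
  · obtain ⟨h1, h⟩ := pairStr_inj h
    obtain ⟨h2, h⟩ := pairStr_inj h
    obtain ⟨h3, h⟩ := pairStr_inj h
    obtain ⟨h4, h⟩ := pairStr_inj h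
    obtain ⟨h5, h⟩ := pairStr_inj h
    obtain ⟨h6, rfl⟩ := pairStr_inj h
    rw [partyStr_injective h1, bits_injective h2, F.encR_inj n h3, F.encR_inj n h4,
      F.encD_inj n h5, bits_injective h6]
  · obtain ⟨h1, h⟩ := pairStr_inj h
    obtain ⟨h2, h3⟩ := pairStr_inj h
    rw [bits_injective h1, F.encR_inj n h2, bits_injective h3]

theorem payload_ofStr_toStr {F : HomFun} {net : Network} {n : ℕ} (M : Payload F net n) :
    Payload.ofStr M.toStr = some M := by
  have h : ∃ M' : Payload F net n, M'.toStr = M.toStr := ⟨M, rfl⟩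
  rw [Payload.ofStr, dif_pos h]
  exact congrArg some (payload_toStr_injective h.choose_spec)

theorem dec_unpadStr {E : PKE} {pad : Padding E} {n : ℕ} {pk sk m c : Str}
    (hk : (pk, sk) ∈ (E.keys n).support) (hc : c ∈ (encryptPad n E pad pk m).support) :
    E.dec sk (unpadStr c) = some m := by
  simp only [encryptPad, PMF.support_map, Set.mem_image] at hc
  obtain ⟨c, hc, rfl⟩ := hc
  simp only [PKE.keys, PMF.support_map, Set.mem_image] at hk
  obtain ⟨k, hk, hk'⟩ := hk
  rw [unpadStr_padStr]
  have h1 : (unpairStr k).1 = pk := congrArg Prod.fst hk'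
  have h2 : (unpairStr k).2 = sk := congrArg Prod.snd hk'
  rw [← h2]
  exact E.correct n m k hk c (by rw [h1]; exact hc)

/-! ### Honest execution of the locking and payment phases -/

section Locking

variable {F : HomFun} {net : Network} {n : ℕ} {E : PKE} {pad : Padding E}
  {pk sk : Fin net.N → Str} {path : ℕ → Fin net.N} {k v : ℕ} {ℓ : ℕ → F.D n}

theorem trace_succ (φ : ℕ → Str → Str) (d i : ℕ) :
    trace F net n E pad pk φ path k v ℓ (d + 1) i =
      (trace F net n E pad pk φ path k v ℓ d (i + 1)).bind fun z =>
        (hopCt F net n E pad pk φ path k v ℓ i z.1).map fun c' =>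
          (c', entryAt F net n path k v ℓ i z.1 :: z.2) := by
  rw [trace, trace, show i + 1 + d = i + (d + 1) by omega, PMF.bind_bind]
  rfl

/-- The balances after the locking on the first `i` channels of a path. -/
def balAfter (net : Network) (path : ℕ → Fin net.N) (k v : ℕ) (bal : Fin net.N → Fin net.N → ℕ)
    (i : ℕ) : Fin net.N → Fin net.N → ℕ :=
  fun P Q => bal P Q - ∑ j ∈ Finset.range i,
    if P = path j ∧ Q = path (j + 1) then amountAt net path k v j else 0

/-- The balance of `P_i` suffices for locking. -/
def CanLock (net : Network) (path : ℕ → Fin net.N) (k v : ℕ) (bal : Fin net.N → Fin net.N → ℕ)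
    (i : ℕ) : Prop :=
  amountAt net path k v i ≤ balAfter net path k v bal i (path i) (path (i + 1))

theorem balAfter_zero (bal : Fin net.N → Fin net.N → ℕ) : balAfter net path k v bal 0 = bal := by
  funext P Q
  simp [balAfter]

theorem lockCoins_balAfter (bal : Fin net.N → Fin net.N → ℕ) (i : ℕ) :
    lockCoins net (balAfter net path k v bal i) (path i) (path (i + 1)) (amountAt net path k v i) =
      balAfter net path k v bal (i + 1) := by
  funext P Q
  simp only [lockCoins, balAfter, Finset.sum_range_succ]
  split_ifs <;> omega

theorem amountAt_pred {i : ℕ} (hi : 1 ≤ i) (hk : i < k) :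
    amountAt net path k v (i - 1) = amountAt net path k v i + net.fee (path i) (path (i + 1)) := by
  have : Finset.Ioo (i - 1) k = insert i (Finset.Ioo i k) := by
    ext t
    simp only [Finset.mem_Ioo, Finset.mem_insert]
    omega
  rw [amountAt, amountAt, this, Finset.sum_insert (by simp)]
  omega

theorem timeAt_pred {i : ℕ} (hi : 1 ≤ i) (hk : i < k) :
    timeAt net path k (i - 1) = timeAt net path k i + net.lock (path i) (path (i + 1)) := by
  have : Finset.Ioo (i - 1) k = insert i (Finset.Ioo i k) := by
    ext t
    simp only [Finset.mem_Ioo, Finset.mem_insert]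
    omega
  rw [timeAt, timeAt, this, Finset.sum_insert (by simp)]
  omega

theorem witness_pred {i : ℕ} (hi : 1 ≤ i) :
    witness F n ℓ i = witness F n ℓ (i - 1) + ℓ i := by
  obtain ⟨i, rfl⟩ := Nat.exists_eq_add_of_le' hi
  simp [witness, Finset.sum_range_succ _ (i + 1)]

/-- The sender's setup makes the fee and timelock inequalities equalities and satisfies the
condition check by additivity of `H`. Given the channel, only the balance can fail. -/
theorem accepts_iff (bal : Fin net.N → Fin net.N → ℕ) {i : ℕ} (hi : 1 ≤ i) (hk : i < k) (c : Str)
    (hadj : net.chan.Adj (path i) (path (i + 1))) :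
    accepts F net n (balAfter net path k v bal i) (path i) (condPay F net n path k v ℓ (i - 1))
      (hopMsg F net n path k v ℓ i c) ↔ CanLock net path k v bal i := by
  refine ⟨fun h => h.2.1, fun h => ⟨hadj, h, ?_, ?_, rfl, ?_⟩⟩
  · exact (amountAt_pred hi hk).ge
  · exact (timeAt_pred hi hk).ge
  · simp only [hopMsg, condPay]
    rw [witness_pred hi, map_add, add_comm]

-- Perfect correctness makes every party decrypt the intended payload, so the outcome depends on the
-- random choices only through the recorded payloads; success is decided by the balances.
open Classical in
theorem lockFrom_eq (hkeys : ∀ P, (pk P, sk P) ∈ (E.keys n).support)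
    (hadj : ∀ t, t < k → net.chan.Adj (path t) (path (t + 1)))
    (bal : Fin net.N → Fin net.N → ℕ) (d i fuel : ℕ) (hi : 1 ≤ i) (hd : i + d = k)
    (hfuel : d + 1 ≤ fuel) :
    ∀ z ∈ (trace F net n E pad pk (fun _ m => m) path k v ℓ d i).support,
      lockFrom F net n E sk fuel (balAfter net path k v bal i) (path i)
        (condPay F net n path k v ℓ (i - 1)) z.1 =
      if ∀ t, i ≤ t → t < k → CanLock net path k v bal t then
        some (path k, balAfter net path k v bal k, z.2.map fun e => (e.party, e.msg)) else none := by
  induction d generalizing i fuel with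
  | zero =>
    obtain ⟨fuel, rfl⟩ := Nat.exists_eq_add_of_le' (show 1 ≤ fuel by omega)
    obtain rfl : i = k := by omega
    simp only [trace, ext, PMF.mem_support_bind_iff, PMF.mem_support_pure_iff]
    rintro z ⟨c, hc, rfl⟩
    rw [if_pos fun t h1 h2 => absurd h2 (by omega)]
    rw [Nat.add_zero, lastCt] at hc
    simp only [lockFrom, dec_unpadStr (hkeys _) hc, Option.bind_some, payload_ofStr_toStr]
    rw [if_pos]
    · rfl
    -- No timelocks remain to be added at the receiver, so `T_{k-1}` equals its expected value.
    · simp [condPay, timeAt]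
  | succ d ih =>
    obtain ⟨fuel, rfl⟩ := Nat.exists_eq_add_of_le' (show 1 ≤ fuel by omega)
    simp only [trace_succ, PMF.mem_support_bind_iff, PMF.support_map, Set.mem_image]
    rintro _ ⟨z, hz, c, hc, rfl⟩
    simp only [lockFrom, dec_unpadStr (hkeys _) hc, hopStr, Option.bind_some, payload_ofStr_toStr]
    rw [accepts_iff bal hi (by omega) z.1 (hadj i (by omega))]
    have h := ih (i + 1) fuel (by omega) (by omega) (by omega) z hz
    have hiff : (∀ t, i ≤ t → t < k → CanLock net path k v bal t) ↔ CanLock net path k v bal i ∧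
        ∀ t, i + 1 ≤ t → t < k → CanLock net path k v bal t := by
      refine ⟨fun h => ⟨h i le_rfl (by omega), fun t h1 h2 => h t (by omega) h2⟩, fun h t h1 h2 => ?_⟩
      rcases h1.eq_or_lt with rfl | h1
      exacts [h.1, h.2 t h1 h2]
    by_cases hl : CanLock net path k v bal i
    · rw [if_pos hl]
      -- The offer to the next party is `condPay` at `i` by definition; only the balances have to be
      -- rewritten.
      have : lockFrom F net n E sk fuel (lockCoins net (balAfter net path k v bal i) (path i)
          (hopMsg F net n path k v ℓ i z.1).next (hopMsg F net n path k v ℓ i z.1).amount)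
          (hopMsg F net n path k v ℓ i z.1).next ⟨(hopMsg F net n path k v ℓ i z.1).amount,
            (hopMsg F net n path k v ℓ i z.1).condOut, (hopMsg F net n path k v ℓ i z.1).time⟩
          (hopMsg F net n path k v ℓ i z.1).onion = _ :=
        (congrArg (fun b => lockFrom F net n E sk fuel b (path (i + 1))
          (condPay F net n path k v ℓ i) z.1) (lockCoins_balAfter bal i)).trans h
      rw [this]
      by_cases hr : ∀ t, i + 1 ≤ t → t < k → CanLock net path k v bal t
      · rw [if_pos hr, if_pos (hiff.2 ⟨hl, hr⟩)]
        rfl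
      · rw [if_neg hr, if_neg fun h => hr (hiff.1 h).2]
        rfl
    · rw [if_neg hl, if_neg fun h => hl (hiff.1 h).1]

/-- Every party on the path can lock the coins. -/
def CanPay (net : Network) (path : ℕ → Fin net.N) (k v : ℕ) (bal : Fin net.N → Fin net.N → ℕ) :
    Prop :=
  ∀ t < k, CanLock net path k v bal t

open Classical in
theorem lockPhase_eq (hkeys : ∀ P, (pk P, sk P) ∈ (E.keys n).support)
    (hadj : ∀ t, t < k → net.chan.Adj (path t) (path (t + 1)))
    (bal : Fin net.N → Fin net.N → ℕ) (hk : 1 ≤ k) (hN : k ≤ net.N) (y : F.D n) :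
    ∀ z ∈ (trace F net n E pad pk (fun _ m => m) path k v ℓ (k - 1) 1).support,
      lockPhase F net n E sk bal (path 0) (path 1) (path k) ⟨condPay F net n path k v ℓ 0, z.1, y⟩ =
        if CanPay net path k v bal then
          some (balAfter net path k v bal k, z.2.map fun e => (e.party, e.msg)) else none := by
  intro z hz
  have h := lockFrom_eq hkeys hadj bal (k - 1) 1 net.N le_rfl (by omega) (by omega) z hz
  rw [← lockCoins_balAfter bal 0, balAfter_zero] at h
  have h0 : CanLock net path k v bal 0 ↔ amountAt net path k v 0 ≤ bal (path 0) (path 1) := by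
    rw [CanLock, balAfter_zero]
  have hiff : CanPay net path k v bal ↔ CanLock net path k v bal 0 ∧
      ∀ t, 1 ≤ t → t < k → CanLock net path k v bal t := by
    refine ⟨fun h => ⟨h 0 hk, fun t _ h2 => h t h2⟩, fun h t h2 => ?_⟩
    rcases t.eq_zero_or_pos with rfl | h1
    exacts [h.1, h.2 t h1 h2]
  have h' : lockFrom F net n E sk net.N (lockCoins net bal (path 0) (path 1)
      (condPay F net n path k v ℓ 0).amount) (path 1) (condPay F net n path k v ℓ 0) z.1 = _ := h
  rw [lockPhase]
  by_cases hl : CanLock net path k v bal 0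
  · rw [if_pos ⟨hadj 0 hk, h0.1 hl⟩]
    dsimp only
    rw [h']
    by_cases hr : ∀ t, 1 ≤ t → t < k → CanLock net path k v bal t
    · rw [if_pos hr, if_pos (hiff.2 ⟨hl, hr⟩)]
      simp
    · rw [if_neg hr, if_neg fun h => hr (hiff.1 h).2]
      rfl
  · rw [if_neg fun h => hl (h0.2 h.2), if_neg fun h => hl (hiff.1 h).1]

/-- Subtracting `ℓ_i` from `y_i` gives back `y_{i-1}`, so the witnesses telescope and each satisfies
its condition by definition. -/
theorem payBack_eq (d i : ℕ) (hi : 1 ≤ i) (hd : i + d = k) :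
    ∀ z ∈ (trace F net n E pad pk (fun _ m => m) path k v ℓ d i).support,
      payBack F net n (witness F n ℓ (k - 1)) (z.2.map fun e => (e.party, e.msg)) =
        some (witness F n ℓ (i - 1), z.2) := by
  induction d generalizing i with
  | zero =>
    obtain rfl : i = k := by omega
    simp only [trace, ext, PMF.mem_support_bind_iff, PMF.mem_support_pure_iff]
    rintro z ⟨c, hc, rfl⟩
    rfl
  | succ d ih =>
    simp only [trace_succ, PMF.mem_support_bind_iff, PMF.support_map, Set.mem_image]
    rintro _ ⟨z, hz, c, hc, rfl⟩
    have h := ih (i + 1) (by omega) (by omega) z hz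
    rw [List.map_cons, payBack, h, Option.bind_some, Nat.add_sub_cancel]
    refine (if_pos (by rfl)).trans ?_
    simp [entryAt, hopMsg, witness_pred hi]

theorem payPhase_eq (hk : 1 ≤ k) (c : Str) :
    ∀ z ∈ (trace F net n E pad pk (fun _ m => m) path k v ℓ (k - 1) 1).support,
      payPhase F net n ⟨condPay F net n path k v ℓ 0, c, witness F n ℓ (k - 1)⟩
        (z.2.map fun e => (e.party, e.msg)) = some z.2 := by
  intro z hz
  rw [payPhase, payBack_eq (k - 1) 1 le_rfl (by omega) z hz, Option.bind_some]
  exact if_pos rfl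

end Locking

/-! ## Feasible choices -/

section Feasible

variable {net : Network} {C : Finset (Fin net.N)} {c : Choice net}

theorem Choice.Legal.path_inj (hc : c.Legal C) (i j : Bool) {t t' : ℕ}
    (ht : t ≤ c.seg.length + 1) (ht' : t' ≤ c.seg.length + 1)
    (h : c.path i j t = c.path i j t') : t = t' := by
  have hlen : (c.s i :: c.seg ++ [c.r j]).length = c.seg.length + 2 := by simp
  unfold Choice.path at h
  rw [List.getD_eq_getElem _ _ (by omega), List.getD_eq_getElem _ _ (by omega)] at h
  exact ((hc.2.2.1 i j).1.getElem_inj_iff).1 h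

theorem Choice.Legal.adj (hc : c.Legal C) (i j : Bool) {t : ℕ} (ht : t < c.seg.length + 1) :
    net.chan.Adj (c.path i j t) (c.path i j (t + 1)) := by
  have hlen : (c.s i :: c.seg ++ [c.r j]).length = c.seg.length + 2 := by simp
  unfold Choice.path
  rw [List.getD_eq_getElem _ _ (by omega), List.getD_eq_getElem _ _ (by omega)]
  exact List.isChain_iff_getElem.1 (hc.2.2.1 i j).2 t (by omega)

theorem Choice.Legal.length_le (hc : c.Legal C) : c.seg.length + 1 ≤ net.N := by
  have := (hc.2.2.1 false false).1.length_le_card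
  simp at this
  omega

/-- Both payments can be made. -/
def Choice.Feasible (c : Choice net) (b : Bool) : Prop :=
  CanPay net (c.path false b) (c.seg.length + 1) c.value net.bal ∧
    CanPay net (c.path true !b) (c.seg.length + 1) c.value
      (balAfter net (c.path false b) (c.seg.length + 1) c.value net.bal (c.seg.length + 1))

/-- A simple path leaves each of its parties at most once, so a payment does not compete with itself
for coins. -/
theorem Choice.Legal.balAfter_self (hc : c.Legal C) (i j : Bool) (v : ℕ)
    (bal : Fin net.N → Fin net.N → ℕ) {t : ℕ} (ht : t < c.seg.length + 1) :
    balAfter net (c.path i j) (c.seg.length + 1) v bal t (c.path i j t) (c.path i j (t + 1)) =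
      bal (c.path i j t) (c.path i j (t + 1)) := by
  rw [balAfter, Finset.sum_eq_zero, Nat.sub_zero]
  intro q hq
  rw [Finset.mem_range] at hq
  refine if_neg fun h => ?_
  have := hc.path_inj i j (by omega) (by omega) h.1
  omega

/-- The two paths agree in their interior and are simple, so the first payment can use a directed
channel of the second only at the same position. At most one summand survives. -/
theorem Choice.Legal.balAfter_other (hc : c.Legal C) (b : Bool) (v : ℕ)
    (bal : Fin net.N → Fin net.N → ℕ) {t : ℕ} (ht : t < c.seg.length + 1) :
    balAfter net (c.path false b) (c.seg.length + 1) v bal (c.seg.length + 1) (c.path true (!b) t)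
      (c.path true (!b) (t + 1)) = bal (c.path true (!b) t) (c.path true (!b) (t + 1)) -
        if c.path true (!b) t = c.path false b t ∧
          c.path true (!b) (t + 1) = c.path false b (t + 1)
        then amountAt net (c.path false false) (c.seg.length + 1) v t else 0 := by
  rw [balAfter, Finset.sum_eq_single t, hc.amountAt_eq]
  · intro q hq hqt
    rw [Finset.mem_range] at hq
    refine if_neg fun h => hqt ?_
    rcases t.eq_zero_or_pos with rfl | h0
    · rcases q.eq_zero_or_pos with rfl | hq0
      · rfl
      · rw [c.path_eq false b true (!b) hq0 hq] at h
        exact (hc.path_inj true (!b) (by omega) (by omega) h.1).symm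
    · rw [c.path_eq true (!b) false b h0 ht] at h
      exact (hc.path_inj false b (by omega) (by omega) h.1).symm
  · intro h
    exact absurd (Finset.mem_range.2 ht) h

theorem Choice.Legal.feasible_iff (hc : c.Legal C) (b : Bool) :
    c.Feasible b ↔ ∀ t < c.seg.length + 1,
      amountAt net (c.path false false) (c.seg.length + 1) c.value t ≤
        net.bal (c.path false b t) (c.path false b (t + 1)) ∧
      amountAt net (c.path false false) (c.seg.length + 1) c.value t ≤
        net.bal (c.path true (!b) t) (c.path true (!b) (t + 1)) -
          if c.path true (!b) t = c.path false b t ∧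
            c.path true (!b) (t + 1) = c.path false b (t + 1)
          then amountAt net (c.path false false) (c.seg.length + 1) c.value t else 0 := by
  rw [Choice.Feasible, CanPay, CanPay, ← forall₂_and]
  refine forall₂_congr fun t ht => ?_
  rw [CanLock, CanLock, hc.amountAt_eq _ false b, hc.amountAt_eq _ true (!b), hc.balAfter_self _ _ _ _ ht,
    hc.balAfter_self _ _ _ _ ht, hc.balAfter_other _ _ _ ht]

/-- Success must not leak the bit. All channels but the last are the same in both worlds. The last
channels are merely exchanged between the payments. -/
theorem Choice.Legal.feasible_false_iff_true (hc : c.Legal C) :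
    c.Feasible false ↔ c.Feasible true := by
  rw [hc.feasible_iff, hc.feasible_iff]
  refine forall₂_congr fun t ht => ?_
  simp only [Bool.not_false, Bool.not_true]
  by_cases hlt : t < c.seg.length
  · have h1 : ∀ i j, c.path i j t = c.path i false t := by
      intro i j
      rcases t.eq_zero_or_pos with rfl | h0
      · rfl
      · exact c.path_eq i j i false h0 ht
    have h2 : ∀ i j, c.path i j (t + 1) = c.path i false (t + 1) := fun i j =>
      c.path_eq i j i false (by omega) (by omega)
    rw [h1 true true, h1 false true, h2 true true, h2 false true]
  · obtain rfl : t = c.seg.length := by omega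
    have hpos : 0 < c.seg.length := by
      obtain ⟨P, hP, -⟩ := hc.1
      exact List.length_pos_of_mem hP
    have h1 : ∀ i j, c.path i j c.seg.length = c.path false false c.seg.length := fun i j =>
      c.path_eq i j false false hpos (by omega)
    simp only [c.path_last, h1 true true, h1 false true, h1 true false, true_and]
    -- With equal receivers both worlds coincide here; with distinct ones the payments use different
    -- last channels and do not interfere, so their conditions just trade places.
    by_cases hr : c.r false = c.r true
    · rw [hr]
    · rw [if_neg fun h => hr h.symm, if_neg hr, Nat.sub_zero, Nat.sub_zero, and_comm]

/-- The value is at most the sender's balance and the segment has no repetitions. The set does not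
depend on `n`, so a sum of negligible functions over it is negligible. -/
theorem finite_feasible (net : Network) (C : Finset (Fin net.N)) :
    {c : Choice net | c.Legal C ∧ c.Feasible false}.Finite := by
  let f : Choice net → (Bool → Fin net.N) × (Bool → Fin net.N) × ℕ × List (Fin net.N) :=
    fun c => (c.s, c.r, c.value, c.seg)
  have hf : Function.Injective f := by
    rintro ⟨s, r, v, l⟩ ⟨s', r', v', l'⟩ h
    simp only [f, Prod.mk.injEq] at h
    obtain ⟨rfl, rfl, rfl, rfl⟩ := h
    rfl
  have hl : {l : List (Fin net.N) | l.Nodup}.Finite :=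
    Set.finite_coe_iff.1 (inferInstanceAs (Finite {l : List (Fin net.N) // l.Nodup}))
  refine ((Set.finite_univ.prod (Set.finite_univ.prod
    ((Set.finite_le_nat (∑ P, ∑ Q, net.bal P Q)).prod hl))).preimage hf.injOn).subset ?_
  rintro c ⟨hc, hfe⟩
  refine ⟨trivial, trivial, ?_, ?_⟩
  · have h := hfe.1 0 (by omega)
    rw [CanLock, balAfter_zero] at h
    refine (Nat.le_add_right _ _).trans (h.trans ?_)
    exact (Finset.single_le_sum (f := fun Q => net.bal (c.path false false 0) Q)
      (fun _ _ => Nat.zero_le _) (Finset.mem_univ _)).trans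
      (Finset.single_le_sum (f := fun P => ∑ Q, net.bal P Q) (fun _ _ => Nat.zero_le _)
        (Finset.mem_univ _))
  · have := (hc.2.2.1 false false).1
    rw [List.cons_append] at this
    exact this.of_cons.of_append_left

end Feasible

/-! ## Two payments -/

section TwoPayments

variable (F : HomFun) (net : Network) (n : ℕ) (E : PKE) (pad : Padding E)
  (pk : Fin net.N → Str) (path : ℕ → Fin net.N) (k v : ℕ)

/-- The entries of the intermediaries in a payment. -/
def payEntries : PMF (List (Entry F net n)) :=
  (iid (F.sample n) k).bind fun r =>
    (trace F net n E pad pk (fun _ m => m) path k v (secrets r) (k - 1) 1).map Prod.snd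

theorem pay_eq_map (h : ℕ) :
    pay F net n E pad pk (hide h false) path k v =
      (payEntries F net n E pad pk path k v).map fun es => es.map Entry.toStr := by
  simp only [pay, payEntries, hide_false, PMF.map_bind, PMF.map_comp]
  rfl

variable {F net n E pad pk path k v}

theorem party_of_mem_payEntries {c : Choice net} {i j : Bool} :
    ∀ es ∈ (payEntries F net n E pad pk (c.path i j) (c.seg.length + 1) v).support,
      es.map Entry.party = c.seg := by
  simp only [payEntries, trace, PMF.map_bind, PMF.mem_support_bind_iff, PMF.support_map,
    Set.mem_image]
  rintro _ ⟨r, -, d, -, z, hz, rfl⟩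
  rw [party_of_mem_ext _ _ _ z hz]
  refine List.ext_getElem (by simp) fun t h1 h2 => ?_
  rw [List.getElem_map, List.getElem_range', one_mul, add_comm]
  exact c.path_succ i j h2

theorem setup_eq :
    setup F net n E pad pk path k v = (iid (F.sample n) k).bind fun r =>
      (trace F net n E pad pk (fun _ m => m) path k v (secrets r) (k - 1) 1).map fun z =>
        ⟨condPay F net n path k v (secrets r) 0, z.1, witness F n (secrets r) (k - 1)⟩ := by
  have : setup F net n E pad pk path k v = (iid (F.sample n) k).bind fun r =>
      (onionAt F net n E pad pk path k v (secrets r) (k - 1) 1).bind fun c => PMF.pure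
        ⟨condPay F net n path k v (secrets r) 0, c, witness F n (secrets r) (k - 1)⟩ := rfl
  rw [this]
  simp only [onionAt_eq, PMF.bind_map]
  rfl

/-- Success is a fixed proposition once paths, value and balances are given, so it separates from
the random entries. The second payment starts from the balances left by the first. -/
theorem setup_bind_setup_eq {sk : Fin net.N → Str} {path' : ℕ → Fin net.N}
    (hkeys : ∀ P, (pk P, sk P) ∈ (E.keys n).support)
    (hadj : ∀ t, t < k → net.chan.Adj (path t) (path (t + 1)))
    (hadj' : ∀ t, t < k → net.chan.Adj (path' t) (path' (t + 1))) (hk : 1 ≤ k) (hN : k ≤ net.N)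
    {ok : Prop} [Decidable ok] (hok : ok ↔ CanPay net path k v net.bal ∧
      CanPay net path' k v (balAfter net path k v net.bal k)) :
    ((setup F net n E pad pk path k v).bind fun S₀ => (setup F net n E pad pk path' k v).bind
      fun S₁ => PMF.pure
        ((lockPhase F net n E sk net.bal (path 0) (path 1) (path k) S₀).bind fun l₀ =>
          (lockPhase F net n E sk l₀.1 (path' 0) (path' 1) (path' k) S₁).bind fun l₁ =>
            (payPhase F net n S₀ l₀.2).bind fun e₀ =>
              (payPhase F net n S₁ l₁.2).map fun e₁ => (e₀, e₁))) =
      (payEntries F net n E pad pk path k v).bind fun es =>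
        (payEntries F net n E pad pk path' k v).bind fun es' =>
          PMF.pure (if ok then some (es, es') else none) := by
  simp only [setup_eq, payEntries, PMF.bind_bind, PMF.bind_map, Function.comp_def]
  congr 1
  funext r
  refine pmf_bind_congr fun z hz => ?_
  congr 1
  funext r'
  refine pmf_bind_congr fun z' hz' => ?_
  rw [lockPhase_eq hkeys hadj net.bal hk hN _ z hz]
  by_cases hf : CanPay net path k v net.bal
  · rw [if_pos hf, Option.bind_some, lockPhase_eq hkeys hadj' _ hk hN _ z' hz']
    by_cases hf' : CanPay net path' k v (balAfter net path k v net.bal k)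
    · rw [if_pos hf', if_pos (hok.2 ⟨hf, hf'⟩), Option.bind_some, payPhase_eq hk _ z hz,
        Option.bind_some, payPhase_eq hk _ z' hz']
      rfl
    · rw [if_neg hf', if_neg fun h => hf' (hok.1 h).2]
      rfl
  · rw [if_neg hf, if_neg fun h => hf (hok.1 h).1]
    rfl

open Classical in
theorem twoPayments_eq {keys : Fin net.N → Str × Str} (hkeys : ∀ P, keys P ∈ (E.keys n).support)
    {C : Finset (Fin net.N)} {c : Choice net} (hc : c.Legal C) (b : Bool) :
    twoPayments F net n E pad keys c b =
      (payEntries F net n E pad (fun P => (keys P).1) (c.path false b) (c.seg.length + 1)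
        c.value).bind fun es =>
        (payEntries F net n E pad (fun P => (keys P).1) (c.path true !b) (c.seg.length + 1)
          c.value).bind fun es' =>
            PMF.pure (if c.Feasible b then some (es, es') else none) :=
  setup_bind_setup_eq (path := c.path false b) (path' := c.path true !b) (sk := fun P => (keys P).2)
    hkeys (fun _ ht => hc.adj false b ht)
    (fun _ ht => hc.adj true (!b) ht) (Nat.le_add_left _ _) hc.length_le Iff.rfl

end TwoPayments

/-! ## The relationship anonymity game -/

section Game

variable (F : HomFun) (net : Network) (E : PKE) (pad : Padding E) (C : Finset (Fin net.N))
  (A₁ A₂ : Prog)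

theorem Choice.toStr_of_ofStr {net : Network} {w : Str} {c : Choice net}
    (h : Choice.ofStr net w = some c) : c.toStr = w := by
  rw [Choice.ofStr] at h
  split at h
  · rename_i hw
    rw [← Option.some.inj h]
    exact hw.choose_spec
  · exact absurd h (by simp)

/-- The guess of the adversary after its output `a`, if the payments are successful and the choice is
known to be `c`. -/
def guess (c : Choice net) (b : Bool) (n : ℕ) (pk : Fin net.N → Str) (a : Str) : PMF Bool :=
  (payEntries F net n E pad pk (c.path false b) (c.seg.length + 1) c.value).bind fun es =>
    (payEntries F net n E pad pk (c.path true !b) (c.seg.length + 1) c.value).bind fun es' =>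
      (finish net C A₂ c.toStr c.seg n a (es.map Entry.toStr) (es'.map Entry.toStr)).map bitOf

/-- The part of the game after the output `a` of the first adversary. -/
def gameAfter (n : ℕ) (keys : Fin net.N → Str × Str) (a : Str) : PMF Bool :=
  open Classical in
  match Choice.ofStr net (unpairStr a).1 with
  | none => coin
  | some c =>
    if c.Legal C then
      coin.bind fun b => (twoPayments F net n E pad keys c b).bind fun res =>
        match res with
        | none => coin
        | some e => (view F net n C false e.1 e.2).bind fun w =>
            (output noOracle A₂ (pairStr (unary n) (pairStr (joinStr w) (unpairStr a).2))).bind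
              fun g => PMF.pure (bitOf g == b)
    else coin

theorem anonymityGame_eq (n : ℕ) :
    anonymityGame F net n E pad C A₁ A₂ = (iid (E.keys n) net.N).bind fun K =>
      (output noOracle A₁ (advInput net n (fun P => (K P).1) (corruptKeys net C K))).bind
        (gameAfter F net E pad C A₂ n K) := by
  have : ∀ K, corruptKeys net C K = fun P => if P ∈ C then (K P).2 else [] := fun _ => rfl
  unfold anonymityGame gameAfter advInput
  simp only [this]
  congr!

theorem twoExp_eq (c : Choice net) (b : Bool) {m₁ m₂ : ℕ} (hk : m₁ + m₂ + 2 = c.seg.length + 1)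
    (n : ℕ) :
    twoExp E pad F net C A₁ A₂ c.toStr c.seg (c.path false b) (c.path true !b) c.value m₁ m₂ false
      false n = (iid (E.keys n) net.N).bind fun K =>
        (output noOracle A₁ (advInput net n (fun P => (K P).1) (corruptKeys net C K))).bind
          (guess F net E pad C A₂ c b n fun P => (K P).1) := by
  unfold twoExp
  rw [hk]
  simp only [pay_eq_map, PMF.bind_map]
  rfl

variable {F net E pad C A₂}

theorem guess_of_ne {c : Choice net} {b : Bool} {n : ℕ} {pk : Fin net.N → Str} {a : Str}
    (h : (unpairStr a).1 ≠ c.toStr) :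
    guess F net E pad C A₂ c b n pk a = PMF.pure false := by
  simp [guess, finish, h, PMF.bind_const, PMF.pure_map, bitOf]

-- At most one term of the sum is nonzero, that of the choice announced in `a`. With guesses `g₁`,
-- `g₀` in the two worlds, the game is won with probability `(P(g₁) + 1 - P(g₀)) / 2`. The condition
-- on `Choice.ofStr` in `S` keeps one choice per string, as decoding returns a chosen preimage.
open Classical in
theorem prob_gameAfter {n : ℕ} {keys : Fin net.N → Str × Str}
    (hkeys : ∀ P, keys P ∈ (E.keys n).support) {S : Finset (Choice net)}
    (hS : ∀ c, c ∈ S ↔ c.Legal C ∧ c.Feasible false ∧ Choice.ofStr net c.toStr = some c) (a : Str) :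
    prob (gameAfter F net E pad C A₂ n keys a) = 1 / 2 +
      ∑ c ∈ S, (prob (guess F net E pad C A₂ c true n (fun P => (keys P).1) a) -
        prob (guess F net E pad C A₂ c false n (fun P => (keys P).1) a)) / 2 := by
  have hne : ∀ c : Choice net, (unpairStr a).1 ≠ c.toStr →
      (prob (guess F net E pad C A₂ c true n (fun P => (keys P).1) a) -
        prob (guess F net E pad C A₂ c false n (fun P => (keys P).1) a)) / 2 = 0 := by
    intro c hc
    rw [guess_of_ne hc, guess_of_ne hc, sub_self, zero_div]
  by_cases hex : ∃ c ∈ S, c.toStr = (unpairStr a).1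
  · obtain ⟨c, hcS, hca⟩ := hex
    obtain ⟨hc, hf, hof⟩ := (hS c).1 hcS
    rw [Finset.sum_eq_single_of_mem c hcS]
    · have hof' : Choice.ofStr net (unpairStr a).1 = some c := hca ▸ hof
      have hb : ∀ b, c.Feasible b := by
        rintro (_ | _)
        exacts [hf, hc.feasible_false_iff_true.1 hf]
      have : gameAfter F net E pad C A₂ n keys a = coin.bind fun b =>
          (guess F net E pad C A₂ c b n (fun P => (keys P).1) a).map (· == b) := by
        simp only [gameAfter, hof', if_pos hc, guess, PMF.map_bind]
        congr 1
        funext b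
        rw [twoPayments_eq hkeys hc b]
        simp only [if_pos (hb b), PMF.bind_bind, PMF.pure_bind]
        refine pmf_bind_congr fun es hes => pmf_bind_congr fun es' hes' => ?_
        rw [view_eq_viewStr C false c.seg es es' (party_of_mem_payEntries es hes)
          (party_of_mem_payEntries es' hes'), finish, if_pos hca.symm, PMF.map_bind, PMF.map_bind]
        refine congrArg _ (funext fun w => ?_)
        rw [PMF.map_comp]
        rfl
      rw [this, prob_coin_bind, prob_map_beq_true, prob_map_beq_false]
      ring
    · intro c' hc' hcc'
      refine hne c' fun h => hcc' ?_
      have := ((hS c').1 hc').2.2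
      rw [← h, ← hca, hof] at this
      exact (Option.some.inj this).symm
  -- No choice in `S` was announced: the output is undecodable, illegal or infeasible, and each of
  -- these cases ends in a fair coin.
  · rw [Finset.sum_eq_zero fun c hc => hne c fun h => hex ⟨c, hc, h.symm⟩, add_zero]
    rw [← prob_coin]
    congr 1
    unfold gameAfter
    split
    · rfl
    · rename_i c hof
      split
      · rename_i hc
        have hca := Choice.toStr_of_ofStr hof
        have hf : ¬c.Feasible false := fun hf => hex ⟨c, (hS c).2 ⟨hc, hf, hca ▸ hof⟩, hca⟩
        have hb : ∀ b, ¬c.Feasible b := by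
          rintro (_ | _)
          exacts [hf, fun h => hf (hc.feasible_false_iff_true.2 h)]
        have : ∀ b, twoPayments F net n E pad keys c b = PMF.pure none := by
          intro b
          rw [twoPayments_eq hkeys hc b]
          simp only [if_neg (hb b), PMF.bind_const]
        simp only [this, PMF.pure_bind, PMF.bind_const]
      · rfl

theorem relationshipAnonymity (hE : E.INDCCA) (pad : Padding E) (F : HomFun) (net : Network) :
    RelationshipAnonymity E pad F net := by
  classical
  intro C A₁ A₂ hA₁ hA₂
  have hfin : {c : Choice net | c.Legal C ∧ c.Feasible false ∧
      Choice.ofStr net c.toStr = some c}.Finite :=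
    (finite_feasible net C).subset fun c hc => ⟨hc.1, hc.2.1⟩
  let after (c : Choice net) (b : Bool) (n : ℕ) (K : Fin net.N → Str × Str) : PMF Bool :=
    (output noOracle A₁ (advInput net n (fun P => (K P).1) (corruptKeys net C K))).bind
      (guess F net E pad C A₂ c b n fun P => (K P).1)
  let game (c : Choice net) (b : Bool) (n : ℕ) : PMF Bool :=
    (iid (E.keys n) net.N).bind (after c b n)
  have hgame : ∀ n, prob (anonymityGame F net n E pad C A₁ A₂) = 1 / 2 +
      ∑ c ∈ hfin.toFinset, (prob (game c true n) - prob (game c false n)) / 2 := by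
    intro n
    rw [anonymityGame_eq]
    exact prob_bind_eq_half_add _ _ _ (fun c K => after c true n K) (fun c K => after c false n K)
      fun K hK => prob_bind_eq_half_add _ _ _
        (fun c => guess F net E pad C A₂ c true n fun P => (K P).1)
        (fun c => guess F net E pad C A₂ c false n fun P => (K P).1) fun a _ =>
          prob_gameAfter (mem_support_of_mem_iid hK) (fun c => hfin.mem_toFinset) a
  have hneg : ∀ c ∈ hfin.toFinset,
      Negligible fun n => 1 / 2 * (prob (game c true n) - prob (game c false n)) := by
    intro c hc
    obtain ⟨hc, -, -⟩ := hfin.mem_toFinset.1 hc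
    obtain ⟨P, hP, hPC⟩ := hc.1
    -- Any honest party of the segment will do; the segment is cut there, with the cut depending
    -- only on `c`.
    obtain ⟨l, l', hseg⟩ := List.append_of_mem hP
    have h := negligible_twoExp_swap E pad F A₁ A₂ c.toStr hE hA₁ hA₂ hc hseg hPC
    have hk : l.length + l'.length + 2 = c.seg.length + 1 := by
      rw [hseg, List.length_append, List.length_cons]
      omega
    refine Negligible.const_mul ?_ _
    have ht := twoExp_eq F net E pad C A₁ A₂ c true hk
    have hf := twoExp_eq F net E pad C A₁ A₂ c false hk
    simp only [Bool.not_true, Bool.not_false] at ht hf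
    simpa only [ht, hf] using h
  have := Negligible.sum _ hneg
  unfold NegligibleAdvantage
  convert this using 2 with n
  have h := hgame n
  rw [prob] at h
  rw [h, add_sub_cancel_left]
  exact Finset.sum_congr rfl fun c _ => by ring

end Game

end

end SyncPCN

theorem mainTheorem3 (E : SyncPCN.PKE) (hE : E.INDCCA) (pad : SyncPCN.Padding E)
    (F : SyncPCN.HomFun) (hF : F.OneWay) (net : SyncPCN.Network) :
    SyncPCN.RelationshipAnonymity E pad F net :=
  SyncPCN.relationshipAnonymity hE pad F net
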